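/- **Setting.** Let $n\in\{1,2,3\}$, let $\mathcal O=\prod_{i=1}^n[a_i,a_i+L]$ be a cube, and let $\Omega\subset\mathcal O$ be a connected open set with $\Omega=\{\varphi<0\}$, $\Gamma:=\partial\Omega=\{\varphi=0\}$ and $\nabla\varphi\neq0$ on $\Gamma$. For $N\in\mathbb N^*$ put $h=L/N$, $x_\alpha=a+\alpha h$ for $\alpha\in\{0,\dots,N\}^n$, and let $D$ be the set of the $n$ coordinate unit vectors. Let $\Omega_h^{\rm int}$ be the set of nodes $x_\alpha\in\Omega$, $\Omega_h$ the set of nodes that are in $\Omega$ or have a neighbor $x_{\alpha\pm d}$, $d\in D$, in $\Omega$, and $\overline\Omega_h$ the union of the closed grid cells that intersect $\Omega$. Let $r>0$ and suppose that $\Omega$ is $r$-smooth: for each $x_0\in\Gamma$ there is a cone with apex $x_0$, opening angle strictly greater than $\pi/2$ and radius $r$ that is included in $\overline\Omega$. Suppose that $\varphi\in\mathcal C^2(\overline\Omega_h)$ (that is, $\varphi$ is $\mathcal C^2$ on a neighborhood of $\overline\Omega_h$) for all $h=L/N<2r/\sqrt{10}$. **Scheme.** Write $\varphi_\alpha=\varphi(x_\alpha)$,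 $f_\alpha=f(x_\alpha)$. Let $B$ be the set of pairs $(\alpha,d)$, $d\in D$, with $x_\alpha,x_{\alpha+d}\in\Omega_h$ whose edge $[x_\alpha,x_{\alpha+d}]$ intersects $\Gamma$ and is not included in $\Gamma$, and let $J$ be the set of pairs $(\alpha,d)$, $d\in D$, with $x_\alpha\in\Omega$ and ($x_{\alpha-d}\notin\Omega$ or $x_{\alpha+d}\notin\Omega$). For parameters $\sigma,\gamma>0$ and discrete functions $u_h,v_h$ on $\Omega_h$ put $$a_h(u_h,v_h)=\sum_{\alpha:x_\alpha\in\Omega_h^{\rm int}}\sum_{d\in D}\frac{-u_{\alpha-d}+2u_\alpha-u_{\alpha+d}}{h^2}v_\alpha+b_h(u_h,v_h)+j_h(u_h,v_h),$$ $$b_h(u_h,v_h)=\frac{\gamma}{2h^2}\sum_{(\alpha,d)\in B}\frac{(\varphi_{\alpha+d}u_\alpha-\varphi_\alpha u_{\alpha+d})(\varphi_{\alpha+d}v_\alpha-\varphi_\alpha v_{\alpha+d})}{\varphi_\alpha^2+\varphi_{\alpha+d}^2}$$ (a summand with $\varphi_\alpha=\varphi_{\alpha+d}=0$ is read as $0$),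 $$j_h(u_h,v_h)=\sigma\sum_{(\alpha,d)\in J}\frac{-u_{\alpha-d}+2u_\alpha-u_{\alpha+d}}{h}\cdot\frac{-v_{\alpha-d}+2v_\alpha-v_{\alpha+d}}{h},\qquad l_h(v_h)=\sum_{\alpha:x_\alpha\in\Omega_h^{\rm int}}f_\alpha v_\alpha .$$ The discrete problem is to find $u_h$ on $\Omega_h$ with $a_h(u_h,v_h)=l_h(v_h)$ for all $v_h$ on $\Omega_h$. **Theorem 1 (Convergence).** There are $\sigma_0,\gamma_0>0$ such that for all $\sigma\ge\sigma_0$ and $\gamma\ge\gamma_0$ there is a constant $C>0$, independent of $h$, $f$ and $u$, with the following property. For every $h=L/N<\frac{2r}{\sqrt{10}}$ and every $f\in\mathcal C^0(\Omega)$ for which the solution $u$ of $-\Delta u=f$ in $\Omega$, $u=0$ on $\Gamma$, is in $\mathcal C^4(\Omega)$ with finite norm $\|u\|_{\mathcal C^4(\Omega)}$ (the supremum over $\Omega$ of the derivatives of order at most $4$), the discrete problem has a unique solution $u_h$, and with $U=(u(x_\alpha))_\alpha$ $$\|U-u_h\|_{h,0}+\|U-u_h\|_{h,\infty}+|U-u_h|_{h,1}\le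 C\,h^{3/2}\,\|u\|_{\mathcal C^4(\Omega)},$$ where $\|v\|_{h,0}=\bigl(h^n\sum_{x_\alpha\in\Omega_h^{\rm int}}v_\alpha^2\bigr)^{1/2}$, $\|v\|_{h,\infty}=\max_{x_\alpha\in\Omega_h^{\rm int}}|v_\alpha|$ and $|v|_{h,1}=\bigl(\sum_{d\in D,\;x_\alpha,x_{\alpha+d}\in\Omega_h^{\rm int}}h^n|(v_{\alpha+d}-v_\alpha)/h|^2\bigr)^{1/2}$. -/

import Mathlib

open scoped ENNReal

noncomputable section

namespace PhiFD

/-- The Euclidean space `ℝⁿ`. -/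
abbrev Pt (n : ℕ) : Type := EuclideanSpace ℝ (Fin n)

/-! ### Continuous objects -/

/-- The cube `∏ᵢ [aᵢ, aᵢ + L]`. -/
def box {n : ℕ} (a : Pt n) (L : ℝ) : Set (Pt n) :=
  {x | ∀ i, a i ≤ x i ∧ x i ≤ a i + L}

/-- The solid round cone with apex `x₀`, unit axis `e`, (full) opening angle `θ` and radius `r`. -/
def cone {n : ℕ} (x₀ e : Pt n) (θ r : ℝ) : Set (Pt n) :=
  {y | ‖y - x₀‖ ≤ r ∧ Real.cos (θ / 2) * ‖y - x₀‖ ≤ inner ℝ (y - x₀) e}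

/-- `Ω` is `r`-smooth: at each boundary point, the closure of `Ω` contains a cone centered at that
point, with opening angle strictly greater than `π / 2` and radius `r`. -/
def IsRSmooth {n : ℕ} (Ω : Set (Pt n)) (r : ℝ) : Prop :=
  ∀ x₀ ∈ frontier Ω, ∃ e : Pt n, ‖e‖ = 1 ∧
    ∃ θ : ℝ, Real.pi / 2 < θ ∧ θ ≤ 2 * Real.pi ∧ cone x₀ e θ r ⊆ closure Ω

/-- `Ω = {φ < 0}`, with boundary `{φ = 0}` on which the gradient of `φ` does not vanish. -/
structure IsLevelSet {n : ℕ} (Ω : Set (Pt n)) (φ : Pt n → ℝ) : Prop where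
  eq_neg : Ω = {x | φ x < 0}
  frontier_eq : frontier Ω = {x | φ x = 0}
  fderiv_ne_zero : ∀ x ∈ frontier Ω, fderiv ℝ φ x ≠ 0

/-- `φ ∈ C²(K)` for a closed set `K`: `φ` is twice continuously differentiable on a neighborhood
of each point of `K`, that is, on an open set that contains `K`. -/
def IsC2OnClosed {n : ℕ} (φ : Pt n → ℝ) (K : Set (Pt n)) : Prop :=
  ∀ x ∈ K, ContDiffAt ℝ 2 φ x

/-- `u` is a classical solution of `-Δu = f` in `Ω`, `u = 0` on `∂Ω`, with `f` continuous. -/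
structure IsPoissonSolution {n : ℕ} (Ω : Set (Pt n)) (f u : Pt n → ℝ) : Prop where
  continuousOn_rhs : ContinuousOn f Ω
  contDiffOn : ContDiffOn ℝ 2 u Ω
  continuousOn : ContinuousOn u (closure Ω)
  equation : ∀ x ∈ Ω, -(Laplacian.laplacian u x) = f x
  boundary : ∀ x ∈ frontier Ω, u x = 0

/-- The `C⁴` norm on an open set `Ω`: the supremum over `Ω` of the norms of the derivatives of
order at most four (possibly `∞`). -/
def c4Norm {n : ℕ} (Ω : Set (Pt n)) (u : Pt n → ℝ) : ℝ≥0∞ :=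
  ⨆ (k : ℕ) (_ : k ≤ 4) (x ∈ Ω), ‖iteratedFDeriv ℝ k u x‖ₑ

/-- `u ∈ C⁴(Ω)`: four times continuously differentiable on the open set `Ω`, with finite norm. -/
def MemC4 {n : ℕ} (Ω : Set (Pt n)) (u : Pt n → ℝ) : Prop :=
  ContDiffOn ℝ 4 u Ω ∧ c4Norm Ω u < ∞

/-! ### The Cartesian grid -/

/-- Multi-indices. They are taken in `ℤⁿ`; those of the grid are `{0, …, N}ⁿ`. -/
abbrev Idx (n : ℕ) : Type := Fin n → ℤ

/-- The unit multi-index in the `i`-th direction; `D` is the set of all of them. -/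
def dir {n : ℕ} (i : Fin n) : Idx n := Pi.single i 1

/-- The data of a Cartesian grid: corner `a`, step `h`, and number `N` of cells per direction. -/
structure Grid (n : ℕ) where
  a : Pt n
  h : ℝ
  N : ℕ

/-- The grid that divides the sides of the cube `∏ᵢ [aᵢ, aᵢ + L]` into `N` cells. -/
def cubeGrid {n : ℕ} (a : Pt n) (L : ℝ) (N : ℕ) : Grid n := ⟨a, L / N, N⟩

namespace Grid

variable {n : ℕ}

/-- The node `x_α = a + α h`. -/
def node (G : Grid n) (α : Idx n) : Pt n := WithLp.toLp 2 fun i => G.a i + (α i : ℝ) * G.h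

/-- The multi-indices `{0, …, N}ⁿ` of the nodes of the grid. -/
def indices (G : Grid n) : Finset (Idx n) := Finset.Icc 0 fun _ => (G.N : ℤ)

open Classical in
/-- Indices of the interior nodes `Ω_h^int`. -/
def interiorNodes (G : Grid n) (Ω : Set (Pt n)) : Finset (Idx n) :=
  G.indices.filter fun α => G.node α ∈ Ω

open Classical in
/-- Indices of the active nodes `Ω_h`: the nodes in `Ω` and their neighbors. -/
def activeNodes (G : Grid n) (Ω : Set (Pt n)) : Finset (Idx n) :=
  G.indices.filter fun α =>
    G.node α ∈ Ω ∨ ∃ i : Fin n, G.node (α + dir i) ∈ Ω ∨ G.node (α - dir i) ∈ Ω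

/-- The closed cell whose lowest vertex is `x_β`. -/
def cell (G : Grid n) (β : Idx n) : Set (Pt n) :=
  {x | ∀ i, G.node β i ≤ x i ∧ x i ≤ G.node β i + G.h}

/-- The union `Ω̄_h` of the closed cells of the grid that intersect `Ω`. -/
def cover (G : Grid n) (Ω : Set (Pt n)) : Set (Pt n) :=
  {x | ∃ β : Idx n, (∀ i, 0 ≤ β i ∧ β i < (G.N : ℤ)) ∧ (G.cell β ∩ Ω).Nonempty ∧ x ∈ G.cell β}

/-- The edge between `x_α` and `x_{α+d}`. -/
def edge (G : Grid n) (α : Idx n) (i : Fin n) : Set (Pt n) :=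
  segment ℝ (G.node α) (G.node (α + dir i))

open Classical in
/-- The set `B`: edges between active nodes that intersect the boundary of `Ω` and are not included
in it. -/
def cutEdges (G : Grid n) (Ω : Set (Pt n)) : Finset (Idx n × Fin n) :=
  (G.activeNodes Ω ×ˢ Finset.univ).filter fun p =>
    p.1 + dir p.2 ∈ G.activeNodes Ω ∧
      (G.edge p.1 p.2 ∩ frontier Ω).Nonempty ∧ ¬ G.edge p.1 p.2 ⊆ frontier Ω

open Classical in
/-- The set `J`: pairs of a node in `Ω` and a direction in which one of its two neighbors is not
in `Ω`. -/
def ghostPairs (G : Grid n) (Ω : Set (Pt n)) : Finset (Idx n × Fin n) :=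
  (G.interiorNodes Ω ×ˢ Finset.univ).filter fun p =>
    G.node (p.1 - dir p.2) ∉ Ω ∨ G.node (p.1 + dir p.2) ∉ Ω

/-! ### Discrete functions and forms -/

/-- Discrete functions on `Ω_h`. -/
abbrev DiscreteFn (G : Grid n) (Ω : Set (Pt n)) : Type := {α : Idx n // α ∈ G.activeNodes Ω} → ℝ

/-- The value `u_α`. It is set to `0` off the active nodes, where the scheme never reads it. -/
def val {G : Grid n} {Ω : Set (Pt n)} (u : G.DiscreteFn Ω) (α : Idx n) : ℝ :=
  if hα : α ∈ G.activeNodes Ω then u ⟨α, hα⟩ else 0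

/-- The second difference `-u_{α-d} + 2u_α - u_{α+d}`. -/
def secondDiff (w : Idx n → ℝ) (α : Idx n) (i : Fin n) : ℝ :=
  -w (α - dir i) + 2 * w α - w (α + dir i)

/-- `(-Δ_h u, v)`. -/
def lapForm (G : Grid n) (Ω : Set (Pt n)) (u v : G.DiscreteFn Ω) : ℝ :=
  ∑ α ∈ G.interiorNodes Ω, ∑ i : Fin n, secondDiff (val u) α i / G.h ^ 2 * val v α

/-- The quantity `φ_{α+d} u_α - φ_α u_{α+d}`. -/
def phiJump (G : Grid n) (φ : Pt n → ℝ) (w : Idx n → ℝ) (α : Idx n) (i : Fin n) : ℝ :=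
  φ (G.node (α + dir i)) * w α - φ (G.node α) * w (α + dir i)

/-- The penalization `b_h(u, v)` of the boundary condition. A summand in which `φ` vanishes at both
ends of the edge is zero. -/
def bForm (G : Grid n) (Ω : Set (Pt n)) (φ : Pt n → ℝ) (γ : ℝ) (u v : G.DiscreteFn Ω) : ℝ :=
  γ / (2 * G.h ^ 2) * ∑ p ∈ G.cutEdges Ω,
    1 / (φ (G.node p.1) ^ 2 + φ (G.node (p.1 + dir p.2)) ^ 2) *
      G.phiJump φ (val u) p.1 p.2 * G.phiJump φ (val v) p.1 p.2

/-- The stabilization `j_h(u, v)`. -/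
def jForm (G : Grid n) (Ω : Set (Pt n)) (σ : ℝ) (u v : G.DiscreteFn Ω) : ℝ :=
  σ * ∑ p ∈ G.ghostPairs Ω,
    secondDiff (val u) p.1 p.2 / G.h * (secondDiff (val v) p.1 p.2 / G.h)

/-- The bilinear form `a_h = (-Δ_h ·, ·) + b_h + j_h`. -/
def aForm (G : Grid n) (Ω : Set (Pt n)) (φ : Pt n → ℝ) (σ γ : ℝ) (u v : G.DiscreteFn Ω) : ℝ :=
  G.lapForm Ω u v + G.bForm Ω φ γ u v + G.jForm Ω σ u v

/-- The right-hand side `l_h(v) = ∑ f(x_α) v_α` over the nodes in `Ω`. -/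
def lForm (G : Grid n) (Ω : Set (Pt n)) (f : Pt n → ℝ) (v : G.DiscreteFn Ω) : ℝ :=
  ∑ α ∈ G.interiorNodes Ω, f (G.node α) * val v α

/-- `u` solves the `φ`-FD scheme. -/
def IsDiscreteSolution (G : Grid n) (Ω : Set (Pt n)) (φ : Pt n → ℝ) (σ γ : ℝ) (f : Pt n → ℝ)
    (u : G.DiscreteFn Ω) : Prop :=
  ∀ v : G.DiscreteFn Ω, G.aForm Ω φ σ γ u v = G.lForm Ω f v

/-! ### Discrete norms on the interior nodes -/

/-- The discrete `L²` norm. -/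
def normL2 (G : Grid n) (Ω : Set (Pt n)) (w : Idx n → ℝ) : ℝ :=
  Real.sqrt (G.h ^ n * ∑ α ∈ G.interiorNodes Ω, w α ^ 2)

/-- The discrete `L^∞` norm: the maximum of `|w_α|` over the interior nodes (`0` if there are
none). -/
def normLinf (G : Grid n) (Ω : Set (Pt n)) (w : Idx n → ℝ) : ℝ :=
  ⨆ α : {α : Idx n // α ∈ G.interiorNodes Ω}, |w α|

open Classical in
/-- The discrete `H¹` semi-norm: a sum over the edges whose two end nodes are in `Ω`. -/
def seminormH1 (G : Grid n) (Ω : Set (Pt n)) (w : Idx n → ℝ) : ℝ :=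
  Real.sqrt (∑ p ∈ (G.interiorNodes Ω ×ˢ (Finset.univ : Finset (Fin n))).filter
      (fun p => p.1 + dir p.2 ∈ G.interiorNodes Ω),
    G.h ^ n * |(w (p.1 + dir p.2) - w p.1) / G.h| ^ 2)

/-- The error `U - u_h`, where `U_α = u(x_α)`. -/
def error (G : Grid n) (Ω : Set (Pt n)) (u : Pt n → ℝ) (uh : G.DiscreteFn Ω) (α : Idx n) : ℝ :=
  u (G.node α) - val uh α

end Grid

end PhiFD

end

/-! Multiplied by h², the scheme becomes the form `LatticeDomain.form` on the integer lattice. The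
error is v = U - u_h, where U is u at the nodes in Ω and a Taylor extension at their outer neighbors
(`extension`). With K the C⁴ norm of u, the residual of v is O(K h²) in a layer of nodes around Γ
and O(K h⁴) elsewhere (`exists_residual_le`). Indeed, near Γ the solution is affine up to O(K h²),
and that affine function is a multiple of φ up to O(K h²) (`exists_affine`); second differences
annihilate affine functions and the jumps of the penalization annihilate multiples of φ.

The scheme is tested with ωv, where ω > 0 is discretely superharmonic. Summation by parts
(`lap_weighted`) gives a weighted energy, the term (1/2) ∑ v²(-Δω), and boundary terms. In
`exists_weight`, ω is a regularized fundamental solution of the Laplacian centered at a node α₀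
where |v| is maximal, so -Δω ≥ 0 and -Δω(α₀) ≥ c. For n ≤ 3 the sum of ω is O(N) over the layer,
which is a discrete hypersurface, and O(N²) over the grid. Hence v(α₀)² ≲ (K h²)² N + K h⁴ N²
|v(α₀)|, that is max |v| ≲ K h^(3/2). The same inequality with the constant weight N^(2-n) bounds
the H¹ seminorm, and the L² norm follows from the maximum.

Coercivity (`coercive`) has to handle the boundary terms. If the jump vanishes on a cut edge, v has
opposite signs at its ends and the term has the right sign; otherwise the penalization pays.
Differences over cut edges are recovered from interior differences and the stabilization by a detour
inside Ω (`eCut_le`). The weights vary slowly between neighbors, so their commutators with the form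
are absorbed.

The geometry comes from compactness of Γ: near each of its points φ is strictly monotone along a
coordinate axis, with uniform constants (`exists_uniform_flat`). This settles all small h. On each
of the finitely many remaining grids the form is definite for large parameters
(`exists_params_definite`), and a crude bound with a constant depending on the grid is enough. -/

noncomputable section

namespace PhiFD

/-! ### Finite sums over lattice pairs -/

section Sums

variable {ι κ : Type*}

theorem sum_le_sum_of_injOn_maps {S : Finset ι} {T : Finset κ} (τ : ι → κ)
    (hinj : Set.InjOn τ S) (hmem : ∀ p ∈ S, τ p ∈ T) {g : κ → ℝ} (hg : ∀ q ∈ T, 0 ≤ g q) :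
    ∑ p ∈ S, g (τ p) ≤ ∑ q ∈ T, g q := by
  classical
  rw [← Finset.sum_image (g := τ) (f := g) hinj]
  refine Finset.sum_le_sum_of_subset_of_nonneg ?_ fun q hq _ => hg q hq
  intro q hq
  obtain ⟨p, hp, rfl⟩ := Finset.mem_image.1 hq
  exact hmem p hp

theorem sum_add_le_of_support {G : Type*} [AddGroup G] {I S : Finset G} (c : G) {f : G → ℝ}
    (hf : ∀ α, 0 ≤ f α) (h0 : ∀ α, α ∉ I → f α = 0) :
    ∑ α ∈ S, f (α + c) ≤ ∑ α ∈ I, f α := by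
  classical
  have h1 : ∑ α ∈ S, f (α + c) = ∑ α ∈ S.filter (fun α => α + c ∈ I), f (α + c) := by
    rw [Finset.sum_filter]
    refine Finset.sum_congr rfl fun α _ => ?_
    split_ifs with h
    · rfl
    · exact h0 _ h
  rw [h1]
  refine sum_le_sum_of_injOn_maps (fun α => α + c) (fun x _ y _ h => add_right_cancel h) ?_
    fun q _ => hf q
  intro p hp
  exact (Finset.mem_filter.1 hp).2

theorem sum_pairs_shift_le {G : Type*} [AddGroup G] [Fintype κ] {S : Finset (G × κ)}
    {T : Finset G} (c : κ → G) (hmem : ∀ p ∈ S, p.1 + c p.2 ∈ T) {f : G → ℝ}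
    (hf : ∀ α, 0 ≤ f α) :
    ∑ p ∈ S, f (p.1 + c p.2) ≤ Fintype.card κ * ∑ α ∈ T, f α := by
  have h := sum_le_sum_of_injOn_maps (S := S) (T := T ×ˢ (Finset.univ : Finset κ))
    (fun p => (p.1 + c p.2, p.2)) (g := fun q => f q.1) ?_ ?_ (fun q _ => hf q.1)
  · refine h.trans (le_of_eq ?_)
    rw [Finset.sum_product_right]
    simp [Finset.card_univ]
  · rintro ⟨x, i⟩ _ ⟨y, j⟩ _ hxy
    simp only [Prod.mk.injEq] at hxy ⊢
    obtain ⟨h1, rfl⟩ := hxy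
    exact ⟨add_right_cancel h1, rfl⟩
  · intro p hp
    exact Finset.mem_product.2 ⟨hmem p hp, Finset.mem_univ _⟩

end Sums

/-! ### Signed lattice directions -/

/-- The signed coordinate directions. -/
abbrev SDir (n : ℕ) : Type := Fin n × Bool

/-- The multi-index of a signed direction. -/
def step {n : ℕ} (s : SDir n) : Idx n := if s.2 then dir s.1 else -dir s.1

/-- The opposite direction. -/
def SDir.flip {n : ℕ} (s : SDir n) : SDir n := (s.1, !s.2)

@[simp] theorem step_flip {n : ℕ} (s : SDir n) : step s.flip = -step s := by
  rcases s with ⟨i, b⟩; cases b <;> simp [step, SDir.flip]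

@[simp] theorem flip_flip {n : ℕ} (s : SDir n) : s.flip.flip = s := by
  rcases s with ⟨i, b⟩; simp [SDir.flip]

/-- The difference `v_α - v_{α+s}`. -/
def sdiff {n : ℕ} (v : Idx n → ℝ) (α : Idx n) (s : SDir n) : ℝ := v α - v (α + step s)

theorem sdiff_add_sdiff_flip {n : ℕ} (v : Idx n → ℝ) (α : Idx n) (s : SDir n) :
    sdiff v α s + sdiff v α s.flip = Grid.secondDiff v α s.1 := by
  rcases s with ⟨i, b⟩
  cases b <;> simp [sdiff, Grid.secondDiff, step, SDir.flip, sub_eq_add_neg] <;> ring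

theorem sum_sdiff {n : ℕ} (v : Idx n → ℝ) (α : Idx n) :
    ∑ s : SDir n, sdiff v α s = ∑ i, Grid.secondDiff v α i := by
  rw [Fintype.sum_prod_type]
  refine Finset.sum_congr rfl fun i _ => ?_
  rw [Fintype.sum_bool]
  exact sdiff_add_sdiff_flip v α (i, true)

/-! ### Lattice domains -/

/-- The combinatorial data of a lattice domain `{ψ < 0}` with its cut edges. -/
structure LatticeDomain (n : ℕ) where
  I : Finset (Idx n)
  ψ : Idx n → ℝ
  B : Finset (Idx n × Fin n)
  mem_iff : ∀ α, α ∈ I ↔ ψ α < 0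
  mem_B : ∀ α i, (α ∈ I ↔ α + dir i ∉ I) → (α, i) ∈ B

namespace LatticeDomain

variable {n : ℕ} (Q : LatticeDomain n)

/-- Directed edges with both ends in the domain. -/
def intPairs : Finset (Idx n × SDir n) :=
  (Q.I ×ˢ Finset.univ).filter fun p => p.1 + step p.2 ∈ Q.I

/-- Directed edges that leave the domain. -/
def cutPairs : Finset (Idx n × SDir n) :=
  (Q.I ×ˢ Finset.univ).filter fun p => p.1 + step p.2 ∉ Q.I

/-- Nodes with an edge that leaves the domain. -/
def ghost : Finset (Idx n × Fin n) :=
  (Q.I ×ˢ Finset.univ).filter fun p => p.1 - dir p.2 ∉ Q.I ∨ p.1 + dir p.2 ∉ Q.I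

/-- End nodes of the edges that leave the domain. -/
def layer : Finset (Idx n) :=
  Q.cutPairs.image (fun p => p.1) ∪ Q.cutPairs.image fun p => p.1 + step p.2

theorem mem_intPairs {p : Idx n × SDir n} :
    p ∈ Q.intPairs ↔ p.1 ∈ Q.I ∧ p.1 + step p.2 ∈ Q.I := by
  simp [intPairs]

theorem mem_cutPairs {p : Idx n × SDir n} :
    p ∈ Q.cutPairs ↔ p.1 ∈ Q.I ∧ p.1 + step p.2 ∉ Q.I := by
  simp [cutPairs]

theorem mem_ghost {p : Idx n × Fin n} :
    p ∈ Q.ghost ↔ p.1 ∈ Q.I ∧ (p.1 - dir p.2 ∉ Q.I ∨ p.1 + dir p.2 ∉ Q.I) := by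
  simp [ghost]

theorem mem_ghost_of_cut {α : Idx n} {s : SDir n} (h : (α, s) ∈ Q.cutPairs) :
    (α, s.1) ∈ Q.ghost := by
  rw [mem_cutPairs] at h
  rw [mem_ghost]
  refine ⟨h.1, ?_⟩
  have h2 := h.2
  rcases s with ⟨i, b⟩
  cases b
  · left; simpa [step, sub_eq_add_neg] using h2
  · right; simpa [step] using h2

theorem fst_mem_layer {p : Idx n × SDir n} (h : p ∈ Q.cutPairs) : p.1 ∈ Q.layer :=
  Finset.mem_union_left _ (Finset.mem_image_of_mem _ h)

theorem snd_mem_layer {p : Idx n × SDir n} (h : p ∈ Q.cutPairs) : p.1 + step p.2 ∈ Q.layer :=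
  Finset.mem_union_right _ (Finset.mem_image.2 ⟨p, h, rfl⟩)

theorem ghost_mem_layer {p : Idx n × Fin n} (h : p ∈ Q.ghost) : p.1 ∈ Q.layer := by
  rw [mem_ghost] at h
  rcases h with ⟨h1, h2 | h2⟩
  · exact Q.fst_mem_layer (p := (p.1, (p.2, false)))
      (Q.mem_cutPairs.2 ⟨h1, by simpa [step, sub_eq_add_neg] using h2⟩)
  · exact Q.fst_mem_layer (p := (p.1, (p.2, true)))
      (Q.mem_cutPairs.2 ⟨h1, by simpa [step] using h2⟩)

theorem sum_int_add_cut (f : Idx n × SDir n → ℝ) :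
    ∑ p ∈ Q.intPairs, f p + ∑ p ∈ Q.cutPairs, f p = ∑ α ∈ Q.I, ∑ s, f (α, s) := by
  rw [intPairs, cutPairs, Finset.sum_filter_add_sum_filter_not, Finset.sum_product]

theorem sum_int_reverse (f : Idx n × SDir n → ℝ) :
    ∑ p ∈ Q.intPairs, f p = ∑ p ∈ Q.intPairs, f (p.1 + step p.2, p.2.flip) := by
  refine (Finset.sum_nbij' (fun p => (p.1 + step p.2, p.2.flip))
    (fun p => (p.1 + step p.2, p.2.flip)) ?_ ?_ ?_ ?_ ?_).symm
  · intro p hp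
    rw [mem_intPairs] at hp ⊢
    simpa using hp.symm
  · intro p hp
    rw [mem_intPairs] at hp ⊢
    simpa using hp.symm
  · intro p _; simp
  · intro p _; simp
  · intro p _; rfl

/-- `∑ (v_α - v_{α+s}) z_α` over all edges that start in the domain. -/
def lap (v z : Idx n → ℝ) : ℝ := ∑ α ∈ Q.I, ∑ s, sdiff v α s * z α

/-- The normalized jump `(ψ_{α+d} w_α - ψ_α w_{α+d}) / (ψ_α² + ψ_{α+d}²)^{1/2}`. -/
def jump (w : Idx n → ℝ) (p : Idx n × Fin n) : ℝ :=
  (Q.ψ (p.1 + dir p.2) * w p.1 - Q.ψ p.1 * w (p.1 + dir p.2)) /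
    Real.sqrt (Q.ψ p.1 ^ 2 + Q.ψ (p.1 + dir p.2) ^ 2)

/-- The bilinear form of the scheme, multiplied by `h²`. -/
def form (σ γ : ℝ) (v z : Idx n → ℝ) : ℝ :=
  Q.lap v z + γ / 2 * ∑ p ∈ Q.B, Q.jump v p * Q.jump z p +
    σ * ∑ p ∈ Q.ghost, Grid.secondDiff v p.1 p.2 * Grid.secondDiff z p.1 p.2

/-- Weighted energies. -/
def eInt (ω v : Idx n → ℝ) : ℝ := ∑ p ∈ Q.intPairs, ω p.1 * sdiff v p.1 p.2 ^ 2
def eCut (ω v : Idx n → ℝ) : ℝ := ∑ p ∈ Q.cutPairs, ω p.1 * sdiff v p.1 p.2 ^ 2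
def eGhost (ω v : Idx n → ℝ) : ℝ := ∑ p ∈ Q.ghost, ω p.1 * Grid.secondDiff v p.1 p.2 ^ 2
def eJump (ω v : Idx n → ℝ) : ℝ := ∑ p ∈ Q.B, ω p.1 * Q.jump v p ^ 2

/-- A discrete Green formula. Adding the two orientations of an interior edge with end values v, v'
uses (v - v')(ωv - ω'v') = (1/2)(ω + ω')(v - v')² + (1/2)(v² - v'²)(ω - ω'). A cut edge occurs with
one orientation only, so its contribution stays as a boundary term, corrected by the part of -Δω
that the sum over all directions has borrowed from it. -/
theorem lap_weighted (ω v : Idx n → ℝ) :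
    Q.lap v (fun α => ω α * v α) = 1 / 2 * Q.eInt ω v +
      1 / 2 * ∑ α ∈ Q.I, v α ^ 2 * ∑ s, sdiff ω α s +
      ∑ p ∈ Q.cutPairs, (ω p.1 * v p.1 * sdiff v p.1 p.2 -
        1 / 2 * (v p.1 ^ 2 * sdiff ω p.1 p.2)) := by
  have h1 : Q.lap v (fun α => ω α * v α) =
      ∑ p ∈ Q.intPairs, sdiff v p.1 p.2 * (ω p.1 * v p.1) +
      ∑ p ∈ Q.cutPairs, sdiff v p.1 p.2 * (ω p.1 * v p.1) := by
    rw [sum_int_add_cut Q (fun p => sdiff v p.1 p.2 * (ω p.1 * v p.1))]; rfl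
  have h2 : ∑ α ∈ Q.I, v α ^ 2 * ∑ s, sdiff ω α s =
      ∑ p ∈ Q.intPairs, v p.1 ^ 2 * sdiff ω p.1 p.2 +
      ∑ p ∈ Q.cutPairs, v p.1 ^ 2 * sdiff ω p.1 p.2 := by
    rw [sum_int_add_cut Q (fun p => v p.1 ^ 2 * sdiff ω p.1 p.2)]
    simp only [Finset.mul_sum]
  have h3 : ∑ p ∈ Q.intPairs, sdiff v p.1 p.2 * (ω p.1 * v p.1) =
      1 / 2 * Q.eInt ω v + 1 / 2 * ∑ p ∈ Q.intPairs, v p.1 ^ 2 * sdiff ω p.1 p.2 := by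
    have e1 := Q.sum_int_reverse (fun p => sdiff v p.1 p.2 * (ω p.1 * v p.1))
    have e2 := Q.sum_int_reverse (fun p => ω p.1 * sdiff v p.1 p.2 ^ 2)
    have e3 := Q.sum_int_reverse (fun p => v p.1 ^ 2 * sdiff ω p.1 p.2)
    have key : ∑ p ∈ Q.intPairs, sdiff v p.1 p.2 * (ω p.1 * v p.1) +
        ∑ p ∈ Q.intPairs, sdiff v (p.1 + step p.2) p.2.flip *
          (ω (p.1 + step p.2) * v (p.1 + step p.2)) =
        1 / 2 * (∑ p ∈ Q.intPairs, ω p.1 * sdiff v p.1 p.2 ^ 2 +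
          ∑ p ∈ Q.intPairs, ω (p.1 + step p.2) * sdiff v (p.1 + step p.2) p.2.flip ^ 2) +
        1 / 2 * (∑ p ∈ Q.intPairs, v p.1 ^ 2 * sdiff ω p.1 p.2 +
          ∑ p ∈ Q.intPairs, v (p.1 + step p.2) ^ 2 * sdiff ω (p.1 + step p.2) p.2.flip) := by
      simp only [← Finset.sum_add_distrib, Finset.mul_sum]
      refine Finset.sum_congr rfl fun p _ => ?_
      simp only [sdiff, step_flip, add_neg_cancel_right]
      ring
    simp only at e1 e2 e3
    rw [eInt]
    linarith
  have h4 : ∑ p ∈ Q.cutPairs, (ω p.1 * v p.1 * sdiff v p.1 p.2 -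
        1 / 2 * (v p.1 ^ 2 * sdiff ω p.1 p.2)) =
      ∑ p ∈ Q.cutPairs, sdiff v p.1 p.2 * (ω p.1 * v p.1) -
        1 / 2 * ∑ p ∈ Q.cutPairs, v p.1 ^ 2 * sdiff ω p.1 p.2 := by
    rw [Finset.sum_sub_distrib, ← Finset.mul_sum]
    congr 1
    exact Finset.sum_congr rfl fun p _ => by ring
  rw [h1, h2, h3, h4]
  ring

end LatticeDomain

/-- A positive weight with relative variation at most `ε` between neighbors. -/
def SlowlyVarying {n : ℕ} (ω : Idx n → ℝ) (ε : ℝ) : Prop :=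
  ∀ α, 0 < ω α ∧ ∀ s : SDir n, |ω α - ω (α + step s)| ≤ ε * ω α

namespace SlowlyVarying

variable {n : ℕ} {ω : Idx n → ℝ} {ε : ℝ}

theorem pos (h : SlowlyVarying ω ε) (α : Idx n) : 0 < ω α := (h α).1

theorem step_le (h : SlowlyVarying ω ε) (hε : ε ≤ 1) (α : Idx n) (s : SDir n) :
    ω (α + step s) ≤ 2 * ω α := by
  have h1 := (abs_le.1 ((h α).2 s)).1
  nlinarith [h.pos α]

theorem le_step (h : SlowlyVarying ω ε) (hε : ε ≤ 1) (α : Idx n) (s : SDir n) :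
    ω α ≤ 2 * ω (α + step s) := by
  have := h.step_le hε (α + step s) s.flip
  simpa using this

end SlowlyVarying

/-- Here x is the value inside, y the value outside, q = -φ inside and p = φ outside. When px + qy =
0, the values x and y have opposite signs and x(x - y) ≥ 0. In general x(x - y)(p + q) = (px + qy)(x
- y) + q(x - y)², and the normalizing root is at most p + q. -/
theorem cut_edge_bounds {p q x y J : ℝ} (hp : 0 ≤ p) (hq : 0 < q)
    (hJ : J ^ 2 = ((p * x + q * y) / Real.sqrt (q ^ 2 + p ^ 2)) ^ 2) :
    -(|J| * |x - y|) ≤ x * (x - y) ∧ x ^ 2 ≤ 2 * (J ^ 2 + (x - y) ^ 2) ∧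
      y ^ 2 ≤ 2 * (J ^ 2 + (x - y) ^ 2) := by
  set D := Real.sqrt (q ^ 2 + p ^ 2) with hD
  have hDpos : 0 < D := Real.sqrt_pos.2 (by positivity)
  have hDle : D ≤ p + q := by
    rw [hD]; exact Real.sqrt_le_iff.2 ⟨by positivity, by nlinarith⟩
  have habs : |J| * D = |p * x + q * y| := by
    rw [sq_eq_sq_iff_abs_eq_abs, abs_div, abs_of_pos hDpos] at hJ
    rw [hJ]; field_simp
  have hle : |p * x + q * y| ≤ |J| * (p + q) := by
    rw [← habs]; exact mul_le_mul_of_nonneg_left hDle (abs_nonneg _)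
  have hs : 0 < p + q := by linarith
  have hd := abs_nonneg (x - y)
  have hx : |x| ≤ |J| + |x - y| := by
    have : |x| * (p + q) ≤ (|J| + |x - y|) * (p + q) := by
      calc |x| * (p + q) = |(p * x + q * y) + q * (x - y)| := by
            nth_rewrite 1 [← abs_of_pos hs]; rw [← abs_mul]; congr 1; ring
        _ ≤ |p * x + q * y| + q * |x - y| := by
            refine (abs_add_le _ _).trans ?_
            rw [abs_mul, abs_of_pos hq]
        _ ≤ _ := by nlinarith
    exact le_of_mul_le_mul_right this hs
  have hy : |y| ≤ |J| + |x - y| := by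
    have : |y| * (p + q) ≤ (|J| + |x - y|) * (p + q) := by
      calc |y| * (p + q) = |(p * x + q * y) - p * (x - y)| := by
            nth_rewrite 1 [← abs_of_pos hs]; rw [← abs_mul]; congr 1; ring
        _ ≤ |p * x + q * y| + p * |x - y| := by
            refine (abs_sub _ _).trans ?_
            rw [abs_mul, abs_of_nonneg hp]
        _ ≤ _ := by nlinarith
    exact le_of_mul_le_mul_right this hs
  have two : ∀ z : ℝ, |z| ≤ |J| + |x - y| → z ^ 2 ≤ 2 * (J ^ 2 + (x - y) ^ 2) := by
    intro z hz
    rw [← sq_abs z, ← sq_abs J, ← sq_abs (x - y)]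
    nlinarith [abs_nonneg z, sq_nonneg (|J| - |x - y|)]
  refine ⟨?_, two x hx, two y hy⟩
  have : -(|J| * |x - y|) * (p + q) ≤ x * (x - y) * (p + q) := by
    have e : x * (x - y) * (p + q) = (p * x + q * y) * (x - y) + q * (x - y) ^ 2 := by ring
    have h1 : -(|p * x + q * y| * |x - y|) ≤ (p * x + q * y) * (x - y) := by
      rw [← abs_mul]; exact neg_abs_le _
    rw [e]
    nlinarith [mul_le_mul_of_nonneg_right hle hd, mul_nonneg hq.le (sq_nonneg (x - y))]
  exact le_of_mul_le_mul_right this hs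

namespace LatticeDomain

variable {n : ℕ} (Q : LatticeDomain n)

/-- Near the boundary, edges that leave the domain can be bypassed through the domain, and the cut
edges join nodes of the boundary layer. -/
structure IsFine : Prop where
  extend : ∀ α ∈ Q.I, ∀ s : SDir n, α + step s ∉ Q.I → α - step s ∈ Q.I ∨
    ∃ t : SDir n, α + step t ∈ Q.I ∧ α + step t + step s ∈ Q.I ∧ α + step t + step s + step t ∈ Q.I
  near : ∀ p ∈ Q.B, p.1 ∈ Q.layer ∧ p.1 + dir p.2 ∈ Q.layer

/-- The undirected edge of a directed one. -/
def edgeOf (p : Idx n × SDir n) : Idx n × Fin n :=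
  (if p.2.2 then p.1 else p.1 - dir p.2.1, p.2.1)

theorem edgeOf_mem {p : Idx n × SDir n} (hp : p ∈ Q.cutPairs) : edgeOf p ∈ Q.B := by
  rcases p with ⟨α, i, b⟩
  rw [mem_cutPairs] at hp
  apply Q.mem_B
  cases b <;> simp_all [step, sub_eq_add_neg]

theorem edgeOf_injOn : Set.InjOn edgeOf (Q.cutPairs : Set (Idx n × SDir n)) := by
  rintro ⟨α, i, b⟩ hp ⟨β, j, c⟩ hq h
  rw [Finset.mem_coe, mem_cutPairs] at hp hq
  cases b <;> cases c <;> simp [edgeOf] at h <;> obtain ⟨h, rfl⟩ := h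
  · simp [sub_left_injective h]
  · subst h; simp [step] at hp hq; exact absurd hp.1 hq.2
  · subst h; simp [step] at hp hq; exact absurd hq.1 hp.2
  · simp [h]

theorem cut_bounds (v : Idx n → ℝ) {p : Idx n × SDir n} (hp : p ∈ Q.cutPairs) :
    -(|Q.jump v (edgeOf p)| * |sdiff v p.1 p.2|) ≤ v p.1 * sdiff v p.1 p.2 ∧
    v p.1 ^ 2 ≤ 2 * (Q.jump v (edgeOf p) ^ 2 + sdiff v p.1 p.2 ^ 2) ∧
    v (p.1 + step p.2) ^ 2 ≤ 2 * (Q.jump v (edgeOf p) ^ 2 + sdiff v p.1 p.2 ^ 2) := by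
  rw [mem_cutPairs] at hp
  have h1 := (Q.mem_iff _).1 hp.1
  have h2 := not_lt.1 (mt (Q.mem_iff _).2 hp.2)
  refine cut_edge_bounds h2 (q := -Q.ψ p.1) (by linarith) ?_
  rcases p with ⟨α, i, b⟩
  cases b
  · simp only [jump, edgeOf, step, div_pow, Bool.false_eq_true, if_false,
      sub_eq_add_neg, neg_add_cancel_right]
    rw [neg_sq, add_comm (Q.ψ (α + -dir i) ^ 2)]
    ring
  · simp only [jump, edgeOf, step, div_pow, if_true]
    rw [neg_sq]
    ring

variable {ω : Idx n → ℝ} {ε : ℝ}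

theorem eInt_nonneg (hω : SlowlyVarying ω ε) (v : Idx n → ℝ) : 0 ≤ Q.eInt ω v :=
  Finset.sum_nonneg fun _ _ => mul_nonneg (hω.pos _).le (sq_nonneg _)
theorem eCut_nonneg (hω : SlowlyVarying ω ε) (v : Idx n → ℝ) : 0 ≤ Q.eCut ω v :=
  Finset.sum_nonneg fun _ _ => mul_nonneg (hω.pos _).le (sq_nonneg _)
theorem eGhost_nonneg (hω : SlowlyVarying ω ε) (v : Idx n → ℝ) : 0 ≤ Q.eGhost ω v :=
  Finset.sum_nonneg fun _ _ => mul_nonneg (hω.pos _).le (sq_nonneg _)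
theorem eJump_nonneg (hω : SlowlyVarying ω ε) (v : Idx n → ℝ) : 0 ≤ Q.eJump ω v :=
  Finset.sum_nonneg fun _ _ => mul_nonneg (hω.pos _).le (sq_nonneg _)

/-- The factor 2 pays for moving the weight from the inner node to the lower end of the undirected
edge, where `eJump` evaluates it. -/
theorem sum_cut_jump_le (hω : SlowlyVarying ω ε) (hε : ε ≤ 1) (v : Idx n → ℝ) :
    ∑ p ∈ Q.cutPairs, ω p.1 * Q.jump v (edgeOf p) ^ 2 ≤ 2 * Q.eJump ω v := by
  have h : ∀ p ∈ Q.cutPairs, ω p.1 * Q.jump v (edgeOf p) ^ 2 ≤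
      2 * (ω (edgeOf p).1 * Q.jump v (edgeOf p) ^ 2) := by
    rintro ⟨α, i, b⟩ _
    have : ω α ≤ 2 * ω (edgeOf (α, i, b)).1 := by
      cases b
      · have := hω.le_step hε α (i, false)
        simpa [step, edgeOf, sub_eq_add_neg] using this
      · have := hω.pos α
        simp [edgeOf]; linarith
    nlinarith [sq_nonneg (Q.jump v (edgeOf (α, i, b)))]
  refine (Finset.sum_le_sum h).trans ?_
  rw [← Finset.mul_sum]
  refine mul_le_mul_of_nonneg_left ?_ zero_le_two
  exact sum_le_sum_of_injOn_maps edgeOf Q.edgeOf_injOn (fun p hp => Q.edgeOf_mem hp)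
    (g := fun q => ω q.1 * Q.jump v q ^ 2) fun q _ => mul_nonneg (hω.pos _).le (sq_nonneg _)

theorem sum_layer_le {f : Idx n → ℝ} (hf : ∀ α, 0 ≤ f α) :
    ∑ α ∈ Q.layer, f α ≤ ∑ p ∈ Q.cutPairs, (f p.1 + f (p.1 + step p.2)) := by
  classical
  have img : ∀ g : Idx n × SDir n → Idx n,
      ∑ α ∈ Q.cutPairs.image g, f α ≤ ∑ p ∈ Q.cutPairs, f (g p) := by
    intro g
    rw [← Finset.sum_fiberwise_of_maps_to (s := Q.cutPairs) (t := Q.cutPairs.image g) (g := g)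
      (fun p hp => Finset.mem_image_of_mem g hp)]
    refine Finset.sum_le_sum fun α hα => ?_
    obtain ⟨p, hp, rfl⟩ := Finset.mem_image.1 hα
    exact Finset.single_le_sum (f := fun p => f (g p)) (fun q _ => hf _)
      (Finset.mem_filter.2 ⟨hp, rfl⟩)
  rw [Finset.sum_add_distrib, layer]
  have := Finset.sum_union_inter (s₁ := Q.cutPairs.image (fun p => p.1))
    (s₂ := Q.cutPairs.image fun p => p.1 + step p.2) (f := f)
  have h0 : 0 ≤ ∑ α ∈ Q.cutPairs.image (fun p => p.1) ∩
    Q.cutPairs.image fun p => p.1 + step p.2, f α := Finset.sum_nonneg fun _ _ => hf _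
  linarith [img (fun p => p.1), img fun p => p.1 + step p.2]

/-- The jump plays the part of a boundary value: together with the difference over a cut edge it
controls the values at both ends. The constant 6 is 2 for the inner end plus 2 · 2 for the outer
one, whose weight may be twice as large. -/
theorem sum_layer_sq_le (hω : SlowlyVarying ω ε) (hε : ε ≤ 1) (v : Idx n → ℝ) :
    ∑ α ∈ Q.layer, ω α * v α ^ 2 ≤ 6 * Q.eCut ω v + 12 * Q.eJump ω v := by
  refine (Q.sum_layer_le (f := fun α => ω α * v α ^ 2)
    fun α => mul_nonneg (hω.pos _).le (sq_nonneg _)).trans ?_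
  have h : ∀ p ∈ Q.cutPairs, ω p.1 * v p.1 ^ 2 + ω (p.1 + step p.2) * v (p.1 + step p.2) ^ 2 ≤
      6 * (ω p.1 * sdiff v p.1 p.2 ^ 2) + 6 * (ω p.1 * Q.jump v (edgeOf p) ^ 2) := by
    intro p hp
    obtain ⟨-, h2, h3⟩ := Q.cut_bounds v hp
    have h4 := hω.step_le hε p.1 p.2
    have h5 := hω.pos p.1
    have h6 := mul_le_mul_of_nonneg_left h2 h5.le
    have h7 := mul_le_mul h4 h3 (sq_nonneg _) (by linarith)
    nlinarith
  refine (Finset.sum_le_sum h).trans ?_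
  rw [Finset.sum_add_distrib, ← Finset.mul_sum, ← Finset.mul_sum]
  have := Q.sum_cut_jump_le hω hε v
  rw [eCut]
  linarith

/-- Young's inequality with parameter η trades the possibly negative product of jump and difference
for a small multiple of `eCut` and a large one of `eJump`; the variation of the weight only costs
terms of order ε. -/
theorem sum_cut_lower (hω : SlowlyVarying ω ε) (hε0 : 0 ≤ ε) (hε : ε ≤ 1) (v : Idx n → ℝ)
    {η : ℝ} (hη : 0 < η) :
    -((η + ε) * Q.eCut ω v) - (1 / (2 * η) + 2 * ε) * Q.eJump ω v ≤
      ∑ p ∈ Q.cutPairs, (ω p.1 * v p.1 * sdiff v p.1 p.2 -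
        1 / 2 * (v p.1 ^ 2 * sdiff ω p.1 p.2)) := by
  have h : ∀ p ∈ Q.cutPairs, -((η + ε) * (ω p.1 * sdiff v p.1 p.2 ^ 2)) -
      (1 / (4 * η) + ε) * (ω p.1 * Q.jump v (edgeOf p) ^ 2) ≤
      ω p.1 * v p.1 * sdiff v p.1 p.2 - 1 / 2 * (v p.1 ^ 2 * sdiff ω p.1 p.2) := by
    intro p hp
    obtain ⟨h1, h2, -⟩ := Q.cut_bounds v hp
    have h5 := hω.pos p.1
    have h4 : sdiff ω p.1 p.2 ≤ ε * ω p.1 := (abs_le.1 ((hω p.1).2 p.2)).2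
    set J := Q.jump v (edgeOf p)
    set d := sdiff v p.1 p.2
    have hy : |J| * |d| ≤ η * d ^ 2 + 1 / (4 * η) * J ^ 2 := by
      rw [← sq_abs d, ← sq_abs J]
      have : η * |d| ^ 2 + 1 / (4 * η) * |J| ^ 2 - |J| * |d| =
          (2 * η * |d| - |J|) ^ 2 / (4 * η) := by field_simp; ring
      have : 0 ≤ (2 * η * |d| - |J|) ^ 2 / (4 * η) := by positivity
      linarith
    have h6 : v p.1 ^ 2 * sdiff ω p.1 p.2 ≤ (2 * (J ^ 2 + d ^ 2)) * (ε * ω p.1) :=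
      (mul_le_mul_of_nonneg_left h4 (sq_nonneg _)).trans
        (mul_le_mul_of_nonneg_right h2 (by positivity))
    have h7 : ω p.1 * (-(η * d ^ 2 + 1 / (4 * η) * J ^ 2)) ≤ ω p.1 * (v p.1 * d) :=
      mul_le_mul_of_nonneg_left (by linarith) h5.le
    nlinarith
  refine le_trans ?_ (Finset.sum_le_sum h)
  rw [Finset.sum_sub_distrib, Finset.sum_neg_distrib, ← Finset.mul_sum, ← Finset.mul_sum, ← eCut]
  have := mul_le_mul_of_nonneg_left (Q.sum_cut_jump_le hω hε v)
    (show 0 ≤ 1 / (4 * η) + ε by positivity)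
  have e : (1 / (4 * η) + ε) * (2 * Q.eJump ω v) = (1 / (2 * η) + 2 * ε) * Q.eJump ω v := by
    field_simp; ring
  linarith

end LatticeDomain

/-! ### Differences over cut edges, and commutators of the form with the weight. -/

namespace LatticeDomain

variable {n : ℕ} (Q : LatticeDomain n) {ω : Idx n → ℝ} {ε : ℝ}

-- A shift by a fixed vector is injective, so each interior edge is met at most once; translates
-- that are not interior edges are discarded by the default value 0.
open Classical in
theorem sum_int_shift_le (hω : SlowlyVarying ω ε) (v : Idx n → ℝ) (c : Idx n) (s : SDir n)
    (S : Finset (Idx n)) :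
    ∑ α ∈ S, (if (α + c, s) ∈ Q.intPairs then ω (α + c) * sdiff v (α + c) s ^ 2 else 0) ≤
      Q.eInt ω v := by
  have hpos : ∀ α s, 0 ≤ (if (α, s) ∈ Q.intPairs then ω α * sdiff v α s ^ 2 else 0) := by
    intro α s
    split_ifs
    · exact mul_nonneg (hω.pos _).le (sq_nonneg _)
    · exact le_rfl
  refine (sum_add_le_of_support (I := Q.I) c
    (f := fun α => if (α, s) ∈ Q.intPairs then ω α * sdiff v α s ^ 2 else 0)
    (fun α => hpos α s) ?_).trans ?_
  · intro α hα
    exact if_neg fun h => hα (Q.mem_intPairs.1 h).1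
  · have h1 : Q.eInt ω v =
        ∑ s, ∑ α ∈ Q.I, (if (α, s) ∈ Q.intPairs then ω α * sdiff v α s ^ 2 else 0) := by
      rw [Finset.sum_comm, ← Finset.sum_product', eInt, intPairs, Finset.sum_filter]
      refine Finset.sum_congr rfl fun p hp => ?_
      have : (p ∈ (Q.I ×ˢ Finset.univ).filter fun p => p.1 + step p.2 ∈ Q.I) ↔
        p.1 + step p.2 ∈ Q.I := by simp [(Finset.mem_product.1 hp).1]
      simp only [Prod.mk.eta, this]
    rw [h1]
    exact Finset.single_le_sum (f := fun s => ∑ α ∈ Q.I,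
      (if (α, s) ∈ Q.intPairs then ω α * sdiff v α s ^ 2 else 0))
      (fun s _ => Finset.sum_nonneg fun α _ => hpos α s) (Finset.mem_univ s)

open Classical in
theorem sum_ghost_shift_le (hω : SlowlyVarying ω ε) (v : Idx n → ℝ) (c : Idx n) (i : Fin n)
    (S : Finset (Idx n)) :
    ∑ α ∈ S, (if (α + c, i) ∈ Q.ghost then ω (α + c) * Grid.secondDiff v (α + c) i ^ 2 else 0) ≤
      Q.eGhost ω v := by
  have hpos : ∀ α i, 0 ≤ (if (α, i) ∈ Q.ghost then ω α * Grid.secondDiff v α i ^ 2 else 0) := by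
    intro α i
    split_ifs
    · exact mul_nonneg (hω.pos _).le (sq_nonneg _)
    · exact le_rfl
  refine (sum_add_le_of_support (I := Q.I) c
    (f := fun α => if (α, i) ∈ Q.ghost then ω α * Grid.secondDiff v α i ^ 2 else 0)
    (fun α => hpos α i) ?_).trans ?_
  · intro α hα
    exact if_neg fun h => hα (Q.mem_ghost.1 h).1
  · have h1 : Q.eGhost ω v =
        ∑ i, ∑ α ∈ Q.I, (if (α, i) ∈ Q.ghost then ω α * Grid.secondDiff v α i ^ 2 else 0) := by
      rw [Finset.sum_comm, ← Finset.sum_product', eGhost, ghost, Finset.sum_filter]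
      refine Finset.sum_congr rfl fun p hp => ?_
      have : (p ∈ (Q.I ×ˢ Finset.univ).filter
        fun p => p.1 - dir p.2 ∉ Q.I ∨ p.1 + dir p.2 ∉ Q.I) ↔
        (p.1 - dir p.2 ∉ Q.I ∨ p.1 + dir p.2 ∉ Q.I) := by simp [(Finset.mem_product.1 hp).1]
      simp only [Prod.mk.eta, this]
    rw [h1]
    exact Finset.single_le_sum (f := fun i => ∑ α ∈ Q.I,
      (if (α, i) ∈ Q.ghost then ω α * Grid.secondDiff v α i ^ 2 else 0))
      (fun i _ => Finset.sum_nonneg fun α _ => hpos α i) (Finset.mem_univ i)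

/-- The constant in the bound of the differences over edges that leave the domain. -/
def bypassConst (n : ℕ) : ℝ := 120 * (n : ℝ) ^ 2 + 1

/-- If α - s is in the domain, the difference over the cut edge is a ghost second difference minus
an interior difference. Otherwise the path α, α + t, γ = α + t + s goes around through the domain,
and its last edge, from γ to α + s, is itself cut: in direction t at γ it is a ghost second
difference minus the interior difference from γ to γ + t. This is where the stabilization is
indispensable. -/
theorem eCut_le (hQ : Q.IsFine) (hω : SlowlyVarying ω ε) (hε : ε ≤ 1) (v : Idx n → ℝ) :
    Q.eCut ω v ≤ bypassConst n * (Q.eInt ω v + Q.eGhost ω v) := by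
  classical
  set X : Idx n → SDir n → ℝ := fun α s =>
    if (α, s) ∈ Q.intPairs then ω α * sdiff v α s ^ 2 else 0 with hX
  set Y : Idx n → Fin n → ℝ := fun α i =>
    if (α, i) ∈ Q.ghost then ω α * Grid.secondDiff v α i ^ 2 else 0 with hY
  have hX0 : ∀ α s, 0 ≤ X α s := by
    intro α s
    simp only [hX]
    split_ifs
    · exact mul_nonneg (hω.pos _).le (sq_nonneg _)
    · exact le_rfl
  have hY0 : ∀ α s, 0 ≤ Y α s := by
    intro α s
    simp only [hY]
    split_ifs
    · exact mul_nonneg (hω.pos _).le (sq_nonneg _)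
    · exact le_rfl
  -- The coefficients are 4, for the square of a sum of four terms, times 1, 2, 4, 4, for the
  -- comparison of the weights along the path.
  set Z : Idx n → SDir n → SDir n → ℝ := fun α s t =>
    4 * X α t + 8 * X (α + step t) s + 16 * Y (α + (step t + step s)) t.1 +
      16 * X (α + (step t + step s)) t with hZ
  have hZ0 : ∀ α s t, 0 ≤ Z α s t := fun α s t => by
    have := hX0 α t; have := hX0 (α + step t) s; have := hY0 (α + (step t + step s)) t.1
    have := hX0 (α + (step t + step s)) t
    simp only [hZ]; positivity
  have key : ∀ p ∈ Q.cutPairs, ω p.1 * sdiff v p.1 p.2 ^ 2 ≤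
      2 * Y p.1 p.2.1 + 2 * X p.1 p.2.flip + ∑ t, Z p.1 p.2 t := by
    rintro ⟨α, s⟩ hp
    obtain ⟨hα, hβ⟩ := Q.mem_cutPairs.1 hp
    have hsum : 0 ≤ ∑ t, Z α s t := Finset.sum_nonneg fun t _ => hZ0 α s t
    have hωα := hω.pos α
    rcases hQ.extend α hα s hβ with h | ⟨t, h1, h2, h3⟩
    · have hm : (α, s.flip) ∈ Q.intPairs := Q.mem_intPairs.2 ⟨hα, by simpa [sub_eq_add_neg] using h⟩
      have e1 : Y α s.1 = ω α * Grid.secondDiff v α s.1 ^ 2 := if_pos (Q.mem_ghost_of_cut hp)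
      have e2 : X α s.flip = ω α * sdiff v α s.flip ^ 2 := if_pos hm
      have e3 := sdiff_add_sdiff_flip v α s
      simp only
      rw [e1, e2, ← e3]
      have : sdiff v α s ^ 2 ≤ 2 * (sdiff v α s + sdiff v α s.flip) ^ 2 +
        2 * sdiff v α s.flip ^ 2 := by nlinarith [sq_nonneg (sdiff v α s + 2 * sdiff v α s.flip)]
      nlinarith
    · set γ := α + (step t + step s) with hγ
      have hγ' : γ = α + step t + step s := by rw [hγ, add_assoc]
      have c1 : (α, t) ∈ Q.intPairs := Q.mem_intPairs.2 ⟨hα, h1⟩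
      have c2 : (α + step t, s) ∈ Q.intPairs := Q.mem_intPairs.2 ⟨h1, h2⟩
      have c3 : (γ, t) ∈ Q.intPairs := Q.mem_intPairs.2 ⟨by rw [hγ']; exact h2, by rw [hγ']; exact h3⟩
      have hγt : γ + step t.flip = α + step s := by rw [hγ, step_flip]; abel
      have c4 : (γ, t.flip) ∈ Q.cutPairs := Q.mem_cutPairs.2 ⟨by rw [hγ']; exact h2, by
        simp only; rw [hγt]; exact hβ⟩
      have c5 : (γ, t.1) ∈ Q.ghost := Q.mem_ghost_of_cut (s := t.flip) c4
      have hZt : Z α s t ≤ ∑ t, Z α s t :=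
        Finset.single_le_sum (f := fun t => Z α s t) (fun t _ => hZ0 α s t) (Finset.mem_univ t)
      have e : Z α s t = 4 * (ω α * sdiff v α t ^ 2) +
          8 * (ω (α + step t) * sdiff v (α + step t) s ^ 2) +
          16 * (ω γ * Grid.secondDiff v γ t.1 ^ 2) + 16 * (ω γ * sdiff v γ t ^ 2) := by
        simp only [hZ, hX, hY]
        rw [if_pos c1, if_pos c2, if_pos c3, if_pos c5]
      have e3 : sdiff v α s = sdiff v α t + sdiff v (α + step t) s + Grid.secondDiff v γ t.1 -
          sdiff v γ t := by
        rw [← sdiff_add_sdiff_flip v γ t]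
        simp only [sdiff]
        rw [hγt, ← hγ']; ring
      have w1 := hω.le_step hε α t
      have w2 := hω.le_step hε (α + step t) s
      rw [← hγ'] at w2
      have sq4 : ∀ a b c d : ℝ, (a + b + c - d) ^ 2 ≤ 4 * (a ^ 2 + b ^ 2 + c ^ 2 + d ^ 2) := by
        intro a b c d
        nlinarith [sq_nonneg (a - b), sq_nonneg (a - c), sq_nonneg (a + d), sq_nonneg (b - c),
          sq_nonneg (b + d), sq_nonneg (c + d)]
      have h6 := mul_le_mul_of_nonneg_left (sq4 (sdiff v α t) (sdiff v (α + step t) s)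
        (Grid.secondDiff v γ t.1) (sdiff v γ t)) hωα.le
      have y1 := hY0 α s.1
      have y2 := hX0 α s.flip
      simp only
      rw [e3]
      have i1 := mul_le_mul_of_nonneg_right w1 (sq_nonneg (sdiff v (α + step t) s))
      have w3 : ω α ≤ 4 * ω γ := by linarith
      have i2 := mul_le_mul_of_nonneg_right w3 (sq_nonneg (Grid.secondDiff v γ t.1))
      have i3 := mul_le_mul_of_nonneg_right w3 (sq_nonneg (sdiff v γ t))
      linarith
  have hd : (Fintype.card (SDir n) : ℝ) = 2 * n := by
    simp [SDir, mul_comm]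
  have bX : ∀ c s, ∑ α ∈ Q.I, X (α + c) s ≤ Q.eInt ω v := fun c s => Q.sum_int_shift_le hω v c s Q.I
  have bX0 : ∀ s, ∑ α ∈ Q.I, X α s ≤ Q.eInt ω v := fun s => by simpa using bX 0 s
  have bY : ∀ c i, ∑ α ∈ Q.I, Y (α + c) i ≤ Q.eGhost ω v :=
    fun c i => Q.sum_ghost_shift_le hω v c i Q.I
  have bY0 : ∀ i, ∑ α ∈ Q.I, Y α i ≤ Q.eGhost ω v := fun s => by simpa using bY 0 s
  have hI := Q.eInt_nonneg hω v
  have hG := Q.eGhost_nonneg hω v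
  calc Q.eCut ω v ≤ ∑ p ∈ Q.cutPairs, (2 * Y p.1 p.2.1 + 2 * X p.1 p.2.flip + ∑ t, Z p.1 p.2 t) :=
        Finset.sum_le_sum key
    _ ≤ ∑ p ∈ Q.I ×ˢ (Finset.univ : Finset (SDir n)),
        (2 * Y p.1 p.2.1 + 2 * X p.1 p.2.flip + ∑ t, Z p.1 p.2 t) := by
        refine Finset.sum_le_sum_of_subset_of_nonneg (Finset.filter_subset _ _) fun p _ _ => ?_
        have := hX0 p.1 p.2.flip; have := hY0 p.1 p.2.1
        have : 0 ≤ ∑ t, Z p.1 p.2 t := Finset.sum_nonneg fun t _ => hZ0 _ _ t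
        positivity
    _ = ∑ s, (2 * ∑ α ∈ Q.I, Y α s.1 + 2 * ∑ α ∈ Q.I, X α s.flip +
          ∑ t, ∑ α ∈ Q.I, Z α s t) := by
        rw [Finset.sum_product_right]
        refine Finset.sum_congr rfl fun s _ => ?_
        rw [Finset.sum_add_distrib, Finset.sum_add_distrib, Finset.mul_sum, Finset.mul_sum,
          Finset.sum_comm (s := Q.I) (t := Finset.univ)]
    _ ≤ ∑ s : SDir n, (2 * Q.eGhost ω v + 2 * Q.eInt ω v +
          ∑ t : SDir n, (28 * Q.eInt ω v + 16 * Q.eGhost ω v)) := by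
        refine Finset.sum_le_sum fun s _ => ?_
        have h1 := bY0 s.1
        have h2 := bX0 s.flip
        have h3 : ∑ t, ∑ α ∈ Q.I, Z α s t ≤
            ∑ t : SDir n, (28 * Q.eInt ω v + 16 * Q.eGhost ω v) := by
          refine Finset.sum_le_sum fun t _ => ?_
          simp only [hZ, Finset.sum_add_distrib, ← Finset.mul_sum]
          linarith [bX0 t, bX (step t) s, bY (step t + step s) t.1, bX (step t + step s) t]
        linarith
    _ = 2 * n * (2 * Q.eGhost ω v + 2 * Q.eInt ω v +
          2 * n * (28 * Q.eInt ω v + 16 * Q.eGhost ω v)) := by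
        simp only [Finset.sum_const, Finset.card_univ, nsmul_eq_mul, hd]
    _ ≤ _ := by
        rw [bypassConst]
        have hn : (n : ℝ) ≤ (n : ℝ) ^ 2 := by exact_mod_cast Nat.le_self_pow two_ne_zero n
        nlinarith [mul_le_mul_of_nonneg_right hn hI, mul_le_mul_of_nonneg_right hn hG,
          mul_nonneg (sq_nonneg (n : ℝ)) hI, mul_nonneg (sq_nonneg (n : ℝ)) hG]

/-- The commutator is (ω_α - ω_{α+d}) v_{α+d} times ψ_α divided by the normalizing root, a quotient
of modulus at most 1 even when the root vanishes. -/
theorem jump_weighted (hω : SlowlyVarying ω ε) (v : Idx n → ℝ) (p : Idx n × Fin n) :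
    |Q.jump (fun α => ω α * v α) p - ω p.1 * Q.jump v p| ≤ ε * ω p.1 * |v (p.1 + dir p.2)| := by
  set D := Real.sqrt (Q.ψ p.1 ^ 2 + Q.ψ (p.1 + dir p.2) ^ 2) with hD
  have e : Q.jump (fun α => ω α * v α) p - ω p.1 * Q.jump v p =
      (ω p.1 - ω (p.1 + dir p.2)) * (v (p.1 + dir p.2)) * (Q.ψ p.1 / D) := by
    simp only [jump, ← hD]; ring
  have h1 : |Q.ψ p.1 / D| ≤ 1 := by
    rw [abs_div, abs_of_nonneg (Real.sqrt_nonneg _)]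
    refine div_le_one_of_le₀ ?_ (Real.sqrt_nonneg _)
    rw [← Real.sqrt_sq_eq_abs]
    exact Real.sqrt_le_sqrt (by nlinarith [sq_nonneg (Q.ψ (p.1 + dir p.2))])
  have h2 : |ω p.1 - ω (p.1 + dir p.2)| ≤ ε * ω p.1 := by
    simpa [step] using (hω p.1).2 (p.2, true)
  rw [e, abs_mul, abs_mul]
  have h3 := mul_le_mul_of_nonneg_right h2 (abs_nonneg (v (p.1 + dir p.2)))
  have h4 := mul_le_mul_of_nonneg_left h1
    (mul_nonneg (abs_nonneg (ω p.1 - ω (p.1 + dir p.2))) (abs_nonneg (v (p.1 + dir p.2))))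
  linarith

theorem secondDiff_weighted (hω : SlowlyVarying ω ε) (v : Idx n → ℝ) (p : Idx n × Fin n) :
    |Grid.secondDiff (fun α => ω α * v α) p.1 p.2 - ω p.1 * Grid.secondDiff v p.1 p.2| ≤
      ε * ω p.1 * (|v (p.1 + dir p.2)| + |v (p.1 - dir p.2)|) := by
  have e : Grid.secondDiff (fun α => ω α * v α) p.1 p.2 - ω p.1 * Grid.secondDiff v p.1 p.2 =
      (ω p.1 - ω (p.1 + dir p.2)) * v (p.1 + dir p.2) +
      (ω p.1 - ω (p.1 - dir p.2)) * v (p.1 - dir p.2) := by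
    simp only [Grid.secondDiff]; ring
  have h1 : |ω p.1 - ω (p.1 + dir p.2)| ≤ ε * ω p.1 := by
    simpa [step] using (hω p.1).2 (p.2, true)
  have h2 : |ω p.1 - ω (p.1 - dir p.2)| ≤ ε * ω p.1 := by
    simpa [step, sub_eq_add_neg] using (hω p.1).2 (p.2, false)
  rw [e]
  refine (abs_add_le _ _).trans ?_
  rw [abs_mul, abs_mul, mul_add]
  exact add_le_add (mul_le_mul_of_nonneg_right h1 (abs_nonneg _))
    (mul_le_mul_of_nonneg_right h2 (abs_nonneg _))

/-- The constant in the bound of the commutators with the weight. -/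
def commConst (n : ℕ) : ℝ := 150 * ((n : ℝ) + 1)

theorem sum_B_end_le (hQ : Q.IsFine) (hω : SlowlyVarying ω ε) (hε : ε ≤ 1) (v : Idx n → ℝ) :
    ∑ p ∈ Q.B, ω p.1 * v (p.1 + dir p.2) ^ 2 ≤
      commConst n * (Q.eInt ω v + Q.eCut ω v + Q.eJump ω v) := by
  have h1 : ∑ p ∈ Q.B, ω p.1 * v (p.1 + dir p.2) ^ 2 ≤
      ∑ p ∈ Q.B, 2 * (ω (p.1 + dir p.2) * v (p.1 + dir p.2) ^ 2) := by
    refine Finset.sum_le_sum fun p _ => ?_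
    have : ω p.1 ≤ 2 * ω (p.1 + dir p.2) := by simpa [step] using hω.le_step hε p.1 (p.2, true)
    nlinarith [sq_nonneg (v (p.1 + dir p.2))]
  have h2 := sum_pairs_shift_le (S := Q.B) (T := Q.layer) (c := fun i : Fin n => dir i)
    (fun p hp => (hQ.near p hp).2) (f := fun α => ω α * v α ^ 2)
    (fun α => mul_nonneg (hω.pos _).le (sq_nonneg _))
  rw [Fintype.card_fin] at h2
  rw [← Finset.mul_sum] at h1
  have h3 := Q.sum_layer_sq_le hω hε v
  have h4 := Q.eInt_nonneg hω v
  have h5 := Q.eCut_nonneg hω v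
  have h6 := Q.eJump_nonneg hω v
  have hn : (0 : ℝ) ≤ n := Nat.cast_nonneg n
  rw [commConst]
  nlinarith [mul_le_mul_of_nonneg_left h3 hn, mul_nonneg hn h4, mul_nonneg hn h5, mul_nonneg hn h6]

theorem sum_ghost_ends_le (hω : SlowlyVarying ω ε) (hε : ε ≤ 1) (v : Idx n → ℝ) :
    ∑ p ∈ Q.ghost, ω p.1 * (|v (p.1 + dir p.2)| + |v (p.1 - dir p.2)|) ^ 2 ≤
      commConst n * (Q.eInt ω v + Q.eCut ω v + Q.eJump ω v) := by
  have h1 : ∑ p ∈ Q.ghost, ω p.1 * (|v (p.1 + dir p.2)| + |v (p.1 - dir p.2)|) ^ 2 ≤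
      ∑ p ∈ Q.ghost, (12 * (ω (p.1 + 0) * v (p.1 + 0) ^ 2) +
        3 * (ω p.1 * sdiff v p.1 (p.2, true) ^ 2 + ω p.1 * sdiff v p.1 (p.2, false) ^ 2)) := by
    refine Finset.sum_le_sum fun p _ => ?_
    have a1 : |v (p.1 + dir p.2)| ≤ |v p.1| + |sdiff v p.1 (p.2, true)| := by
      have : v (p.1 + dir p.2) = v p.1 - sdiff v p.1 (p.2, true) := by simp [sdiff, step]
      rw [this]; exact abs_sub _ _
    have a2 : |v (p.1 - dir p.2)| ≤ |v p.1| + |sdiff v p.1 (p.2, false)| := by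
      have : v (p.1 - dir p.2) = v p.1 - sdiff v p.1 (p.2, false) := by
        simp [sdiff, step, sub_eq_add_neg]
      rw [this]; exact abs_sub _ _
    -- The Cauchy-Schwarz inequality for the three terms 2|v_α| and the two differences.
    have a3 : (|v (p.1 + dir p.2)| + |v (p.1 - dir p.2)|) ^ 2 ≤ 12 * v p.1 ^ 2 +
        3 * (sdiff v p.1 (p.2, true) ^ 2 + sdiff v p.1 (p.2, false) ^ 2) := by
      rw [← sq_abs (v p.1), ← sq_abs (sdiff v p.1 (p.2, true)),
        ← sq_abs (sdiff v p.1 (p.2, false))]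
      refine (pow_le_pow_left₀ (by positivity) (add_le_add a1 a2) 2).trans ?_
      set x := |v p.1|
      set y := |sdiff v p.1 (p.2, true)|
      set z := |sdiff v p.1 (p.2, false)|
      nlinarith [sq_nonneg (2 * x - y), sq_nonneg (2 * x - z), sq_nonneg (y - z)]
    have := mul_le_mul_of_nonneg_left a3 (hω.pos p.1).le
    rw [add_zero]
    linarith
  have h2 := sum_pairs_shift_le (S := Q.ghost) (T := Q.layer) (c := fun _ : Fin n => (0 : Idx n))
    (fun p hp => by simpa using Q.ghost_mem_layer hp) (f := fun α => ω α * v α ^ 2)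
    (fun α => mul_nonneg (hω.pos _).le (sq_nonneg _))
  rw [Fintype.card_fin] at h2
  have h0 : ∑ p ∈ Q.ghost,
      (ω p.1 * sdiff v p.1 (p.2, true) ^ 2 + ω p.1 * sdiff v p.1 (p.2, false) ^ 2) ≤
      Q.eInt ω v + Q.eCut ω v := by
    rw [eInt, eCut, Q.sum_int_add_cut (fun p => ω p.1 * sdiff v p.1 p.2 ^ 2)]
    simp only [Fintype.sum_prod_type, Fintype.sum_bool]
    rw [← Finset.sum_product' Q.I Finset.univ (f := fun α i =>
      ω α * sdiff v α (i, true) ^ 2 + ω α * sdiff v α (i, false) ^ 2)]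
    refine Finset.sum_le_sum_of_subset_of_nonneg (Finset.filter_subset _ _) fun p _ _ => ?_
    have := hω.pos p.1
    positivity
  rw [Finset.sum_add_distrib, ← Finset.mul_sum, ← Finset.mul_sum] at h1
  have h3 := Q.sum_layer_sq_le hω hε v
  have h4 := Q.eInt_nonneg hω v
  have h5 := Q.eCut_nonneg hω v
  have h6 := Q.eJump_nonneg hω v
  have hn : (0 : ℝ) ≤ n := Nat.cast_nonneg n
  rw [commConst]
  nlinarith [mul_le_mul_of_nonneg_left h3 hn, mul_nonneg hn h4, mul_nonneg hn h5, mul_nonneg hn h6]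

end LatticeDomain

/-! ### Weighted coercivity and stability. -/

theorem bypassConst_ge_one (n : ℕ) : 1 ≤ LatticeDomain.bypassConst n := by
  rw [LatticeDomain.bypassConst]; nlinarith [sq_nonneg (n : ℝ)]

/-- The coercivity constant. -/
def coercConst (n : ℕ) : ℝ := 1 / (16 * LatticeDomain.bypassConst n)

theorem coercConst_pos (n : ℕ) : 0 < coercConst n := by
  have := bypassConst_ge_one n
  rw [coercConst]; positivity

theorem coercConst_mul (n : ℕ) : coercConst n * LatticeDomain.bypassConst n = 1 / 16 := by
  have := bypassConst_ge_one n
  rw [coercConst]; field_simp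

theorem coercConst_le (n : ℕ) : coercConst n ≤ 1 / 16 := by
  have := coercConst_mul n
  nlinarith [bypassConst_ge_one n, coercConst_pos n]

namespace LatticeDomain

variable {n : ℕ} (Q : LatticeDomain n) {ω : Idx n → ℝ} {ε : ℝ}

/-- The total weighted energy. -/
def energy (ω v : Idx n → ℝ) : ℝ := Q.eInt ω v + Q.eCut ω v + Q.eGhost ω v + Q.eJump ω v

theorem mul_perturbed_ge {w x y r ε : ℝ} (hw : 0 ≤ w)
    (h : |y - w * x| ≤ ε * w * r) :
    1 / 2 * (w * x ^ 2) - 1 / 2 * ε ^ 2 * (w * r ^ 2) ≤ x * y := by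
  have h1 : -(|x| * (ε * w * r)) ≤ x * (y - w * x) := by
    refine le_trans ?_ (neg_abs_le _)
    rw [abs_mul]
    exact neg_le_neg (mul_le_mul_of_nonneg_left h (abs_nonneg _))
  have h2 : 0 ≤ w * (|x| - ε * r) ^ 2 := mul_nonneg hw (sq_nonneg _)
  nlinarith [sq_abs x]

/-- The good terms are half the interior energy and about half of the penalization and of the
stabilization. By `eCut_le`, each multiple κ of `eCut` costs only a sixteenth of `eInt` + `eGhost`,
which covers the cut terms and puts `eCut` into the energy on the left. The commutators are
quadratic in ε and are absorbed through `hc`. -/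
theorem coercive (hQ : Q.IsFine) (hω : SlowlyVarying ω ε) (hε0 : 0 ≤ ε)
    {σ γ : ℝ} (hσ : 1 ≤ σ) (hγ : 4 / coercConst n ≤ γ) (hε : ε ≤ coercConst n)
    (hc : (γ + σ) * ε ^ 2 * commConst n ≤ coercConst n) (v : Idx n → ℝ) :
    coercConst n * Q.energy ω v + 1 / 2 * ∑ α ∈ Q.I, v α ^ 2 * ∑ s, sdiff ω α s ≤
      Q.form σ γ v (fun α => ω α * v α) := by
  set κ := coercConst n with hκ
  have hκ0 : 0 < κ := coercConst_pos n
  have hκ1 : κ ≤ 1 / 16 := coercConst_le n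
  have hε1 : ε ≤ 1 := by linarith
  have hγ0 : 0 < γ := lt_of_lt_of_le (by positivity) hγ
  have hI := Q.eInt_nonneg hω v
  have hC := Q.eCut_nonneg hω v
  have hG := Q.eGhost_nonneg hω v
  have hJ := Q.eJump_nonneg hω v
  -- With η = κ the price is (1 / (2κ)) `eJump`, which half of the penalization covers because γ ≥ 4
  -- / κ.
  have h1 := Q.sum_cut_lower hω hε0 hε1 v hκ0
  have h2 : 1 / 2 * Q.eJump ω v - 1 / 2 * ε ^ 2 * ∑ p ∈ Q.B, ω p.1 * v (p.1 + dir p.2) ^ 2 ≤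
      ∑ p ∈ Q.B, Q.jump v p * Q.jump (fun α => ω α * v α) p := by
    rw [eJump, Finset.mul_sum, Finset.mul_sum, ← Finset.sum_sub_distrib]
    refine Finset.sum_le_sum fun p _ => ?_
    have := mul_perturbed_ge (hω.pos p.1).le (Q.jump_weighted hω v p)
    rwa [sq_abs] at this
  have h3 : 1 / 2 * Q.eGhost ω v - 1 / 2 * ε ^ 2 *
      ∑ p ∈ Q.ghost, ω p.1 * (|v (p.1 + dir p.2)| + |v (p.1 - dir p.2)|) ^ 2 ≤
      ∑ p ∈ Q.ghost, Grid.secondDiff v p.1 p.2 *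
        Grid.secondDiff (fun α => ω α * v α) p.1 p.2 := by
    rw [eGhost, Finset.mul_sum, Finset.mul_sum, ← Finset.sum_sub_distrib]
    refine Finset.sum_le_sum fun p _ => ?_
    exact mul_perturbed_ge (hω.pos p.1).le (secondDiff_weighted hω v p)
  have h4 := Q.sum_B_end_le hQ hω hε1 v
  have h5 := Q.sum_ghost_ends_le hω hε1 v
  have h6 := Q.eCut_le hQ hω hε1 v
  have h7 := mul_le_mul_of_nonneg_left h6 hκ0.le
  rw [← mul_assoc, coercConst_mul] at h7
  set S := Q.eInt ω v + Q.eCut ω v + Q.eJump ω v with hS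
  have hS0 : 0 ≤ S := by positivity
  have hB : γ / 2 * (1 / 2 * Q.eJump ω v) - 1 / 4 * (γ * ε ^ 2 * commConst n * S) ≤
      γ / 2 * ∑ p ∈ Q.B, Q.jump v p * Q.jump (fun α => ω α * v α) p := by
    have a1 := mul_le_mul_of_nonneg_left h2 (show 0 ≤ γ / 2 by positivity)
    have a2 := mul_le_mul_of_nonneg_left h4 (show 0 ≤ γ / 4 * ε ^ 2 by positivity)
    linarith
  have hG' : σ * (1 / 2 * Q.eGhost ω v) - 1 / 2 * (σ * ε ^ 2 * commConst n * S) ≤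
      σ * ∑ p ∈ Q.ghost, Grid.secondDiff v p.1 p.2 *
        Grid.secondDiff (fun α => ω α * v α) p.1 p.2 := by
    have a1 := mul_le_mul_of_nonneg_left h3 (show 0 ≤ σ by linarith)
    have a2 := mul_le_mul_of_nonneg_left h5 (show 0 ≤ σ / 2 * ε ^ 2 by positivity)
    linarith
  have hcomm0 : 0 ≤ commConst n := by rw [commConst]; positivity
  have hR : 1 / 4 * (γ * ε ^ 2 * commConst n * S) + 1 / 2 * (σ * ε ^ 2 * commConst n * S) ≤
      κ * S := by
    have a1 := mul_le_mul_of_nonneg_right hc hS0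
    have a2 : 0 ≤ γ * ε ^ 2 * commConst n * S := by positivity
    have a3 : 0 ≤ σ * ε ^ 2 * commConst n * S := by positivity
    nlinarith
  rw [form, lap_weighted, energy]
  have hεC : ε * Q.eCut ω v ≤ κ * Q.eCut ω v := mul_le_mul_of_nonneg_right hε hC
  have hεJ : ε * Q.eJump ω v ≤ κ * Q.eJump ω v := mul_le_mul_of_nonneg_right hε hJ
  have hκI : κ * Q.eInt ω v ≤ 1 / 16 * Q.eInt ω v := mul_le_mul_of_nonneg_right hκ1 hI
  have hκG : κ * Q.eGhost ω v ≤ 1 / 16 * Q.eGhost ω v := mul_le_mul_of_nonneg_right hκ1 hG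
  have hσG : Q.eGhost ω v ≤ σ * Q.eGhost ω v := le_mul_of_one_le_left hG hσ
  have hκJ : κ * Q.eJump ω v ≤ 1 / 16 * Q.eJump ω v := mul_le_mul_of_nonneg_right hκ1 hJ
  have hinv : 16 ≤ 1 / κ := by
    rw [le_div_iff₀ hκ0]; linarith
  have hγJ : (4 / κ) * Q.eJump ω v ≤ γ * Q.eJump ω v := mul_le_mul_of_nonneg_right hγ hJ
  have hinvJ := mul_le_mul_of_nonneg_right hinv hJ
  have e1 : 1 / (2 * κ) * Q.eJump ω v = 1 / 2 * (1 / κ * Q.eJump ω v) := by field_simp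
  have e2 : 4 / κ * Q.eJump ω v = 4 * (1 / κ * Q.eJump ω v) := by field_simp
  have h1' : -(κ * Q.eCut ω v + ε * Q.eCut ω v) -
      (1 / 2 * (1 / κ * Q.eJump ω v) + 2 * (ε * Q.eJump ω v)) ≤
      ∑ p ∈ Q.cutPairs, (ω p.1 * v p.1 * sdiff v p.1 p.2 -
        1 / 2 * (v p.1 ^ 2 * sdiff ω p.1 p.2)) := by
    rw [← e1]; linarith
  have hκS : κ * S = κ * Q.eInt ω v + κ * Q.eCut ω v + κ * Q.eJump ω v := by rw [hS]; ring
  linarith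

/-- `v` satisfies the scheme tested with `z`, with a residual of size `m` in the boundary layer and
`m'` elsewhere. -/
structure HasResidual (σ γ : ℝ) (v : Idx n → ℝ) (m m' : ℝ) : Prop where
  exists_data : ∃ (R : Idx n → ℝ) (a b : Idx n × Fin n → ℝ),
    (∀ α ∈ Q.I, α ∈ Q.layer → |R α| ≤ m) ∧ (∀ α ∈ Q.I, α ∉ Q.layer → |R α| ≤ m') ∧
    (∀ p ∈ Q.B, |a p| ≤ m) ∧ (∀ p ∈ Q.ghost, |b p| ≤ m) ∧
    ∀ z, Q.form σ γ v z = ∑ α ∈ Q.I, R α * z α + γ / 2 * ∑ p ∈ Q.B, a p * Q.jump z p +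
      σ * ∑ p ∈ Q.ghost, b p * Grid.secondDiff z p.1 p.2

theorem mul_perturbed_le {w x y r ε m a τ : ℝ} (hw : 0 ≤ w)
    (hτ : 0 < τ) (ha : |a| ≤ m) (h : |y - w * x| ≤ ε * w * r) :
    a * y ≤ τ * (w * x ^ 2) + τ * ε ^ 2 * (w * r ^ 2) + m ^ 2 / (2 * τ) * w := by
  have hm : 0 ≤ m := (abs_nonneg _).trans ha
  have hy : |y| ≤ w * |x| + ε * w * r := by
    have : y = w * x + (y - w * x) := by ring
    rw [this]
    refine (abs_add_le _ _).trans (add_le_add ?_ h)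
    rw [abs_mul, abs_of_nonneg hw]
  have h1 : a * y ≤ m * (w * |x| + ε * w * r) := by
    refine (le_abs_self _).trans ?_
    rw [abs_mul]
    exact mul_le_mul ha hy (abs_nonneg _) hm
  have y1 : ∀ t : ℝ, m * t ≤ τ * t ^ 2 + m ^ 2 / (4 * τ) := by
    intro t
    have : τ * t ^ 2 + m ^ 2 / (4 * τ) - m * t = (2 * τ * t - m) ^ 2 / (4 * τ) := by
      field_simp; ring
    have : 0 ≤ (2 * τ * t - m) ^ 2 / (4 * τ) := by positivity
    linarith
  have h2 := mul_le_mul_of_nonneg_left (y1 |x|) hw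
  have h3 := mul_le_mul_of_nonneg_left (y1 (ε * r)) hw
  rw [sq_abs] at h2
  have e : m ^ 2 / (2 * τ) * w = w * (m ^ 2 / (4 * τ)) + w * (m ^ 2 / (4 * τ)) := by
    field_simp; ring
  nlinarith

/-- The parameter in Young's inequality. -/
def youngConst (n : ℕ) (σ γ : ℝ) : ℝ := coercConst n / (2 * (13 + γ + σ))

/-- The constant of the weighted stability estimate. -/
def stabConst (n : ℕ) (σ γ : ℝ) : ℝ :=
  (1 / 4 + (γ / 2 + σ) * n / 2) / youngConst n σ γ

-- Layer residuals are split by Young's inequality against the energy, so m enters squared and only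
-- through the weight of the layer. The residual m' away from the layer stays linear in v: it is
-- much smaller, and v will be bounded there by its maximum.
set_option maxHeartbeats 1000000 in
theorem stability (hQ : Q.IsFine) (hω : SlowlyVarying ω ε) (hε0 : 0 ≤ ε)
    {σ γ : ℝ} (hσ : 1 ≤ σ) (hγ : 4 / coercConst n ≤ γ) (hε : ε ≤ coercConst n)
    (hc : (γ + σ) * ε ^ 2 * commConst n ≤ coercConst n) {v : Idx n → ℝ} {m m' : ℝ}
    (hm' : 0 ≤ m') (hv : Q.HasResidual σ γ v m m') :
    1 / 2 * coercConst n * Q.energy ω v + 1 / 2 * ∑ α ∈ Q.I, v α ^ 2 * ∑ s, sdiff ω α s ≤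
      stabConst n σ γ * m ^ 2 * ∑ α ∈ Q.layer, ω α + m' * ∑ α ∈ Q.I, ω α * |v α| := by
  obtain ⟨R, a, b, hR, hR', ha, hb, hform⟩ := hv.exists_data
  have hcoer := Q.coercive hQ hω hε0 hσ hγ hε hc v
  rw [hform] at hcoer
  set κ := coercConst n with hκ
  have hκ0 : 0 < κ := coercConst_pos n
  have hκ1 : κ ≤ 1 / 16 := coercConst_le n
  have hε1 : ε ≤ 1 := by linarith
  have hγ0 : 0 < γ := lt_of_lt_of_le (by positivity) hγ
  have hσ0 : 0 < σ := by linarith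
  set τ := youngConst n σ γ with hτ
  -- The number 13 is 12, from the bound of the layer values by `eJump`, plus 1 for the commutators;
  -- γ and σ account for the penalization and the stabilization. Everything multiplied by τ then
  -- fits in half of the coercivity.
  have hτdef : τ * (13 + γ + σ) = κ / 2 := by
    rw [hτ, youngConst]; field_simp; rw [hκ]
  have hτ0 : 0 < τ := by rw [hτ, youngConst]; positivity
  have hI := Q.eInt_nonneg hω v
  have hC := Q.eCut_nonneg hω v
  have hG := Q.eGhost_nonneg hω v
  have hJ := Q.eJump_nonneg hω v
  set W := ∑ α ∈ Q.layer, ω α with hW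
  have hW0 : 0 ≤ W := Finset.sum_nonneg fun α _ => (hω.pos α).le
  have h1 : ∑ α ∈ Q.I, R α * (ω α * v α) ≤
      τ * (6 * Q.eCut ω v + 12 * Q.eJump ω v) + m ^ 2 / (4 * τ) * W +
        m' * ∑ α ∈ Q.I, ω α * |v α| := by
    classical
    have b1 : ∀ α ∈ Q.I, R α * (ω α * v α) ≤
        (if α ∈ Q.layer then τ * (ω α * v α ^ 2) + m ^ 2 / (4 * τ) * ω α else 0) +
          m' * (ω α * |v α|) := by
      intro α hα
      have hw := hω.pos α
      have c1 : R α * (ω α * v α) ≤ |R α| * (ω α * |v α|) := by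
        refine (le_abs_self _).trans (le_of_eq ?_)
        rw [abs_mul, abs_mul, abs_of_pos hw]
      split_ifs with h
      · have c2 : |R α| * (ω α * |v α|) ≤ m * (ω α * |v α|) :=
          mul_le_mul_of_nonneg_right (hR α hα h) (by positivity)
        have c3 : m * |v α| ≤ τ * v α ^ 2 + m ^ 2 / (4 * τ) := by
          have : τ * v α ^ 2 + m ^ 2 / (4 * τ) - m * |v α| = (2 * τ * |v α| - m) ^ 2 / (4 * τ) := by
            rw [← sq_abs (v α)]; field_simp; ring
          have : 0 ≤ (2 * τ * |v α| - m) ^ 2 / (4 * τ) := by positivity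
          linarith
        have c4 := mul_le_mul_of_nonneg_left c3 hw.le
        have c5 : 0 ≤ m' * (ω α * |v α|) := by positivity
        nlinarith
      · have c2 : |R α| * (ω α * |v α|) ≤ m' * (ω α * |v α|) :=
          mul_le_mul_of_nonneg_right (hR' α hα h) (by positivity)
        linarith
    refine (Finset.sum_le_sum b1).trans ?_
    rw [Finset.sum_add_distrib, ← Finset.mul_sum, ← Finset.sum_filter]
    have b2 : ∑ α ∈ Q.I.filter (fun α => α ∈ Q.layer),
        (τ * (ω α * v α ^ 2) + m ^ 2 / (4 * τ) * ω α) ≤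
        ∑ α ∈ Q.layer, (τ * (ω α * v α ^ 2) + m ^ 2 / (4 * τ) * ω α) := by
      refine Finset.sum_le_sum_of_subset_of_nonneg
        (fun α hα => (Finset.mem_filter.1 hα).2) fun α _ _ => ?_
      have hw := hω.pos α
      positivity
    rw [Finset.sum_add_distrib (s := Q.layer), ← Finset.mul_sum, ← Finset.mul_sum] at b2
    have b3 := mul_le_mul_of_nonneg_left (Q.sum_layer_sq_le hω hε1 v) hτ0.le
    linarith
  have cnt : ∀ (S : Finset (Idx n × Fin n)), (∀ p ∈ S, p.1 ∈ Q.layer) →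
      ∑ p ∈ S, ω p.1 ≤ n * W := by
    intro S hS
    have := sum_pairs_shift_le (S := S) (T := Q.layer) (c := fun _ : Fin n => (0 : Idx n))
      (fun p hp => by simpa using hS p hp) (f := ω) (fun α => (hω.pos _).le)
    simpa [Fintype.card_fin] using this
  have h2 : ∑ p ∈ Q.B, a p * Q.jump (fun α => ω α * v α) p ≤
      τ * Q.eJump ω v + τ * ε ^ 2 * (commConst n * (Q.eInt ω v + Q.eCut ω v + Q.eJump ω v)) +
        m ^ 2 / (2 * τ) * (n * W) := by
    have b1 : ∀ p ∈ Q.B, a p * Q.jump (fun α => ω α * v α) p ≤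
        τ * (ω p.1 * Q.jump v p ^ 2) + τ * ε ^ 2 * (ω p.1 * v (p.1 + dir p.2) ^ 2) +
          m ^ 2 / (2 * τ) * ω p.1 := by
      intro p hp
      have := mul_perturbed_le (hω.pos p.1).le hτ0 (ha p hp)
        (Q.jump_weighted hω v p)
      rwa [sq_abs] at this
    refine (Finset.sum_le_sum b1).trans ?_
    rw [Finset.sum_add_distrib, Finset.sum_add_distrib, ← Finset.mul_sum, ← Finset.mul_sum,
      ← Finset.mul_sum]
    have b2 := mul_le_mul_of_nonneg_left (Q.sum_B_end_le hQ hω hε1 v)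
      (show 0 ≤ τ * ε ^ 2 by positivity)
    have b3 := mul_le_mul_of_nonneg_left (cnt Q.B fun p hp => (hQ.near p hp).1)
      (show 0 ≤ m ^ 2 / (2 * τ) by positivity)
    rw [eJump]
    rw [eJump] at b2
    linarith
  have h3 : ∑ p ∈ Q.ghost, b p * Grid.secondDiff (fun α => ω α * v α) p.1 p.2 ≤
      τ * Q.eGhost ω v + τ * ε ^ 2 * (commConst n * (Q.eInt ω v + Q.eCut ω v + Q.eJump ω v)) +
        m ^ 2 / (2 * τ) * (n * W) := by
    have b1 : ∀ p ∈ Q.ghost, b p * Grid.secondDiff (fun α => ω α * v α) p.1 p.2 ≤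
        τ * (ω p.1 * Grid.secondDiff v p.1 p.2 ^ 2) +
          τ * ε ^ 2 * (ω p.1 * (|v (p.1 + dir p.2)| + |v (p.1 - dir p.2)|) ^ 2) +
          m ^ 2 / (2 * τ) * ω p.1 := fun p hp =>
      mul_perturbed_le (hω.pos p.1).le hτ0 (hb p hp)
        (secondDiff_weighted hω v p)
    refine (Finset.sum_le_sum b1).trans ?_
    rw [Finset.sum_add_distrib, Finset.sum_add_distrib, ← Finset.mul_sum, ← Finset.mul_sum,
      ← Finset.mul_sum]
    have b2 := mul_le_mul_of_nonneg_left (Q.sum_ghost_ends_le hω hε1 v)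
      (show 0 ≤ τ * ε ^ 2 by positivity)
    have b3 := mul_le_mul_of_nonneg_left (cnt Q.ghost fun p hp => Q.ghost_mem_layer hp)
      (show 0 ≤ m ^ 2 / (2 * τ) by positivity)
    rw [eGhost]
    linarith
  set S := Q.eInt ω v + Q.eCut ω v + Q.eJump ω v with hS
  have hS0 : 0 ≤ S := by positivity
  have hcomm0 : 0 ≤ commConst n := by rw [commConst]; positivity
  have h4 := mul_le_mul_of_nonneg_left h2 (show 0 ≤ γ / 2 by positivity)
  have h5 := mul_le_mul_of_nonneg_left h3 hσ0.le
  have h6 : (γ / 2 + σ) * (τ * ε ^ 2 * (commConst n * S)) ≤ τ * S := by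
    have c1 := mul_le_mul_of_nonneg_right hc hS0
    have c2 := mul_le_mul_of_nonneg_left c1 hτ0.le
    have c3 : 0 ≤ γ / 2 * (τ * ε ^ 2 * (commConst n * S)) := by positivity
    have c4 : κ * S ≤ S := by nlinarith
    have c5 := mul_le_mul_of_nonneg_left c4 hτ0.le
    linarith
  have h7 : τ * (6 * Q.eCut ω v + 12 * Q.eJump ω v) + γ / 2 * (τ * Q.eJump ω v) +
      σ * (τ * Q.eGhost ω v) + τ * S ≤ 1 / 2 * κ * Q.energy ω v := by
    have e : 1 / 2 * κ * Q.energy ω v = τ * (13 + γ + σ) * Q.energy ω v := by rw [hτdef]; ring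
    rw [e, energy, hS, mul_assoc, show τ * (6 * Q.eCut ω v + 12 * Q.eJump ω v) +
      γ / 2 * (τ * Q.eJump ω v) + σ * (τ * Q.eGhost ω v) +
      τ * (Q.eInt ω v + Q.eCut ω v + Q.eJump ω v) = τ * ((6 * Q.eCut ω v + 12 * Q.eJump ω v) +
      γ / 2 * Q.eJump ω v + σ * Q.eGhost ω v + (Q.eInt ω v + Q.eCut ω v + Q.eJump ω v)) by ring]
    refine mul_le_mul_of_nonneg_left ?_ hτ0.le
    have : 0 ≤ (γ + σ) * Q.eInt ω v := by positivity
    have : 0 ≤ (γ + σ) * Q.eCut ω v := by positivity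
    have : 0 ≤ γ * Q.eGhost ω v := by positivity
    have : 0 ≤ (γ / 2 + σ) * Q.eJump ω v := by positivity
    linarith
  have h8 : stabConst n σ γ * m ^ 2 * W = m ^ 2 / (4 * τ) * W +
      (γ / 2 + σ) * (m ^ 2 / (2 * τ) * (n * W)) := by
    rw [stabConst, ← hτ]; field_simp
  rw [h8]
  have h9 : 1 / 2 * κ * Q.energy ω v + 1 / 2 * κ * Q.energy ω v = κ * Q.energy ω v := by ring
  linarith

end LatticeDomain

/-! ### Superharmonic weights -/

/-- A radial profile with derivative `-t ^ (-n / 2)`, for `n = 1, 2, 3`. -/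
def radial (n : ℕ) (t : ℝ) : ℝ :=
  if n = 1 then -(2 * Real.sqrt t) else if n = 2 then -Real.log t else 2 / Real.sqrt t

/-- The power `t ^ (1 - n / 2)`, for `n = 1, 2, 3`. -/
def radialScale (n : ℕ) (t : ℝ) : ℝ :=
  if n = 1 then Real.sqrt t else if n = 2 then 1 else 1 / Real.sqrt t

theorem radialScale_pos {n : ℕ} {t : ℝ} (ht : 0 < t) : 0 < radialScale n t := by
  have := Real.sqrt_pos.2 ht
  unfold radialScale
  split_ifs <;> positivity

/-- With √(1 + y) = 1 + d one has y = d(d + 2), and the difference of the two sides is d⁴ times a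
factor that is nonnegative in the range considered. -/
theorem sqrt_one_add_taylor {y : ℝ} (hy : |y| ≤ 1 / 2) :
    -(2 * Real.sqrt (1 + y)) + 2 ≤ -y + y ^ 2 / 4 - y ^ 3 / 8 + 4 * y ^ 4 := by
  obtain ⟨h1, h2⟩ := abs_le.1 hy
  obtain ⟨d, hd⟩ : ∃ d, Real.sqrt (1 + y) = 1 + d := ⟨Real.sqrt (1 + y) - 1, by ring⟩
  have hs := Real.sq_sqrt (show 0 ≤ 1 + y by linarith)
  have hn := Real.sqrt_nonneg (1 + y)
  rw [hd] at hs hn ⊢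
  have hd1 : -(3 / 10) ≤ d := by nlinarith
  have hy' : y = d * (d + 2) := by nlinarith
  have hd2 : d ≤ 1 := by nlinarith
  have key : -y + y ^ 2 / 4 - y ^ 3 / 8 + 4 * y ^ 4 - (-(2 * (1 + d)) + 2) =
      d ^ 4 * (4 * (d + 2) ^ 4 - 5 / 4 - 3 / 4 * d - d ^ 2 / 8) := by
    rw [hy']; ring
  have h4 : 1 ≤ (d + 2) ^ 4 := one_le_pow₀ (by linarith)
  have : 0 ≤ d ^ 4 * (4 * (d + 2) ^ 4 - 5 / 4 - 3 / 4 * d - d ^ 2 / 8) :=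
    mul_nonneg (by positivity) (by nlinarith)
  linarith

theorem inv_sqrt_one_add_taylor {y : ℝ} (hy : |y| ≤ 1 / 2) :
    2 / Real.sqrt (1 + y) - 2 ≤ -y + 3 / 4 * y ^ 2 - 5 / 8 * y ^ 3 + 4 * y ^ 4 := by
  obtain ⟨h1, h2⟩ := abs_le.1 hy
  obtain ⟨d, hd⟩ : ∃ d, Real.sqrt (1 + y) = 1 + d := ⟨Real.sqrt (1 + y) - 1, by ring⟩
  have hs := Real.sq_sqrt (show 0 ≤ 1 + y by linarith)
  have hn := Real.sqrt_nonneg (1 + y)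
  rw [hd] at hs hn ⊢
  have hd1 : -(3 / 10) ≤ d := by nlinarith
  have hy' : y = d * (d + 2) := by nlinarith
  have hd2 : d ≤ 1 / 4 := by nlinarith
  rw [← sub_nonneg]
  have key : -y + 3 / 4 * y ^ 2 - 5 / 8 * y ^ 3 + 4 * y ^ 4 - (2 / (1 + d) - 2) =
      d ^ 4 * (4 * (1 + d) * (d + 2) ^ 4 - 35 / 4 - 21 / 2 * d - 35 / 8 * d ^ 2 - 5 / 8 * d ^ 3) /
        (1 + d) := by
    have : (1 + d) ≠ 0 := by linarith
    rw [hy']; field_simp; ring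
  rw [key]
  have h4 : (17 / 10) ^ 4 ≤ (d + 2) ^ 4 := pow_le_pow_left₀ (by norm_num) (by linarith) 4
  have h5 : 4 * (7 / 10) * (17 / 10) ^ 4 ≤ 4 * (1 + d) * (d + 2) ^ 4 := by
    refine mul_le_mul (by linarith) h4 (by positivity) (by linarith)
  have h6 : d ^ 2 ≤ 9 / 100 := by nlinarith
  have h7 : d ^ 3 ≤ 3 / 100 := by nlinarith [sq_nonneg d]
  refine div_nonneg (mul_nonneg (by positivity) ?_) (by linarith)
  norm_num at h5
  linarith

theorem log_one_add_taylor {y : ℝ} (hy : |y| ≤ 1 / 2) :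
    -Real.log (1 + y) ≤ -y + y ^ 2 / 2 - y ^ 3 / 3 + 4 * y ^ 4 := by
  have h := Real.abs_log_sub_add_sum_range_le (x := -y) (by rw [abs_neg]; linarith) 3
  rw [abs_neg, sub_neg_eq_add] at h
  simp only [Finset.sum_range_succ, Finset.sum_range_zero] at h
  have h1 := (abs_le.1 h).1
  have h2 : |y| ^ (3 + 1) / (1 - |y|) ≤ 2 * y ^ 4 := by
    rw [div_le_iff₀ (by linarith)]
    have : |y| ^ (3 + 1) = y ^ 4 := by
      rw [← Even.pow_abs (by decide : Even 4) y]
    rw [this]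
    nlinarith [show 0 ≤ y ^ 4 by positivity]
  have h3 : 0 ≤ y ^ 4 := by positivity
  norm_num at h1
  linarith

/-- In all three dimensions the derivative at t is -t^(-n/2), so one Taylor polynomial in the
relative increment y serves for the three profiles. -/
theorem radial_mul_one_add_le {n : ℕ} (hn1 : 1 ≤ n) (hn3 : n ≤ 3) {t y : ℝ} (ht : 0 < t)
    (hy : |y| ≤ 1 / 2) :
    radial n (t * (1 + y)) - radial n t ≤ radialScale n t *
      (-y + n / 4 * y ^ 2 - n * (n + 2) / 24 * y ^ 3 + 4 * y ^ 4) := by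
  obtain ⟨h1, h2⟩ := abs_le.1 hy
  have hs := Real.sqrt_pos.2 ht
  have hs' := Real.sqrt_pos.2 (show 0 < 1 + y by linarith)
  interval_cases n
  · have := mul_le_mul_of_nonneg_left (sqrt_one_add_taylor hy) hs.le
    simp only [radial, radialScale, if_true]
    rw [Real.sqrt_mul ht.le]
    push_cast
    linarith
  · have := log_one_add_taylor hy
    simp only [radial, radialScale, if_true, show (2 : ℕ) ≠ 1 by norm_num, if_false]
    rw [Real.log_mul ht.ne' (by linarith)]
    push_cast
    linarith
  · have := mul_le_mul_of_nonneg_left (inv_sqrt_one_add_taylor hy) (one_div_pos.2 hs).le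
    simp only [radial, radialScale, show (3 : ℕ) ≠ 1 by norm_num, show (3 : ℕ) ≠ 2 by norm_num,
      if_false]
    rw [Real.sqrt_mul ht.le]
    have e : 1 / Real.sqrt t * (2 / Real.sqrt (1 + y) - 2) =
      2 / (Real.sqrt t * Real.sqrt (1 + y)) - 2 / Real.sqrt t := by field_simp
    push_cast
    rw [e] at this
    refine this.trans (le_of_eq ?_)
    ring

/-- The regularized squared distance on the lattice. -/
def latDist {n : ℕ} (K : ℝ) (α₀ α : Idx n) : ℝ := ∑ i, ((α i : ℝ) - α₀ i) ^ 2 + K ^ 2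

theorem latDist_step {n : ℕ} (K : ℝ) (α₀ α : Idx n) (s : SDir n) :
    latDist K α₀ (α + step s) = latDist K α₀ α +
      (1 + (if s.2 then 1 else -1) * (2 * ((α s.1 : ℝ) - α₀ s.1))) := by
  classical
  have h : ∀ i, (((α + step s) i : ℤ) : ℝ) - α₀ i = ((α i : ℝ) - α₀ i) +
      if i = s.1 then (if s.2 then 1 else -1) else 0 := by
    intro i
    rcases s with ⟨j, b⟩
    by_cases hij : i = j
    · subst hij
      cases b <;> simp [step, dir] <;> ring
    · cases b <;> simp [step, dir, hij]
  have h2 : ∀ i, ((((α + step s) i : ℤ) : ℝ) - α₀ i) ^ 2 = ((α i : ℝ) - α₀ i) ^ 2 +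
      if i = s.1 then 1 + (if s.2 then 1 else -1) * (2 * ((α i : ℝ) - α₀ i)) else 0 := by
    intro i
    rw [h i]
    split_ifs <;> ring
  simp only [latDist, h2, Finset.sum_add_distrib, Finset.sum_ite_eq', Finset.mem_univ, if_true]
  ring

theorem latDist_ge {n : ℕ} (K : ℝ) (α₀ α : Idx n) (i : Fin n) :
    ((α i : ℝ) - α₀ i) ^ 2 + K ^ 2 ≤ latDist K α₀ α := by
  have := Finset.single_le_sum (f := fun i => ((α i : ℝ) - α₀ i) ^ 2)
    (fun i _ => sq_nonneg _) (Finset.mem_univ i)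
  rw [latDist]
  linarith

theorem latDist_ge_sq {n : ℕ} (K : ℝ) (α₀ α : Idx n) : K ^ 2 ≤ latDist K α₀ α := by
  have : 0 ≤ ∑ i, ((α i : ℝ) - α₀ i) ^ 2 := Finset.sum_nonneg fun i _ => sq_nonneg _
  rw [latDist]
  linarith

theorem latDist_step_eq {n : ℕ} {K : ℝ} (hK : 9 ≤ K) (α₀ α : Idx n) (s : SDir n) :
    ∃ y : ℝ, |y| ≤ 2 / K ∧ latDist K α₀ (α + step s) = latDist K α₀ α * (1 + y) ∧
      y = (1 + (if s.2 then 1 else -1) * (2 * ((α s.1 : ℝ) - α₀ s.1))) / latDist K α₀ α := by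
  have ht : 0 < latDist K α₀ α := lt_of_lt_of_le (by positivity) (latDist_ge_sq K α₀ α)
  refine ⟨_, ?_, ?_, rfl⟩
  · rw [abs_div, abs_of_pos ht, div_le_div_iff₀ ht (by linarith)]
    have h1 := latDist_ge K α₀ α s.1
    set a := (α s.1 : ℝ) - α₀ s.1
    have h2 : |1 + (if s.2 then 1 else -1) * (2 * a)| ≤ 1 + 2 * |a| := by
      refine (abs_add_le _ _).trans ?_
      rw [abs_one, abs_mul, abs_mul]
      split_ifs <;> simp
    have h3 := mul_le_mul_of_nonneg_right h2 (show 0 ≤ K by linarith)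
    nlinarith [sq_abs a, sq_nonneg (|a| - K)]
  · rw [latDist_step]; field_simp

/-- As t is a squared distance, the profile is a multiple of the fundamental solution of the
Laplacian up to regularization. Adding opposite directions and then all axes, the first-order terms
2nt and the second-order terms -2n(t - K²) cancel up to 2nK², the gain of the regularization. The
cubic terms add up to something nonnegative, the quartic ones cost at most 128 per axis, and 2K² ≥
162 beats 128 plus the lower-order terms. -/
theorem radial_superharmonic {n : ℕ} (hn1 : 1 ≤ n) (hn3 : n ≤ 3) {K : ℝ} (hK : 9 ≤ K)
    (α₀ α : Idx n) :
    radialScale n (latDist K α₀ α) * n / latDist K α₀ α ^ 2 ≤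
      ∑ s, sdiff (fun β => radial n (latDist K α₀ β)) α s := by
  set t := latDist K α₀ α with htdef
  have ht : 0 < t := lt_of_lt_of_le (by positivity) (latDist_ge_sq K α₀ α)
  have hP := radialScale_pos (n := n) ht
  have hone : ∀ s : SDir n, ∀ y : ℝ, y = (1 + (if s.2 then 1 else -1) * (2 * ((α s.1 : ℝ) - α₀ s.1))) / t →
      radialScale n t * -(-y + n / 4 * y ^ 2 - n * (n + 2) / 24 * y ^ 3 + 4 * y ^ 4) ≤
      sdiff (fun β => radial n (latDist K α₀ β)) α s := by
    intro s y hy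
    obtain ⟨y', h1, h2, h3⟩ := latDist_step_eq hK α₀ α s
    have : y' = y := by rw [hy, h3]
    subst this
    have hy2 : |y'| ≤ 1 / 2 := h1.trans (by rw [div_le_div_iff₀ (by linarith) two_pos]; linarith)
    have := radial_mul_one_add_le hn1 hn3 ht hy2
    simp only [sdiff, h2, ← htdef]
    linarith
  have htsum : ∑ i, ((α i : ℝ) - α₀ i) ^ 2 = t - K ^ 2 := by rw [htdef, latDist]; ring
  have hdim : ∀ i : Fin n, radialScale n t / t ^ 2 * (2 * t - n / 4 * (2 + 8 * ((α i : ℝ) - α₀ i) ^ 2)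
      - 128) ≤
      sdiff (fun β => radial n (latDist K α₀ β)) α (i, true) +
      sdiff (fun β => radial n (latDist K α₀ β)) α (i, false) := by
    intro i
    have h1 := hone (i, true) _ rfl
    have h2 := hone (i, false) _ rfl
    have h3 := latDist_ge K α₀ α i
    rw [← htdef] at h3
    set a := (α i : ℝ) - α₀ i
    simp only [if_true, Bool.false_eq_true, if_false] at h1 h2
    refine le_trans ?_ (add_le_add h1 h2)
    rw [← mul_add, div_mul_eq_mul_div, div_le_iff₀ (by positivity), mul_assoc]
    refine mul_le_mul_of_nonneg_left ?_ hP.le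
    have e : (-(-((1 + 1 * (2 * a)) / t) + n / 4 * ((1 + 1 * (2 * a)) / t) ^ 2 -
        n * (n + 2) / 24 * ((1 + 1 * (2 * a)) / t) ^ 3 + 4 * ((1 + 1 * (2 * a)) / t) ^ 4) +
        -(-((1 + -1 * (2 * a)) / t) + n / 4 * ((1 + -1 * (2 * a)) / t) ^ 2 -
        n * (n + 2) / 24 * ((1 + -1 * (2 * a)) / t) ^ 3 +
        4 * ((1 + -1 * (2 * a)) / t) ^ 4)) * t ^ 2 =
        2 * t - n / 4 * (2 + 8 * a ^ 2) + n * (n + 2) / 24 * ((2 + 24 * a ^ 2) / t) -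
        4 * ((2 + 48 * a ^ 2 + 32 * a ^ 4) / t ^ 2) := by
      field_simp; ring
    rw [e]
    have p1 : 0 ≤ (n : ℝ) * (n + 2) / 24 * ((2 + 24 * a ^ 2) / t) := by positivity
    have p2 : (2 + 48 * a ^ 2 + 32 * a ^ 4) / t ^ 2 ≤ 32 := by
      rw [div_le_iff₀ (by positivity)]
      have : (a ^ 2 + K ^ 2) ^ 2 ≤ t ^ 2 := pow_le_pow_left₀ (by positivity) h3 2
      nlinarith [mul_nonneg (sq_nonneg a) (show 0 ≤ K ^ 2 - 81 by nlinarith),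
        mul_self_nonneg (K ^ 2 - 1), show 81 ≤ K ^ 2 by nlinarith]
    linarith
  have hs : ∑ s, sdiff (fun β => radial n (latDist K α₀ β)) α s =
      ∑ i, (sdiff (fun β => radial n (latDist K α₀ β)) α (i, true) +
        sdiff (fun β => radial n (latDist K α₀ β)) α (i, false)) := by
    rw [Fintype.sum_prod_type]
    exact Finset.sum_congr rfl fun i _ => Fintype.sum_bool _
  rw [hs]
  refine le_trans ?_ (Finset.sum_le_sum fun i _ => hdim i)
  have hsum : ∑ i, (2 * t - n / 4 * (2 + 8 * ((α i : ℝ) - α₀ i) ^ 2) - 128) =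
      n * (2 * t) - n * (n / 2 + 2 * (t - K ^ 2)) - 128 * n := by
    simp only [Finset.sum_sub_distrib, ← Finset.mul_sum, Finset.sum_add_distrib, htsum,
      Finset.sum_const, Finset.card_univ, Fintype.card_fin, nsmul_eq_mul]
    ring
  rw [← Finset.mul_sum, hsum]
  rw [mul_div_right_comm]
  refine mul_le_mul_of_nonneg_left ?_ (by positivity)
  have hn : (n : ℝ) ≤ 3 := by exact_mod_cast hn3
  have hn0 : (1 : ℝ) ≤ n := by exact_mod_cast hn1
  nlinarith [mul_nonneg (show (0:ℝ) ≤ n by linarith) (show 0 ≤ K ^ 2 - 81 by nlinarith)]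

/-- A small relative variation of the weight is needed. For n = 3 the profile has it by itself. For
n = 1 and n = 2 the bound is absolute, and becomes relative once the weight is bounded below by a
suitable constant. -/
theorem radial_variation {n : ℕ} (hn1 : 1 ≤ n) (hn3 : n ≤ 3) {K : ℝ} (hK : 9 ≤ K)
    (α₀ α : Idx n) (s : SDir n) :
    |radial n (latDist K α₀ α) - radial n (latDist K α₀ (α + step s))| ≤
      if n = 1 then 6 else 4 / K * (if n = 2 then 1 else radial n (latDist K α₀ α)) := by
  obtain ⟨y, h1, h2, h3⟩ := latDist_step_eq hK α₀ α s
  have hge := latDist_ge K α₀ α s.1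
  have hge2 := latDist_ge_sq K α₀ α
  set t := latDist K α₀ α with htdef
  have ht : 0 < t := lt_of_lt_of_le (by positivity) hge2
  have hy2 : |y| ≤ 1 / 2 := h1.trans (by rw [div_le_div_iff₀ (by linarith) two_pos]; linarith)
  obtain ⟨h4, h5⟩ := abs_le.1 hy2
  have hs := Real.sqrt_pos.2 ht
  have hs' := Real.sqrt_pos.2 (show 0 < 1 + y by linarith)
  have hsq := Real.sq_sqrt (show 0 ≤ 1 + y by linarith)
  have hw : |Real.sqrt (1 + y) - 1| ≤ |y| := by
    have e : (Real.sqrt (1 + y) - 1) * (Real.sqrt (1 + y) + 1) = y := by nlinarith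
    have := congrArg abs e
    rw [abs_mul, abs_of_pos (show 0 < Real.sqrt (1 + y) + 1 by linarith)] at this
    nlinarith [abs_nonneg (Real.sqrt (1 + y) - 1)]
  rw [h2]
  clear_value t
  interval_cases n
  · simp only [radial, if_true]
    rw [Real.sqrt_mul ht.le]
    have e : -(2 * Real.sqrt t) - -(2 * (Real.sqrt t * Real.sqrt (1 + y))) =
      2 * Real.sqrt t * (Real.sqrt (1 + y) - 1) := by ring
    rw [e, abs_mul, abs_of_pos (by positivity)]
    have hty : |y| * t ≤ 1 + 2 * |(α s.1 : ℝ) - α₀ s.1| := by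
      rw [h3, abs_div, abs_of_pos ht, div_mul_cancel₀ _ ht.ne']
      refine (abs_add_le _ _).trans ?_
      rw [abs_one, abs_mul, abs_mul]
      split_ifs <;> simp
    have hst : |(α s.1 : ℝ) - α₀ s.1| ≤ Real.sqrt t := by
      rw [← Real.sqrt_sq_eq_abs]
      exact Real.sqrt_le_sqrt (by nlinarith)
    have hs1 : 1 ≤ Real.sqrt t := by
      rw [Real.one_le_sqrt]; nlinarith
    have hst2 := Real.sq_sqrt ht.le
    have : Real.sqrt t * |y| ≤ 3 := by
      have : Real.sqrt t * (Real.sqrt t * |y|) ≤ Real.sqrt t * 3 := by nlinarith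
      exact le_of_mul_le_mul_left this hs
    nlinarith
  · simp only [radial, if_true, show (2 : ℕ) ≠ 1 by norm_num, if_false]
    rw [Real.log_mul ht.ne' (by linarith)]
    have hl : |Real.log (1 + y)| ≤ 2 * |y| := by
      have u1 := Real.log_le_sub_one_of_pos (show 0 < 1 + y by linarith)
      have u2 := Real.one_sub_inv_le_log_of_pos (show 0 < 1 + y by linarith)
      have u3 : 1 - (1 + y)⁻¹ = y / (1 + y) := by
        have : 1 + y ≠ 0 := by linarith
        field_simp; ring
      have u4 : -(2 * |y|) ≤ y / (1 + y) := by
        rw [le_div_iff₀ (by linarith)]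
        nlinarith [neg_abs_le y, abs_nonneg y]
      rw [abs_le]
      constructor
      · linarith
      · linarith [le_abs_self y, abs_nonneg y]
    rw [show -Real.log t - -(Real.log t + Real.log (1 + y)) = Real.log (1 + y) by ring]
    refine hl.trans ?_
    have : 4 / K = 2 * (2 / K) := by ring
    linarith
  · simp only [radial, show (3 : ℕ) ≠ 1 by norm_num, show (3 : ℕ) ≠ 2 by norm_num, if_false]
    rw [Real.sqrt_mul ht.le]
    have e : 2 / Real.sqrt t - 2 / (Real.sqrt t * Real.sqrt (1 + y)) =
      (Real.sqrt (1 + y) - 1) / Real.sqrt (1 + y) * (2 / Real.sqrt t) := by field_simp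
    rw [e, abs_mul, abs_of_pos (show 0 < 2 / Real.sqrt t by positivity)]
    refine mul_le_mul_of_nonneg_right ?_ (by positivity)
    rw [abs_div, abs_of_pos hs', div_le_iff₀ hs']
    have : 1 / 2 ≤ Real.sqrt (1 + y) := by
      rw [Real.le_sqrt' (by norm_num)]; linarith
    have k1 : 4 / K = 2 * (2 / K) := by ring
    have k2 : 0 ≤ 2 / K := by positivity
    nlinarith

/-! ### Sums of the weights over lattice hyperplanes. -/

theorem sum_range_inv_sqrt_le (m : ℕ) :
    ∑ k ∈ Finset.range m, 1 / Real.sqrt (1 + k) ≤ 2 * Real.sqrt m := by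
  induction m with
  | zero => simp
  | succ k ih =>
    rw [Finset.sum_range_succ]
    have h1 : 0 < Real.sqrt (1 + k) := Real.sqrt_pos.2 (by positivity)
    have h2 := Real.sq_sqrt (show (0 : ℝ) ≤ 1 + k by positivity)
    have h3 := Real.sq_sqrt (show (0 : ℝ) ≤ k by positivity)
    -- This is the telescoping comparison with the integral of the inverse square root.
    have h4 : 1 / Real.sqrt (1 + k) ≤ 2 * Real.sqrt (1 + k) - 2 * Real.sqrt k := by
      rw [div_le_iff₀ h1]
      nlinarith [sq_nonneg (Real.sqrt (1 + k) - Real.sqrt k)]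
    push_cast
    rw [add_comm (k : ℝ) 1]
    linarith

/-- The multi-indices `{0, …, N}ⁿ`. -/
def idxBox (n N : ℕ) : Finset (Idx n) := Finset.Icc 0 fun _ => (N : ℤ)

theorem mem_idxBox {n N : ℕ} {α : Idx n} : α ∈ idxBox n N ↔ ∀ i, 0 ≤ α i ∧ α i ≤ N := by
  simp [idxBox, Finset.mem_Icc, Pi.le_def, forall_and]

/-- On each side of c the distance to c is injective. The constant is 2 · 2 · (3/2), the last factor
from √(N + 1) ≤ (3/2)√N. -/
theorem sum_Icc_inv_sqrt_le {N : ℕ} (hN : 1 ≤ N) {c : ℤ} (h0 : 0 ≤ c) (hc : c ≤ N) :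
    ∑ x ∈ Finset.Icc (0 : ℤ) N, 1 / Real.sqrt (1 + |(x : ℝ) - c|) ≤ 6 * Real.sqrt N := by
  have e : ∀ x : ℤ, 1 / Real.sqrt (1 + |(x : ℝ) - c|) =
      1 / Real.sqrt (1 + (((x - c).natAbs : ℕ) : ℝ)) := by
    intro x
    rw [Nat.cast_natAbs]
    push_cast
    rfl
  have half : ∀ S : Finset ℤ, (∀ x ∈ S, 0 ≤ x ∧ x ≤ N) →
      Set.InjOn (fun x : ℤ => (x - c).natAbs) S →
      ∑ x ∈ S, 1 / Real.sqrt (1 + |(x : ℝ) - c|) ≤ 2 * Real.sqrt ((N + 1 : ℕ) : ℝ) := by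
    intro S hS hinj
    simp only [e]
    refine (sum_le_sum_of_injOn_maps (T := Finset.range (N + 1)) (fun x : ℤ => (x - c).natAbs) hinj
      ?_ (g := fun k => 1 / Real.sqrt (1 + (k : ℝ))) fun k _ => by positivity).trans
      (sum_range_inv_sqrt_le _)
    intro x hx
    have := hS x hx
    rw [Finset.mem_range]
    omega
  rw [← Finset.sum_filter_add_sum_filter_not (Finset.Icc (0 : ℤ) N) (fun x => c ≤ x)]
  have h1 := half ((Finset.Icc (0 : ℤ) N).filter fun x => c ≤ x)
    (fun x hx => Finset.mem_Icc.1 (Finset.mem_filter.1 hx).1) (by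
      intro x hx y hy hxy
      have := (Finset.mem_filter.1 hx).2
      have := (Finset.mem_filter.1 hy).2
      simp only at hxy
      omega)
  have h2 := half ((Finset.Icc (0 : ℤ) N).filter fun x => ¬ c ≤ x)
    (fun x hx => Finset.mem_Icc.1 (Finset.mem_filter.1 hx).1) (by
      intro x hx y hy hxy
      have := (Finset.mem_filter.1 hx).2
      have := (Finset.mem_filter.1 hy).2
      simp only at hxy
      omega)
  have hN' : (1 : ℝ) ≤ N := by exact_mod_cast hN
  have h3 : Real.sqrt ((N + 1 : ℕ) : ℝ) ≤ 3 / 2 * Real.sqrt N := by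
    rw [Real.sqrt_le_left (by positivity), mul_pow, Real.sq_sqrt (by positivity)]
    push_cast
    linarith
  linarith

/-- A bound of `ω` on the grid that is constant along the lines of each direction, and whose sum
over these lines is at most `A N`. -/
def ColumnBound {n : ℕ} (N : ℕ) (A : ℝ) (ω : Idx n → ℝ) : Prop :=
  ∃ maj : Fin n → Idx n → ℝ, (∀ i α, 0 ≤ maj i α) ∧
    (∀ i α x, maj i (Function.update α i x) = maj i α) ∧
    (∀ i, ∑ α ∈ (idxBox n N).filter (fun α => α i = 0), maj i α ≤ A * N) ∧
    ∀ i, ∀ α ∈ idxBox n N, ω α ≤ maj i α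

theorem idxBox_filter {n N : ℕ} (i : Fin n) : (idxBox n N).filter (fun α => α i = 0) =
    Fintype.piFinset fun j => if j = i then {0} else Finset.Icc (0 : ℤ) N := by
  ext α
  simp only [Finset.mem_filter, mem_idxBox, Fintype.mem_piFinset]
  constructor
  · rintro ⟨h1, h2⟩ j
    split_ifs with h
    · rw [h, h2]; simp
    · exact Finset.mem_Icc.2 (h1 j)
  · intro h
    have hi : α i = 0 := by simpa using h i
    refine ⟨fun j => ?_, hi⟩
    by_cases hj : j = i
    · rw [hj, hi]; simp
    · have := h j
      rw [if_neg hj] at this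
      exact Finset.mem_Icc.1 this

theorem prod_ite_const {n : ℕ} (i : Fin n) (c : ℝ) :
    ∏ j, (if j = i then 1 else c) = c ^ (n - 1) := by
  rw [Finset.prod_ite]
  simp [Finset.filter_ne', Finset.card_erase_of_mem]

/-- Each of the n - 1 coordinates transverse to i contributes 6√N to the sum over the hyperplane,
and √N^(3-n) · √N^(n-1) = N in every dimension. The product form of the majorant is what makes the
sum factor. -/
theorem columnBound_of_le {n N : ℕ} (hn1 : 1 ≤ n) (hn3 : n ≤ 3) (hN : 1 ≤ N) {α₀ : Idx n}
    (hα₀ : α₀ ∈ idxBox n N) {A : ℝ} (hA : 0 ≤ A) {ω : Idx n → ℝ}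
    (h : ∀ i, ∀ α ∈ idxBox n N, ω α ≤ A * Real.sqrt N ^ (3 - n) *
      ∏ j, if j = i then 1 else 1 / Real.sqrt (1 + |(α j : ℝ) - α₀ j|)) :
    ColumnBound N (36 * A) ω := by
  refine ⟨fun i α => A * Real.sqrt N ^ (3 - n) *
      ∏ j, if j = i then 1 else 1 / Real.sqrt (1 + |(α j : ℝ) - α₀ j|), ?_, ?_, ?_, h⟩
  · intro i α
    refine mul_nonneg (by positivity) (Finset.prod_nonneg fun j _ => ?_)
    split_ifs <;> positivity
  · intro i α x
    simp only
    congr 1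
    refine Finset.prod_congr rfl fun j _ => ?_
    split_ifs with hj
    · rfl
    · rw [Function.update_of_ne hj]
  · intro i
    rw [idxBox_filter, ← Finset.mul_sum]
    rw [← Finset.prod_univ_sum (t := fun j => if j = i then {0} else Finset.Icc (0 : ℤ) N)
      (f := fun j x => if j = i then 1 else 1 / Real.sqrt (1 + |(x : ℝ) - α₀ j|))]
    have h1 : ∏ j, ∑ x ∈ (if j = i then {0} else Finset.Icc (0 : ℤ) N),
        (if j = i then 1 else 1 / Real.sqrt (1 + |(x : ℝ) - α₀ j|)) ≤
        ∏ j, (if j = i then 1 else 6 * Real.sqrt N) := by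
      refine Finset.prod_le_prod (fun j _ => Finset.sum_nonneg fun x _ => ?_) fun j _ => ?_
      · split_ifs <;> positivity
      · by_cases hj : j = i
        · simp [hj]
        · simp only [hj, if_false]
          exact sum_Icc_inv_sqrt_le hN (mem_idxBox.1 hα₀ j).1 (mem_idxBox.1 hα₀ j).2
    rw [prod_ite_const] at h1
    refine (mul_le_mul_of_nonneg_left h1 (by positivity)).trans ?_
    have hs := Real.sq_sqrt (show (0 : ℝ) ≤ N by positivity)
    have h36 : (6 : ℝ) ^ (n - 1) ≤ 36 := by interval_cases n <;> norm_num
    have e : A * Real.sqrt N ^ (3 - n) * (6 * Real.sqrt N) ^ (n - 1) = A * 6 ^ (n - 1) * N := by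
      have : Real.sqrt N ^ (3 - n) * Real.sqrt N ^ (n - 1) = N := by
        rw [← pow_add, show 3 - n + (n - 1) = 2 by omega, hs]
      rw [mul_pow]
      linear_combination A * 6 ^ (n - 1) * this
    rw [e]
    have : A * 6 ^ (n - 1) ≤ 36 * A := by nlinarith
    exact mul_le_mul_of_nonneg_right this (by positivity)

theorem latDist_le {n N : ℕ} (K : ℝ) {α₀ α : Idx n} (hα₀ : α₀ ∈ idxBox n N)
    (hα : α ∈ idxBox n N) : latDist K α₀ α ≤ n * (N : ℝ) ^ 2 + K ^ 2 := by
  rw [latDist]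
  have : ∑ i, ((α i : ℝ) - α₀ i) ^ 2 ≤ ∑ _i : Fin n, (N : ℝ) ^ 2 := by
    refine Finset.sum_le_sum fun i _ => ?_
    obtain ⟨a1, a2⟩ := mem_idxBox.1 hα i
    obtain ⟨b1, b2⟩ := mem_idxBox.1 hα₀ i
    have a1' : (0 : ℝ) ≤ α i := by exact_mod_cast a1
    have a2' : (α i : ℝ) ≤ N := by exact_mod_cast a2
    have b1' : (0 : ℝ) ≤ α₀ i := by exact_mod_cast b1
    have b2' : (α₀ i : ℝ) ≤ N := by exact_mod_cast b2
    exact sq_le_sq' (by linarith) (by linarith)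
  simp only [Finset.sum_const, Finset.card_univ, Fintype.card_fin, nsmul_eq_mul] at this
  linarith

/-- The constant added to the radial profile to make it positive on the grid. -/
def radialOffset (n N : ℕ) (K m : ℝ) : ℝ :=
  if n = 1 then 2 * Real.sqrt ((N : ℝ) ^ 2 + K ^ 2) + m
  else if n = 2 then Real.log (2 * (N : ℝ) ^ 2 + K ^ 2) + m else m

theorem le_offset_add_radial {n N : ℕ} (hn1 : 1 ≤ n) (hn3 : n ≤ 3) {K : ℝ} (hK : 9 ≤ K) (m : ℝ)
    {α₀ α : Idx n} (hα₀ : α₀ ∈ idxBox n N) (hα : α ∈ idxBox n N) :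
    m ≤ radialOffset n N K m + radial n (latDist K α₀ α) := by
  have h1 := latDist_le K hα₀ hα
  have h2 := latDist_ge_sq K α₀ α
  have ht : 0 < latDist K α₀ α := lt_of_lt_of_le (by positivity) h2
  generalize latDist K α₀ α = t at *
  interval_cases n
  · simp only [radialOffset, radial, if_true]
    have := Real.sqrt_le_sqrt h1
    norm_num at this
    linarith
  · simp only [radialOffset, radial, if_true, show (2 : ℕ) ≠ 1 by norm_num, if_false]
    have := Real.log_le_log ht h1
    norm_num at this
    linarith
  · simp only [radialOffset, radial, show (3 : ℕ) ≠ 1 by norm_num, show (3 : ℕ) ≠ 2 by norm_num,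
      if_false]
    have : 0 ≤ 2 / Real.sqrt t := by positivity
    linarith

theorem offset_add_radial_one_le {N : ℕ} (hN : 1 ≤ N) {K m : ℝ} (hK : 9 ≤ K) (hm : 0 ≤ m)
    (α₀ α : Idx 1) :
    radialOffset 1 N K m + radial 1 (latDist K α₀ α) ≤ (2 + 2 * K + m) * Real.sqrt N ^ 2 := by
  simp only [radialOffset, radial, if_true]
  have h1 : Real.sqrt ((N : ℝ) ^ 2 + K ^ 2) ≤ N + K :=
    Real.sqrt_le_iff.2 ⟨by positivity, by nlinarith [mul_nonneg (Nat.cast_nonneg (α := ℝ) N) (show 0 ≤ K by linarith)]⟩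
  have h2 := Real.sqrt_nonneg (latDist K α₀ α)
  have hN' : (1 : ℝ) ≤ N := by exact_mod_cast hN
  rw [Real.sq_sqrt (by positivity)]
  nlinarith

/-- In dimension 2 the logarithm of the squared ratio of grid size to distance is dominated by the
square root of that ratio, which is summable along a line with total O(N) after multiplication by
√N. -/
theorem offset_add_radial_two_le {N : ℕ} (hN : 1 ≤ N) {K : ℝ} (hK : 9 ≤ K)
    {α₀ α : Idx 2} (hα₀ : α₀ ∈ idxBox 2 N) (hα : α ∈ idxBox 2 N) (j : Fin 2) :
    radialOffset 2 N K 1 + radial 2 (latDist K α₀ α) ≤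
      5 * Real.sqrt (3 * K) * Real.sqrt N * (1 / Real.sqrt (1 + |(α j : ℝ) - α₀ j|)) := by
  simp only [radialOffset, radial, if_true, show (2 : ℕ) ≠ 1 by norm_num, if_false]
  have h1 := latDist_le K hα₀ hα
  have h2 := latDist_ge K α₀ α j
  have h3 := latDist_ge_sq K α₀ α
  have ht : 0 < latDist K α₀ α := lt_of_lt_of_le (by positivity) h3
  set t := latDist K α₀ α
  set b := |(α j : ℝ) - α₀ j| with hb
  have hb0 : 0 ≤ b := abs_nonneg _
  have hb2 : ((α j : ℝ) - α₀ j) ^ 2 = b ^ 2 := (sq_abs _).symm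
  rw [hb2] at h2
  have hN' : (1 : ℝ) ≤ N := by exact_mod_cast hN
  have hR : 0 < 2 * (N : ℝ) ^ 2 + K ^ 2 := by positivity
  set x := (2 * (N : ℝ) ^ 2 + K ^ 2) / t with hx
  have hx1 : 1 ≤ x := by
    rw [hx, one_le_div ht]
    push_cast at h1
    exact h1
  have hlog : Real.log (2 * (N : ℝ) ^ 2 + K ^ 2) + 1 + -Real.log t = Real.log x + 1 := by
    rw [hx, Real.log_div hR.ne' ht.ne']; ring
  -- The fourth root turns the logarithm into 4 log q ≤ 4(q - 1), and x is at most the square of 3KN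
  -- / (1 + b).
  set q := Real.sqrt (Real.sqrt x) with hq
  have hq4 : x = q ^ 4 := by
    rw [hq, show (4 : ℕ) = 2 * 2 by norm_num, pow_mul, Real.sq_sqrt (Real.sqrt_nonneg _),
      Real.sq_sqrt (by linarith)]
  have hq1 : 1 ≤ q := by
    rw [hq, Real.one_le_sqrt, Real.one_le_sqrt]; exact hx1
  have hl : Real.log x + 1 ≤ 5 * q := by
    rw [hq4, Real.log_pow]
    have := Real.log_le_sub_one_of_pos (show 0 < q by linarith)
    push_cast
    linarith
  have hxle : x ≤ (3 * K * N / (1 + b)) ^ 2 := by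
    rw [hx, div_pow, div_le_div_iff₀ ht (by positivity)]
    have a1 : (1 + b) ^ 2 ≤ 2 * t := by nlinarith [sq_nonneg (b - 1)]
    have a2 : 2 * (N : ℝ) ^ 2 + K ^ 2 ≤ 3 * (K * N) ^ 2 := by
      nlinarith [mul_nonneg (sq_nonneg (N : ℝ)) (show 0 ≤ K ^ 2 - 1 by nlinarith),
        mul_nonneg (sq_nonneg K) (show 0 ≤ (N : ℝ) ^ 2 - 1 by nlinarith)]
    nlinarith [mul_le_mul a2 a1 (by positivity) (by positivity), sq_nonneg (K * N)]
  have hqle : q ≤ Real.sqrt (3 * K) * Real.sqrt N * (1 / Real.sqrt (1 + b)) := by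
    have : Real.sqrt x ≤ 3 * K * N / (1 + b) := Real.sqrt_le_iff.2 ⟨by positivity, hxle⟩
    have := Real.sqrt_le_sqrt this
    rw [Real.sqrt_div' (3 * K * N) (by positivity : 0 ≤ 1 + b),
      Real.sqrt_mul (by positivity : 0 ≤ 3 * K)] at this
    rw [mul_one_div]
    exact this
  rw [hlog]
  linarith

/-- In dimension 3 the inverse distance is split into inverse square roots of two coordinate
distances, by (1 + x)(1 + y) ≤ x² + y² + K². -/
theorem radial_three_le {K : ℝ} (hK : 9 ≤ K) (α₀ α : Idx 3) {j k : Fin 3} (hjk : j ≠ k) :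
    radial 3 (latDist K α₀ α) ≤ 2 * (1 / Real.sqrt (1 + |(α j : ℝ) - α₀ j|) *
      (1 / Real.sqrt (1 + |(α k : ℝ) - α₀ k|))) := by
  simp only [radial, show (3 : ℕ) ≠ 1 by norm_num, show (3 : ℕ) ≠ 2 by norm_num, if_false]
  have h2 : ((α j : ℝ) - α₀ j) ^ 2 + ((α k : ℝ) - α₀ k) ^ 2 + K ^ 2 ≤ latDist K α₀ α := by
    rw [latDist]
    have := Finset.sum_le_sum_of_subset_of_nonneg (Finset.subset_univ {j, k})
      (f := fun i => ((α i : ℝ) - α₀ i) ^ 2) (fun i _ _ => sq_nonneg _)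
    rw [Finset.sum_pair hjk] at this
    linarith
  set x := |(α j : ℝ) - α₀ j|
  set y := |(α k : ℝ) - α₀ k|
  have hx0 : 0 ≤ x := abs_nonneg _
  have hy0 : 0 ≤ y := abs_nonneg _
  have h3 : (1 + x) * (1 + y) ≤ latDist K α₀ α := by
    rw [← sq_abs ((α j : ℝ) - α₀ j), ← sq_abs ((α k : ℝ) - α₀ k)] at h2
    nlinarith [sq_nonneg (x - y), sq_nonneg (x - 1), sq_nonneg (y - 1)]
  have h4 := Real.sqrt_le_sqrt h3
  rw [Real.sqrt_mul (by positivity)] at h4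
  have h5 : 0 < Real.sqrt (1 + x) * Real.sqrt (1 + y) := by positivity
  rw [one_div_mul_one_div, ← mul_div_assoc, mul_one]
  exact div_le_div_of_nonneg_left zero_le_two h5 h4

/-- The weight is the radial profile centered at α₀ plus an offset. Regularization by K makes it
slowly varying and keeps -Δω bounded below at the center; neither A nor c depends on N or α₀. -/
theorem exists_weight {n : ℕ} (hn1 : 1 ≤ n) (hn3 : n ≤ 3) {ε : ℝ} (hε : 0 < ε) :
    ∃ A c : ℝ, 0 < A ∧ 0 < c ∧ ∀ N : ℕ, 1 ≤ N → ∀ α₀ ∈ idxBox n N, ∃ ω : Idx n → ℝ,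
      SlowlyVarying ω ε ∧
      (∀ α ∈ idxBox n N, (∀ s, α + step s ∈ idxBox n N) → 0 ≤ ∑ s, sdiff ω α s) ∧
      ((∀ s, α₀ + step s ∈ idxBox n N) → c ≤ ∑ s, sdiff ω α₀ s) ∧ ColumnBound N A ω := by
  obtain ⟨K, hK, hKε⟩ : ∃ K : ℝ, 9 ≤ K ∧ 4 / K ≤ ε := by
    refine ⟨9 + 4 / ε, le_add_of_nonneg_right (by positivity), ?_⟩
    rw [div_le_iff₀ (by positivity), mul_add, mul_div_cancel₀ _ hε.ne']
    linarith
  have hK0 : 0 < K := by linarith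
  -- The lower bound m converts the absolute variations, 6 for n = 1 and 4 / K ≤ ε for n = 2, into
  -- relative ones; for n = 3 none is needed.
  set m : ℝ := if n = 1 then 6 / ε else if n = 2 then 1 else 0 with hm
  have hm0 : 0 ≤ m := by rw [hm]; split_ifs <;> positivity
  refine ⟨36 * (5 * Real.sqrt (3 * K) + 4 + 2 * K + m), 1 / K ^ 5, by positivity, by positivity,
    fun N hN α₀ hα₀ => ?_⟩
  set F : Idx n → ℝ := fun α => radialOffset n N K m + radial n (latDist K α₀ α) with hF
  -- The truncation has no effect on the grid, where F ≥ m. It keeps the weight positive on the rest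
  -- of the lattice, and taking a maximum with a constant does not increase variations.
  set ω : Idx n → ℝ := fun α => max (F α) m with hω
  have hbox : ∀ α ∈ idxBox n N, ω α = F α := fun α hα =>
    max_eq_left (le_offset_add_radial hn1 hn3 hK m hα₀ hα)
  have hlap : ∀ α ∈ idxBox n N, (∀ s, α + step s ∈ idxBox n N) →
      radialScale n (latDist K α₀ α) * n / latDist K α₀ α ^ 2 ≤ ∑ s, sdiff ω α s := by
    intro α hα hs
    refine (radial_superharmonic hn1 hn3 hK α₀ α).trans (le_of_eq ?_)
    refine Finset.sum_congr rfl fun s _ => ?_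
    simp only [sdiff, hbox α hα, hbox _ (hs s), hF]
    ring
  refine ⟨ω, ?_, ?_, ?_, ?_⟩
  · have hpos : ∀ α, 0 < ω α := by
      intro α
      by_cases h3 : n = 3
      · refine lt_of_lt_of_le ?_ (le_max_left _ _)
        have ht : 0 < latDist K α₀ α := lt_of_lt_of_le (by positivity) (latDist_ge_sq K α₀ α)
        have : 0 < 2 / Real.sqrt (latDist K α₀ α) := div_pos two_pos (Real.sqrt_pos.2 ht)
        simp only [hF, radialOffset, radial, hm, h3, show (3 : ℕ) ≠ 1 by norm_num,
          show (3 : ℕ) ≠ 2 by norm_num, if_false, zero_add]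
        exact this
      · refine lt_of_lt_of_le ?_ (le_max_right _ _)
        have h12 : n = 1 ∨ n = 2 := by omega
        rcases h12 with h | h
        · simp only [hm, h, if_true]; positivity
        · simp only [hm, h, if_true, show (2 : ℕ) ≠ 1 by norm_num, if_false]; norm_num
    intro α
    refine ⟨hpos α, fun s => ?_⟩
    have h1 : |ω α - ω (α + step s)| ≤
        |radial n (latDist K α₀ α) - radial n (latDist K α₀ (α + step s))| := by
      refine (abs_max_sub_max_le_abs _ _ _).trans (le_of_eq ?_)
      simp only [hF]; congr 1; ring
    refine h1.trans ((radial_variation hn1 hn3 hK α₀ α s).trans ?_)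
    have hmω : m ≤ ω α := le_max_right _ _
    have hFω : F α ≤ ω α := le_max_left _ _
    split_ifs with h h'
    · have : ε * m ≤ ε * ω α := mul_le_mul_of_nonneg_left hmω hε.le
      simp only [hm, h, if_true] at this
      rwa [mul_div_cancel₀ _ hε.ne'] at this
    · have : ε * m ≤ ε * ω α := mul_le_mul_of_nonneg_left hmω hε.le
      simp only [hm, h', if_true, show (2 : ℕ) ≠ 1 by norm_num, if_false] at this
      linarith
    · have h3 : n = 3 := by omega
      have hr : radial n (latDist K α₀ α) ≤ ω α := by
        simpa only [hF, radialOffset, hm, h, h', if_false, zero_add] using hFω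
      exact mul_le_mul hKε hr (by
        simp only [radial, h, h', if_false]; positivity) hε.le
  · intro α hα hs
    refine le_trans ?_ (hlap α hα hs)
    have ht : 0 < latDist K α₀ α := lt_of_lt_of_le (by positivity) (latDist_ge_sq K α₀ α)
    have := radialScale_pos (n := n) ht
    positivity
  · intro hs
    refine le_trans ?_ (hlap α₀ hα₀ hs)
    have ht : latDist K α₀ α₀ = K ^ 2 := by simp [latDist]
    rw [ht]
    have hP : 1 / K ≤ radialScale n (K ^ 2) := by
      have : 1 / K ≤ 1 := by rw [div_le_one hK0]; linarith
      unfold radialScale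
      rw [Real.sqrt_sq hK0.le]
      split_ifs
      · linarith
      · exact this
      · exact le_rfl
    have hn : (1 : ℝ) ≤ n := by exact_mod_cast hn1
    rw [div_le_div_iff₀ (by positivity) (by positivity), one_mul]
    have h1 : 1 ≤ K * radialScale n (K ^ 2) := by
      rw [div_le_iff₀ hK0] at hP; linarith
    have h2 : 1 ≤ K * radialScale n (K ^ 2) * n := one_le_mul_of_one_le_of_one_le h1 hn
    calc (K ^ 2) ^ 2 = K ^ 4 * 1 := by ring
      _ ≤ K ^ 4 * (K * radialScale n (K ^ 2) * n) := mul_le_mul_of_nonneg_left h2 (by positivity)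
      _ = _ := by ring
  · refine columnBound_of_le hn1 hn3 hN hα₀ (by positivity) fun i α hα => ?_
    rw [hbox α hα]
    have hs0 : 0 ≤ 5 * Real.sqrt (3 * K) := by positivity
    have hprod : 0 ≤ Real.sqrt N ^ (3 - n) *
        ∏ j, if j = i then 1 else 1 / Real.sqrt (1 + |(α j : ℝ) - α₀ j|) := by
      refine mul_nonneg (by positivity) (Finset.prod_nonneg fun j _ => ?_)
      split_ifs <;> positivity
    have upgrade : ∀ {B : ℝ}, F α ≤ B * (Real.sqrt N ^ (3 - n) *
        ∏ j, if j = i then 1 else 1 / Real.sqrt (1 + |(α j : ℝ) - α₀ j|)) →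
        B ≤ 5 * Real.sqrt (3 * K) + 4 + 2 * K + m → F α ≤
        (5 * Real.sqrt (3 * K) + 4 + 2 * K + m) * Real.sqrt N ^ (3 - n) *
        ∏ j, if j = i then 1 else 1 / Real.sqrt (1 + |(α j : ℝ) - α₀ j|) := by
      intro B h1 h2
      rw [mul_assoc]
      exact h1.trans (mul_le_mul_of_nonneg_right h2 hprod)
    clear_value m
    interval_cases n
    · refine upgrade (B := 2 + 2 * K + m) ?_ (by linarith)
      have := offset_add_radial_one_le hN hK hm0 α₀ α
      have hi : ∀ j : Fin 1, j = i := fun j => Subsingleton.elim _ _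
      simpa [hi] using this
    · have hm1 : m = 1 := by simpa using hm
      subst hm1
      refine upgrade (B := 5 * Real.sqrt (3 * K)) ?_ (by linarith)
      obtain ⟨j, hj⟩ : ∃ j : Fin 2, ∏ k, (if k = i then 1 else
          1 / Real.sqrt (1 + |(α k : ℝ) - α₀ k|)) = 1 / Real.sqrt (1 + |(α j : ℝ) - α₀ j|) := by
        fin_cases i
        · exact ⟨1, by simp [Fin.prod_univ_two]⟩
        · exact ⟨0, by simp [Fin.prod_univ_two]⟩
      rw [hj]
      have := offset_add_radial_two_le hN hK hα₀ hα j
      simp only [hF]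
      refine this.trans (le_of_eq ?_)
      norm_num
      ring
    · have hm1 : m = 0 := by simpa using hm
      subst hm1
      refine upgrade (B := 2) ?_ (by linarith)
      obtain ⟨j, k, hjk, hj⟩ : ∃ j k : Fin 3, j ≠ k ∧ ∏ l, (if l = i then 1 else
          1 / Real.sqrt (1 + |(α l : ℝ) - α₀ l|)) = 1 / Real.sqrt (1 + |(α j : ℝ) - α₀ j|) *
          (1 / Real.sqrt (1 + |(α k : ℝ) - α₀ k|)) := by
        fin_cases i
        · exact ⟨1, 2, by decide, by simp [Fin.prod_univ_three]⟩
        · exact ⟨0, 2, by decide, by simp [Fin.prod_univ_three]⟩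
        · exact ⟨0, 1, by decide, by simp [Fin.prod_univ_three]⟩
      rw [hj]
      have := radial_three_le hK α₀ α hjk
      simpa [hF, radialOffset] using this

/-! ### Domains given by a level set function -/

/-- A bounded open set `{φ < 0}` with `φ` twice differentiable near its closure. -/
structure LevelSetDomain (n : ℕ) where
  a : Pt n
  L : ℝ
  Ω : Set (Pt n)
  φ : Pt n → ℝ
  L_pos : 0 < L
  isOpen : IsOpen Ω
  subset_box : Ω ⊆ box a L
  levelSet : IsLevelSet Ω φ
  contDiffAt : ∀ x ∈ closure Ω, ContDiffAt ℝ 2 φ x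

/-- The unit vector of a signed direction. -/
def axis {n : ℕ} (s : SDir n) : Pt n :=
  if s.2 then EuclideanSpace.single s.1 1 else -EuclideanSpace.single s.1 1

theorem norm_axis {n : ℕ} (s : SDir n) : ‖axis s‖ = 1 := by
  unfold axis
  split_ifs <;> simp

theorem node_add_step {n : ℕ} (G : Grid n) (α : Idx n) (s : SDir n) :
    G.node (α + step s) = G.node α + G.h • axis s := by
  ext j
  rcases s with ⟨i, b⟩
  by_cases h : j = i
  · subst h
    cases b <;> simp [Grid.node, step, axis, dir] <;> ring
  · cases b <;> simp [Grid.node, step, axis, dir, h]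

theorem axis_flip {n : ℕ} (s : SDir n) : axis s.flip = -axis s := by
  rcases s with ⟨i, b⟩; cases b <;> simp [axis, SDir.flip]

theorem node_add_dir {n : ℕ} (G : Grid n) (α : Idx n) (i : Fin n) :
    G.node (α + dir i) = G.node α + G.h • axis (i, true) := by
  rw [← node_add_step]; simp [step]

/-- Quantitative flatness of the level sets of `φ` in a ball. -/
structure IsFlatAt {n : ℕ} (φ : Pt n → ℝ) (y : Pt n) (η g Λ M : ℝ) (s : SDir n) : Prop where
  diff : ∀ z ∈ Metric.ball y η, DifferentiableAt ℝ φ z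
  bound : ∀ z ∈ Metric.ball y η, ‖fderiv ℝ φ z‖ ≤ Λ
  decr : ∀ z ∈ Metric.ball y η, fderiv ℝ φ z (axis s) ≤ -g
  lip : ∀ z ∈ Metric.ball y η, ∀ z' ∈ Metric.ball y η,
    ‖fderiv ℝ φ z - fderiv ℝ φ z'‖ ≤ M * ‖z - z'‖

theorem norm_taylor_one_le {E F : Type*} [NormedAddCommGroup E] [NormedSpace ℝ E]
    [NormedAddCommGroup F] [NormedSpace ℝ F] {f : E → F} {M : ℝ} {x y : E} (hM : 0 ≤ M)
    (hd : ∀ z ∈ segment ℝ x y, DifferentiableAt ℝ f z)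
    (hl : ∀ z ∈ segment ℝ x y, ‖fderiv ℝ f z - fderiv ℝ f x‖ ≤ M * ‖z - x‖) :
    ‖f y - f x - fderiv ℝ f x (y - x)‖ ≤ M * ‖y - x‖ ^ 2 := by
  have := (convex_segment x y).norm_image_sub_le_of_norm_fderiv_le' (𝕜 := ℝ) (f := f)
    (φ := fderiv ℝ f x) (C := M * ‖y - x‖) hd (fun z hz => (hl z hz).trans ?_)
    (left_mem_segment ℝ x y) (right_mem_segment ℝ x y)
  · rw [sq, ← mul_assoc]; exact this
  · exact mul_le_mul_of_nonneg_left (by simpa [norm_sub_rev] using norm_sub_le_of_mem_segment hz) hM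

namespace IsFlatAt

variable {n : ℕ} {φ : Pt n → ℝ} {y : Pt n} {η g Λ M : ℝ} {s : SDir n}

theorem segment_mem (_ : IsFlatAt φ y η g Λ M s) {z z' w : Pt n} (hz : z ∈ Metric.ball y η)
    (hz' : z' ∈ Metric.ball y η) (hw : w ∈ segment ℝ z z') : w ∈ Metric.ball y η :=
  (convex_ball y η).segment_subset hz hz' hw

theorem lipschitz (h : IsFlatAt φ y η g Λ M s) {z z' : Pt n} (hz : z ∈ Metric.ball y η)
    (hz' : z' ∈ Metric.ball y η) : |φ z' - φ z| ≤ Λ * ‖z' - z‖ :=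
  (convex_ball y η).norm_image_sub_le_of_norm_fderiv_le (𝕜 := ℝ) h.diff h.bound hz hz'

theorem taylor (h : IsFlatAt φ y η g Λ M s) (hM : 0 ≤ M) {z z' : Pt n}
    (hz : z ∈ Metric.ball y η) (hz' : z' ∈ Metric.ball y η) :
    |φ z' - φ z - fderiv ℝ φ z (z' - z)| ≤ M * ‖z' - z‖ ^ 2 :=
  norm_taylor_one_le hM (fun w hw => h.diff w (h.segment_mem hz hz' hw))
    fun w hw => h.lip w (h.segment_mem hz hz' hw) z hz

theorem decrease (h : IsFlatAt φ y η g Λ M s) {z : Pt n} {t : ℝ} (ht : 0 ≤ t)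
    (hz : z ∈ Metric.ball y η) (hz' : z + t • axis s ∈ Metric.ball y η) :
    φ (z + t • axis s) ≤ φ z - g * t := by
  have hmem : ∀ τ ∈ Set.Icc 0 t, z + τ • axis s ∈ Metric.ball y η := by
    intro τ hτ
    refine h.segment_mem hz hz' ?_
    rcases eq_or_lt_of_le ht with h0 | h0
    · have : τ = 0 := le_antisymm (by rw [h0]; exact hτ.2) hτ.1
      simp [this, left_mem_segment]
    · rw [segment_eq_image']
      refine ⟨τ / t, ⟨div_nonneg hτ.1 ht, (div_le_one h0).2 hτ.2⟩, ?_⟩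
      simp only [add_sub_cancel_left, smul_smul, div_mul_cancel₀ _ h0.ne']
  have hder : ∀ τ ∈ Set.Icc 0 t, HasDerivAt (fun τ : ℝ => φ (z + τ • axis s))
      (fderiv ℝ φ (z + τ • axis s) (axis s)) τ := by
    intro τ hτ
    have h1 : HasDerivAt (fun τ : ℝ => z + τ • axis s) (axis s) τ := by
      simpa using ((hasDerivAt_id τ).smul_const (axis s)).const_add z
    exact (h.diff _ (hmem τ hτ)).hasFDerivAt.comp_hasDerivAt τ h1
  have := (convex_Icc 0 t).image_sub_le_mul_sub_of_deriv_le
    (f := fun τ : ℝ => φ (z + τ • axis s)) (C := -g)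
    (fun τ hτ => (hder τ hτ).continuousAt.continuousWithinAt)
    (fun τ hτ => (hder τ (interior_subset hτ)).differentiableAt.differentiableWithinAt)
    (fun τ hτ => by
      rw [(hder τ (interior_subset hτ)).deriv]
      exact h.decr _ (hmem τ (interior_subset hτ)))
    0 (Set.left_mem_Icc.2 ht) t (Set.right_mem_Icc.2 ht) ht
  simp only [zero_smul, add_zero, sub_zero] at this
  linarith

theorem mono (h : IsFlatAt φ y η g Λ M s) {η' g' Λ' M' : ℝ} {y' : Pt n}
    (hball : Metric.ball y' η' ⊆ Metric.ball y η) (hg : g' ≤ g) (hΛ : Λ ≤ Λ') (hM : M ≤ M') :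
    IsFlatAt φ y' η' g' Λ' M' s where
  diff z hz := h.diff z (hball hz)
  bound z hz := (h.bound z (hball hz)).trans hΛ
  decr z hz := (h.decr z (hball hz)).trans (by linarith)
  lip z hz z' hz' := (h.lip z (hball hz) z' (hball hz')).trans
    (mul_le_mul_of_nonneg_right hM (norm_nonneg _))

end IsFlatAt

/-- A point with nonzero gradient is flat. -/
theorem exists_isFlatAt {n : ℕ} {φ : Pt n → ℝ} {y : Pt n} (hφ : ContDiffAt ℝ 2 φ y)
    (h0 : fderiv ℝ φ y ≠ 0) :
    ∃ η g Λ M : ℝ, 0 < η ∧ 0 < g ∧ 0 < Λ ∧ 0 < M ∧ ∃ s, IsFlatAt φ y η g Λ M s := by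
  obtain ⟨i, hi⟩ : ∃ i, fderiv ℝ φ y (EuclideanSpace.single i 1) ≠ 0 := by
    by_contra! hcon
    apply h0
    have : ((fderiv ℝ φ y : Pt n →L[ℝ] ℝ) : Pt n →ₗ[ℝ] ℝ) = 0 :=
      (EuclideanSpace.basisFun (Fin n) ℝ).toBasis.ext fun i => by simpa using hcon i
    ext x
    exact congrArg (fun l : Pt n →ₗ[ℝ] ℝ => l x) this
  obtain ⟨s, hs⟩ : ∃ s : SDir n, fderiv ℝ φ y (axis s) < 0 := by
    rcases lt_or_gt_of_ne hi with h | h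
    · exact ⟨(i, true), by simpa [axis] using h⟩
    · exact ⟨(i, false), by simpa [axis] using h⟩
  have hC1 : ContDiffAt ℝ 1 (fderiv ℝ φ) y := hφ.fderiv_right (by norm_num)
  obtain ⟨K, t, ht, hlip⟩ := hC1.exists_lipschitzOnWith
  have hcont : ContinuousAt (fderiv ℝ φ) y := hC1.continuousAt
  have e1 : ∀ᶠ z in nhds y, DifferentiableAt ℝ φ z :=
    (hφ.eventually (by simp)).mono fun z hz => hz.differentiableAt (by norm_num)
  have e2 : ∀ᶠ z in nhds y, ‖fderiv ℝ φ z‖ < ‖fderiv ℝ φ y‖ + 1 :=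
    hcont.norm.eventually_lt_const (by linarith)
  have e3 : ∀ᶠ z in nhds y, fderiv ℝ φ z (axis s) < fderiv ℝ φ y (axis s) / 2 :=
    (hcont.clm_apply continuousAt_const).eventually_lt_const (by linarith)
  obtain ⟨η, hη, hball⟩ := Metric.eventually_nhds_iff_ball.1 (e1.and (e2.and (e3.and ht)))
  refine ⟨η, -(fderiv ℝ φ y (axis s) / 2), ‖fderiv ℝ φ y‖ + 1, K + 1, hη, by linarith,
    by positivity, by positivity, s, fun z hz => (hball z hz).1, fun z hz => (hball z hz).2.1.le,
    fun z hz => by rw [neg_neg]; exact (hball z hz).2.2.1.le, fun z hz z' hz' => ?_⟩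
  have := hlip.norm_sub_le (hball z hz).2.2.2 (hball z' hz').2.2.2
  refine this.trans (mul_le_mul_of_nonneg_right (by linarith) (norm_nonneg _))

/-- Compactness: a ball around one point also contains balls of half the radius around nearby
points, and the constants of two pieces merge by minima and maxima. -/
theorem exists_uniform_flat {n : ℕ} {φ : Pt n → ℝ} {Γ : Set (Pt n)} (hΓ : IsCompact Γ)
    (hφ : ∀ y ∈ Γ, ContDiffAt ℝ 2 φ y) (h0 : ∀ y ∈ Γ, fderiv ℝ φ y ≠ 0) :
    ∃ η g Λ M : ℝ, 0 < η ∧ 0 < g ∧ 0 < Λ ∧ 0 < M ∧ ∀ y ∈ Γ, ∃ s, IsFlatAt φ y η g Λ M s := by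
  refine hΓ.induction_on (p := fun S => ∃ η g Λ M : ℝ, 0 < η ∧ 0 < g ∧ 0 < Λ ∧ 0 < M ∧
    ∀ y ∈ S, ∃ s, IsFlatAt φ y η g Λ M s) ?_ ?_ ?_ ?_
  · exact ⟨1, 1, 1, 1, one_pos, one_pos, one_pos, one_pos, fun y hy => hy.elim⟩
  · rintro S T hST ⟨η, g, Λ, M, h1, h2, h3, h4, h⟩
    exact ⟨η, g, Λ, M, h1, h2, h3, h4, fun y hy => h y (hST hy)⟩
  · rintro S T ⟨η, g, Λ, M, h1, h2, h3, h4, h⟩ ⟨η', g', Λ', M', h1', h2', h3', h4', h'⟩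
    refine ⟨min η η', min g g', max Λ Λ', max M M', lt_min h1 h1', lt_min h2 h2',
      lt_max_of_lt_left h3, lt_max_of_lt_left h4, fun y hy => ?_⟩
    rcases hy with hy | hy
    · obtain ⟨s, hs⟩ := h y hy
      exact ⟨s, hs.mono (Metric.ball_subset_ball (min_le_left _ _)) (min_le_left _ _)
        (le_max_left _ _) (le_max_left _ _)⟩
    · obtain ⟨s, hs⟩ := h' y hy
      exact ⟨s, hs.mono (Metric.ball_subset_ball (min_le_right _ _)) (min_le_right _ _)
        (le_max_right _ _) (le_max_right _ _)⟩
  · intro y hy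
    obtain ⟨η, g, Λ, M, h1, h2, h3, h4, s, hs⟩ := exists_isFlatAt (hφ y hy) (h0 y hy)
    refine ⟨Metric.ball y (η / 2), mem_nhdsWithin_of_mem_nhds (Metric.ball_mem_nhds y (by linarith)),
      η / 2, g, Λ, M, by linarith, h2, h3, h4, fun z hz => ⟨s, hs.mono ?_ le_rfl le_rfl le_rfl⟩⟩
    refine Metric.ball_subset_ball' ?_
    rw [Metric.mem_ball] at hz
    linarith

theorem exists_mem_frontier_segment {E : Type*} [NormedAddCommGroup E] [NormedSpace ℝ E]
    {Ω : Set E} (hΩ : IsOpen Ω) {x z w : E} (hx : x ∈ Ω) (hw : w ∈ segment ℝ x z) (hwΩ : w ∉ Ω) :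
    ∃ y ∈ segment ℝ x z, y ∈ frontier Ω := by
  by_contra! hcon
  have hpre := (convex_segment (𝕜 := ℝ) x z).isPreconnected
  have hw' : w ∉ closure Ω := fun h => hcon w hw ⟨h, by rwa [hΩ.interior_eq]⟩
  obtain ⟨v, -, hv1, hv2⟩ := hpre Ω (closure Ω)ᶜ hΩ isClosed_closure.isOpen_compl
    (fun v hv => by
      by_cases h : v ∈ Ω
      · exact Or.inl h
      · exact Or.inr fun h' => hcon v hv ⟨h', by rwa [hΩ.interior_eq]⟩)
    ⟨x, left_mem_segment ℝ x z, hx⟩ ⟨w, hw, hw'⟩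
  exact hv2 (subset_closure hv1)

namespace LevelSetDomain

variable {n : ℕ} (P : LevelSetDomain n)

theorem mem_iff {x : Pt n} : x ∈ P.Ω ↔ P.φ x < 0 := by rw [P.levelSet.eq_neg]; rfl

theorem mem_frontier_iff {x : Pt n} : x ∈ frontier P.Ω ↔ P.φ x = 0 := by
  rw [P.levelSet.frontier_eq]; rfl

theorem mem_closure_iff {x : Pt n} : x ∈ closure P.Ω ↔ P.φ x ≤ 0 := by
  rw [closure_eq_self_union_frontier, Set.mem_union, mem_iff, mem_frontier_iff, le_iff_lt_or_eq]

theorem isCompact_closure : IsCompact (closure P.Ω) := by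
  have hb : Bornology.IsBounded P.Ω := by
    refine Bornology.IsBounded.subset ?_ P.subset_box
    refine (Metric.isBounded_iff_subset_closedBall P.a).2 ⟨Real.sqrt (n * P.L ^ 2), fun x hx => ?_⟩
    rw [Metric.mem_closedBall, EuclideanSpace.dist_eq]
    refine Real.sqrt_le_sqrt ?_
    have : ∑ i, dist (x i) (P.a i) ^ 2 ≤ ∑ _i : Fin n, P.L ^ 2 := by
      refine Finset.sum_le_sum fun i _ => ?_
      obtain ⟨h1, h2⟩ := hx i
      rw [Real.dist_eq, sq_abs]
      have := P.L_pos
      exact sq_le_sq' (by linarith) (by linarith)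
    simpa using this
  exact hb.isCompact_closure

theorem isCompact_frontier : IsCompact (frontier P.Ω) :=
  P.isCompact_closure.of_isClosed_subset isClosed_frontier frontier_subset_closure

/-- An open set inside the closed box avoids its faces. Hence all neighbors of a node in Ω are nodes
of the grid, and the scheme never leaves the index box. -/
theorem strict_box {x : Pt n} (hx : x ∈ P.Ω) (i : Fin n) : P.a i < x i ∧ x i < P.a i + P.L := by
  obtain ⟨ε, hε, hball⟩ := Metric.isOpen_iff.1 P.isOpen x hx
  have hmem : ∀ s : SDir n, x + (ε / 2) • axis s ∈ P.Ω := by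
    intro s
    apply hball
    rw [Metric.mem_ball, dist_eq_norm, add_sub_cancel_left, norm_smul, norm_axis,
      Real.norm_of_nonneg (by linarith)]
    linarith
  have h1 := (P.subset_box (hmem (i, true)) i).2
  have h2 := (P.subset_box (hmem (i, false)) i).1
  simp [axis] at h1 h2
  constructor <;> linarith

/-- The grid with `N` cells per direction. -/
def grid (N : ℕ) : Grid n := cubeGrid P.a P.L N

theorem grid_h (N : ℕ) : (P.grid N).h = P.L / N := rfl

theorem h_pos {N : ℕ} (hN : 1 ≤ N) : 0 < (P.grid N).h := by
  have : (0 : ℝ) < N := by exact_mod_cast hN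
  rw [grid_h]; exact div_pos P.L_pos this

theorem node_strict {N : ℕ} (hN : 1 ≤ N) {α : Idx n} (h : (P.grid N).node α ∈ P.Ω) (i : Fin n) :
    0 < α i ∧ α i < N := by
  obtain ⟨h1, h2⟩ := P.strict_box h i
  have hh := P.h_pos hN
  have hN' : (0 : ℝ) < N := by exact_mod_cast hN
  have hL : P.L = N * (P.grid N).h := by rw [grid_h]; field_simp
  simp only [Grid.node] at h1 h2
  have ha : (P.grid N).a i = P.a i := rfl
  rw [ha] at h1 h2
  rw [hL] at h2
  constructor
  · have : (0 : ℝ) < α i := by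
      by_contra! hcon
      nlinarith
    exact_mod_cast this
  · have : (α i : ℝ) < N := by
      by_contra! hcon
      nlinarith
    exact_mod_cast this

theorem indices_eq (N : ℕ) : (P.grid N).indices = idxBox n N := rfl

theorem node_add_step_mem_box {N : ℕ} (hN : 1 ≤ N) {α : Idx n} (h : (P.grid N).node α ∈ P.Ω)
    (s : SDir n) : α + step s ∈ idxBox n N := by
  rw [mem_idxBox]
  intro j
  have h1 := P.node_strict hN h j
  have h2 : step s j = 0 ∨ step s j = 1 ∨ step s j = -1 := by
    rcases s with ⟨i, b⟩
    by_cases hij : j = i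
    · subst hij; cases b <;> simp [step, dir]
    · left; cases b <;> simp [step, dir, hij]
  simp only [Pi.add_apply]
  omega

theorem mem_interior_iff {N : ℕ} (hN : 1 ≤ N) {α : Idx n} :
    α ∈ (P.grid N).interiorNodes P.Ω ↔ (P.grid N).node α ∈ P.Ω := by
  classical
  simp only [Grid.interiorNodes, Finset.mem_filter, and_iff_right_iff_imp]
  intro h
  rw [indices_eq, mem_idxBox]
  intro i
  have := P.node_strict hN h i
  omega

theorem mem_active_iff {N : ℕ} (hN : 1 ≤ N) {α : Idx n} :
    α ∈ (P.grid N).activeNodes P.Ω ↔ (P.grid N).node α ∈ P.Ω ∨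
      ∃ s : SDir n, (P.grid N).node (α + step s) ∈ P.Ω := by
  classical
  have hex : (∃ i : Fin n, (P.grid N).node (α + dir i) ∈ P.Ω ∨ (P.grid N).node (α - dir i) ∈ P.Ω) ↔
      ∃ s : SDir n, (P.grid N).node (α + step s) ∈ P.Ω := by
    constructor
    · rintro ⟨i, h | h⟩
      · exact ⟨(i, true), by simpa [step] using h⟩
      · exact ⟨(i, false), by simpa [step, sub_eq_add_neg] using h⟩
    · rintro ⟨⟨i, b⟩, h⟩
      cases b
      · exact ⟨i, Or.inr (by simpa [step, sub_eq_add_neg] using h)⟩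
      · exact ⟨i, Or.inl (by simpa [step] using h)⟩
  simp only [Grid.activeNodes, Finset.mem_filter, hex, and_iff_right_iff_imp]
  rintro (h | ⟨s, h⟩)
  · exact (Finset.mem_filter.1 ((P.mem_interior_iff hN).2 h)).1
  · have := P.node_add_step_mem_box hN h s.flip
    rw [indices_eq]
    simpa using this

theorem active_subset_box (N : ℕ) : (P.grid N).activeNodes P.Ω ⊆ idxBox n N := by
  classical
  exact Finset.filter_subset _ _

/-- The lattice domain of the grid. -/
def lattice {N : ℕ} (hN : 1 ≤ N) : LatticeDomain n where
  I := (P.grid N).interiorNodes P.Ω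
  ψ α := P.φ ((P.grid N).node α)
  B := (P.grid N).cutEdges P.Ω
  mem_iff α := by rw [P.mem_interior_iff hN, P.mem_iff]
  mem_B α i h := by
    classical
    rw [P.mem_interior_iff hN, P.mem_interior_iff hN] at h
    have hdisj : ∀ x ∈ P.Ω, x ∉ frontier P.Ω := fun x hx hx' =>
      (P.isOpen.frontier_eq ▸ hx').2 hx
    simp only [Grid.cutEdges, Finset.mem_filter, Finset.mem_product, Finset.mem_univ, and_true]
    rw [P.mem_active_iff hN, P.mem_active_iff hN]
    have hback : α + dir i + step (i, false) = α := by simp [step]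
    have hfwd : α + step (i, true) = α + dir i := by simp [step]
    by_cases hα : (P.grid N).node α ∈ P.Ω
    · have hβ := h.1 hα
      refine ⟨Or.inl hα, Or.inr ⟨(i, false), by rw [hback]; exact hα⟩, ?_, fun hsub =>
        hdisj _ hα (hsub (left_mem_segment ℝ _ _))⟩
      obtain ⟨y, hy1, hy2⟩ := exists_mem_frontier_segment P.isOpen hα (right_mem_segment ℝ _ _) hβ
      exact ⟨y, hy1, hy2⟩
    · have hβ : (P.grid N).node (α + dir i) ∈ P.Ω := by
        by_contra hcon; exact hα (h.2 hcon)
      refine ⟨Or.inr ⟨(i, true), by rw [hfwd]; exact hβ⟩, Or.inl hβ, ?_, fun hsub =>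
        hdisj _ hβ (hsub (right_mem_segment ℝ _ _))⟩
      obtain ⟨y, hy1, hy2⟩ := exists_mem_frontier_segment P.isOpen hβ (right_mem_segment ℝ _ _) hα
      exact ⟨y, by rw [Grid.edge, segment_symm]; exact hy1, hy2⟩

end LevelSetDomain

/-! ### The boundary layer of a fine grid. -/

theorem norm_add_smul_axis_sub_le {n : ℕ} {z y : Pt n} {c t : ℝ} (s : SDir n) (ht : 0 ≤ t)
    (h : ‖z - y‖ ≤ c) : ‖z + t • axis s - y‖ ≤ c + t := by
  have e : z + t • axis s - y = (z - y) + t • axis s := by abel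
  rw [e]
  refine (norm_add_le _ _).trans (add_le_add h ?_)
  rw [norm_smul, norm_axis, Real.norm_of_nonneg ht, mul_one]

theorem mem_ball_of_norm_le {n : ℕ} {z y : Pt n} {c η : ℝ} (h : ‖z - y‖ ≤ c) (hc : c < η) :
    z ∈ Metric.ball y η := by
  rw [Metric.mem_ball, dist_eq_norm]; exact h.trans_lt hc

theorem norm_sub_le_of_mem_edge {n : ℕ} {x y : Pt n} {h : ℝ} (hh : 0 ≤ h) {s : SDir n}
    (hy : y ∈ segment ℝ x (x + h • axis s)) : ‖x - y‖ ≤ h ∧ ‖x + h • axis s - y‖ ≤ h := by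
  have e : ‖x + h • axis s - x‖ = h := by
    rw [add_sub_cancel_left, norm_smul, norm_axis, Real.norm_of_nonneg hh, mul_one]
  have h1 := norm_sub_le_of_mem_segment hy
  rw [segment_symm] at hy
  have h2 := norm_sub_le_of_mem_segment hy
  rw [e] at h1
  rw [norm_sub_rev x, e] at h2
  exact ⟨by rw [norm_sub_rev]; exact h1, by rw [norm_sub_rev]; exact h2⟩

namespace LevelSetDomain

variable {n : ℕ} (P : LevelSetDomain n) {N : ℕ} (hN : 1 ≤ N)

theorem mem_I_iff {α : Idx n} : α ∈ (P.lattice hN).I ↔ (P.grid N).node α ∈ P.Ω :=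
  P.mem_interior_iff hN

theorem exists_frontier_of_cut {α : Idx n} {s : SDir n} (h : (α, s) ∈ (P.lattice hN).cutPairs) :
    ∃ y ∈ frontier P.Ω, ‖(P.grid N).node α - y‖ ≤ (P.grid N).h ∧
      ‖(P.grid N).node (α + step s) - y‖ ≤ (P.grid N).h := by
  rw [LatticeDomain.mem_cutPairs, mem_I_iff, mem_I_iff] at h
  obtain ⟨y, hy1, hy2⟩ := exists_mem_frontier_segment P.isOpen h.1 (right_mem_segment ℝ _ _) h.2
  simp only [node_add_step] at hy1 ⊢
  exact ⟨y, hy2, norm_sub_le_of_mem_edge (P.h_pos hN).le hy1⟩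

theorem exists_frontier_near_layer {α : Idx n} (h : α ∈ (P.lattice hN).layer) :
    ∃ y ∈ frontier P.Ω, ‖(P.grid N).node α - y‖ ≤ (P.grid N).h := by
  rcases Finset.mem_union.1 h with h | h <;> obtain ⟨⟨β, s⟩, hp, rfl⟩ := Finset.mem_image.1 h
  · obtain ⟨y, hy, h1, -⟩ := P.exists_frontier_of_cut hN hp
    exact ⟨y, hy, h1⟩
  · obtain ⟨y, hy, -, h1⟩ := P.exists_frontier_of_cut hN hp
    exact ⟨y, hy, h1⟩

theorem mem_layer_of_active {α : Idx n} (h : α ∈ (P.grid N).activeNodes P.Ω)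
    (h' : (P.grid N).node α ∉ P.Ω) : α ∈ (P.lattice hN).layer := by
  rw [P.mem_active_iff hN] at h
  obtain ⟨s, hs⟩ := h.resolve_left h'
  have : (α + step s, s.flip) ∈ (P.lattice hN).cutPairs := by
    rw [LatticeDomain.mem_cutPairs, mem_I_iff, mem_I_iff]
    simpa using ⟨hs, h'⟩
  simpa using (P.lattice hN).snd_mem_layer this

theorem layer_subset_active : (P.lattice hN).layer ⊆ (P.grid N).activeNodes P.Ω := by
  intro α h
  rw [P.mem_active_iff hN]
  rcases Finset.mem_union.1 h with h | h <;> obtain ⟨⟨β, s⟩, hp, rfl⟩ := Finset.mem_image.1 h <;>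
    rw [LatticeDomain.mem_cutPairs, mem_I_iff, mem_I_iff] at hp
  · exact Or.inl hp.1
  · exact Or.inr ⟨s.flip, by simpa using hp.1⟩

variable {η g Λ M : ℝ}

/-- If an edge meets Γ and both its ends are inside, it is almost tangent: the Taylor expansion at y
and the negative sign at the far end force the slope along the edge to be at most Mh, so φ at the
near end is only of order h² below 0. -/
theorem neg_le_of_touching {y x : Pt n} {h : ℝ} {s t : SDir n} (hf : IsFlatAt P.φ y η g Λ M t)
    (hM : 0 ≤ M) (hh : 0 < h) (hhη : h < η) (hy : y ∈ segment ℝ x (x + h • axis s))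
    (hy0 : P.φ y = 0) (hx : P.φ x < 0) (hx' : P.φ (x + h • axis s) < 0) :
    -(2 * M * h ^ 2) ≤ P.φ x := by
  obtain ⟨n1, n2⟩ := norm_sub_le_of_mem_edge hh.le hy
  have b0 : y ∈ Metric.ball y η := Metric.mem_ball_self (by linarith)
  have b1 := mem_ball_of_norm_le n1 hhη
  have b2 := mem_ball_of_norm_le n2 hhη
  rw [segment_eq_image'] at hy
  obtain ⟨τ, ⟨hτ0, hτ1⟩, hyτ⟩ := hy
  simp only [add_sub_cancel_left, smul_smul] at hyτ
  have t1 := hf.taylor hM b0 b1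
  have t2 := hf.taylor hM b0 b2
  have e1 : x - y = (-(τ * h)) • axis s := by rw [← hyτ, neg_smul]; abel
  have e2 : x + h • axis s - y = ((1 - τ) * h) • axis s := by
    rw [← hyτ, sub_mul, sub_smul, one_mul]; abel
  have nrm : ∀ c : ℝ, ‖c • axis s‖ ^ 2 = c ^ 2 := fun c => by
    rw [norm_smul, norm_axis, mul_one, Real.norm_eq_abs, sq_abs]
  rw [e1, nrm, map_smul, smul_eq_mul, hy0] at t1
  rw [e2, nrm, map_smul, smul_eq_mul, hy0] at t2
  set D := fderiv ℝ P.φ y (axis s)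
  have hτ : 0 < 1 - τ := by
    by_contra! hcon
    have : τ = 1 := le_antisymm hτ1 (by linarith)
    rw [this, one_mul] at hyτ
    rw [hyτ, hy0] at hx'
    exact lt_irrefl _ hx'
  have a1 := (abs_le.1 t1).1
  have a2 := (abs_le.1 t2).1
  have hD : h * D ≤ M * h ^ 2 := by
    have : (1 - τ) * (h * D) ≤ (1 - τ) * (M * h ^ 2 * (1 - τ)) := by nlinarith
    have := le_of_mul_le_mul_left this hτ
    nlinarith [mul_nonneg hM (sq_nonneg h)]
  have : 0 ≤ M * h ^ 2 := mul_nonneg hM (sq_nonneg h)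
  have h3 : τ * (h * D) ≤ M * h ^ 2 := by nlinarith
  have h4 : M * (-(τ * h)) ^ 2 ≤ M * h ^ 2 := by
    rw [neg_sq, mul_pow]
    have : τ ^ 2 ≤ 1 := pow_le_one₀ hτ0 hτ1
    nlinarith
  nlinarith

/-- Both properties compare curvature, 2Mh², with one step along the axis t on which φ decreases, at
least gh. If both neighbors of α along s are outside, the Taylor expansions at α give φ < 2Mh² ≤ gh
at the node α + s, so a step along t brings it inside; α itself stays inside along t, which gives
the detour. -/
theorem isFine (hM : 0 ≤ M) (hg : 0 < g)
    (hflat : ∀ y ∈ frontier P.Ω, ∃ s, IsFlatAt P.φ y η g Λ M s)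
    (h1 : 5 * (P.grid N).h < η) (h2 : 2 * M * (P.grid N).h ≤ g) : (P.lattice hN).IsFine := by
  have hh := P.h_pos hN
  set h := (P.grid N).h with hdef
  refine ⟨fun α hα s hs => ?_, fun p hp => ?_⟩
  · by_cases hback : α - step s ∈ (P.lattice hN).I
    · exact Or.inl hback
    right
    obtain ⟨y, hyΓ, hy1, hy2⟩ := P.exists_frontier_of_cut hN
      ((P.lattice hN).mem_cutPairs.2 ⟨hα, hs⟩)
    obtain ⟨t, ht⟩ := hflat y hyΓ
    refine ⟨t, ?_⟩
    simp only [mem_I_iff, P.mem_iff] at *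
    rw [sub_eq_add_neg, ← step_flip] at hback
    simp only [node_add_step, axis_flip] at *
    rw [← hdef] at *
    set x := (P.grid N).node α
    rw [not_lt] at hs hback
    have nx : ‖x - y‖ ≤ h := hy1
    have ex : x + h • -axis s = x + h • axis s.flip := by rw [axis_flip]
    rw [ex] at hback
    have bx := mem_ball_of_norm_le (η := η) nx (by linarith)
    have bs := mem_ball_of_norm_le (η := η) (norm_add_smul_axis_sub_le s hh.le nx) (by linarith)
    have bf := mem_ball_of_norm_le (η := η) (norm_add_smul_axis_sub_le s.flip hh.le nx) (by linarith)
    have nt := norm_add_smul_axis_sub_le t hh.le nx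
    have bt := mem_ball_of_norm_le (η := η) nt (by linarith)
    have nts := norm_add_smul_axis_sub_le s hh.le nt
    have bts := mem_ball_of_norm_le (η := η) nts (by linarith)
    have btst := mem_ball_of_norm_le (η := η) (norm_add_smul_axis_sub_le t hh.le nts) (by linarith)
    have nrm : ∀ s : SDir n, ‖h • axis s‖ ^ 2 = h ^ 2 := fun c => by
      rw [norm_smul, norm_axis, mul_one, Real.norm_eq_abs, sq_abs]
    have t1 := (abs_le.1 (ht.taylor hM bx bf)).2
    have t2 := (abs_le.1 (ht.taylor hM bx bs)).2
    rw [add_sub_cancel_left, nrm, map_smul, smul_eq_mul] at t1 t2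
    rw [axis_flip, map_neg] at t1
    have hgh : 0 < g * h := mul_pos hg hh
    have hM2 : 2 * M * h ^ 2 ≤ g * h := by nlinarith
    have d1 := ht.decrease hh.le bx bt
    have d2 : P.φ (x + h • axis t + h • axis s) ≤ P.φ (x + h • axis s) - g * h := by
      have e : x + h • axis t + h • axis s = x + h • axis s + h • axis t := by abel
      rw [e] at bts ⊢
      exact ht.decrease hh.le bs bts
    have d3 := ht.decrease hh.le bts btst
    rw [axis_flip] at hback
    refine ⟨by linarith, by linarith, by linarith⟩
  · classical
    have hp' := hp
    change p ∈ (P.grid N).cutEdges P.Ω at hp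
    simp only [Grid.cutEdges, Finset.mem_filter, Finset.mem_product, Finset.mem_univ,
      and_true] at hp
    obtain ⟨ha, hb, ⟨y, hy, hyΓ⟩, -⟩ := hp
    by_cases hα : (P.grid N).node p.1 ∈ P.Ω
    swap
    · by_cases hβ : (P.grid N).node (p.1 + dir p.2) ∈ P.Ω
      swap
      · exact ⟨P.mem_layer_of_active hN ha hα, P.mem_layer_of_active hN hb hβ⟩
      · have : (p.1 + dir p.2, (p.2, false)) ∈ (P.lattice hN).cutPairs := by
          rw [LatticeDomain.mem_cutPairs, mem_I_iff, mem_I_iff]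
          simpa [step] using ⟨hβ, hα⟩
        exact ⟨P.mem_layer_of_active hN ha hα, (P.lattice hN).fst_mem_layer this⟩
    by_cases hβ : (P.grid N).node (p.1 + dir p.2) ∈ P.Ω
    swap
    · have : (p.1, (p.2, true)) ∈ (P.lattice hN).cutPairs := by
        rw [LatticeDomain.mem_cutPairs, mem_I_iff, mem_I_iff]
        simpa [step] using ⟨hα, hβ⟩
      exact ⟨(P.lattice hN).fst_mem_layer this, P.mem_layer_of_active hN hb hβ⟩
    -- Both ends are inside, so the edge touches Γ without crossing between its nodes. Then φ ≥
    -- -2Mh² at the ends, and one step against t leaves Ω, which puts them in the layer.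
    obtain ⟨t, ht⟩ := hflat y hyΓ
    have hy0 := P.mem_frontier_iff.1 hyΓ
    rw [Grid.edge, node_add_dir, ← hdef] at hy
    have hy' : y ∈ segment ℝ ((P.grid N).node (p.1 + dir p.2))
        ((P.grid N).node (p.1 + dir p.2) + h • axis (p.2, false)) := by
      rw [segment_symm]
      have e : (P.grid N).node (p.1 + dir p.2) + h • axis (p.2, false) = (P.grid N).node p.1 := by
        rw [node_add_dir]; simp [axis, ← hdef]
      rw [e, node_add_dir]; exact hy
    have key : ∀ (α : Idx n) (s : SDir n), (P.grid N).node α ∈ P.Ω →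
        (P.grid N).node (α + step s) ∈ P.Ω →
        y ∈ segment ℝ ((P.grid N).node α) ((P.grid N).node α + h • axis s) →
        α ∈ (P.lattice hN).layer := by
      intro α s hα hαs hseg
      rw [P.mem_iff] at hα hαs
      rw [node_add_step, ← hdef] at hαs
      have hlow := P.neg_le_of_touching ht hM hh (by linarith) hseg hy0 hα hαs
      have nx := (norm_sub_le_of_mem_edge hh.le hseg).1
      set x := (P.grid N).node α
      have bx := mem_ball_of_norm_le (η := η) nx (by linarith)
      have bf := mem_ball_of_norm_le (η := η) (norm_add_smul_axis_sub_le t.flip hh.le nx)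
        (by linarith)
      have e : x + h • axis t.flip + h • axis t = x := by rw [axis_flip]; simp
      have d := ht.decrease hh.le bf (by rw [e]; exact bx)
      rw [e] at d
      have hM2 : 2 * M * h ^ 2 ≤ g * h := by nlinarith
      have hcut : (α, t.flip) ∈ (P.lattice hN).cutPairs := by
        rw [LatticeDomain.mem_cutPairs, mem_I_iff, mem_I_iff, P.mem_iff, P.mem_iff]
        refine ⟨hα, ?_⟩
        rw [not_lt]
        simp only [node_add_step, ← hdef]
        change 0 ≤ P.φ (x + h • axis t.flip)
        linarith
      exact (P.lattice hN).fst_mem_layer hcut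
    refine ⟨key p.1 (p.2, true) hα (by simpa [step] using hβ) hy,
      key _ (p.2, false) hβ (by simpa [step] using hα) hy'⟩

end LevelSetDomain

/-! ### Counting the nodes of the boundary layer -/

/-- In each column in direction i the set has at most 2m + 1 nodes, and the majorant is constant
there, so the sum reduces to one hyperplane. -/
theorem ColumnBound.sum_le {n N : ℕ} {A : ℝ} {ω : Idx n → ℝ} (hω : ColumnBound N A ω)
    {S : Finset (Idx n)} (hS : S ⊆ idxBox n N) (i : Fin n) (m : ℕ)
    (hfib : ∀ α ∈ S, ∀ β ∈ S, Function.update α i 0 = Function.update β i 0 → α i - β i ≤ m) :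
    ∑ α ∈ S, ω α ≤ (2 * m + 1) * (A * N) := by
  classical
  obtain ⟨maj, h0, hupd, hsum, hle⟩ := hω
  have h1 : ∑ α ∈ S, ω α ≤ ∑ α ∈ S, maj i (Function.update α i 0) :=
    Finset.sum_le_sum fun α hα => by rw [hupd]; exact hle i α (hS hα)
  have hmaps : ∀ α ∈ S, Function.update α i 0 ∈ (idxBox n N).filter fun α => α i = 0 := by
    intro α hα
    rw [Finset.mem_filter, mem_idxBox]
    refine ⟨fun j => ?_, by simp⟩
    by_cases hj : j = i
    · subst hj; simp
    · rw [Function.update_of_ne hj]; exact mem_idxBox.1 (hS hα) j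
  refine h1.trans ?_
  rw [← Finset.sum_fiberwise_of_maps_to hmaps]
  have h2 : ∀ b ∈ (idxBox n N).filter (fun α => α i = 0),
      ∑ α ∈ S.filter (fun α => Function.update α i 0 = b), maj i (Function.update α i 0) ≤
      (2 * m + 1) * maj i b := by
    intro b _
    have e : ∑ α ∈ S.filter (fun α => Function.update α i 0 = b), maj i (Function.update α i 0) =
        (S.filter (fun α => Function.update α i 0 = b)).card * maj i b := by
      rw [← nsmul_eq_mul, ← Finset.sum_const]
      refine Finset.sum_congr rfl fun α hα => ?_
      rw [(Finset.mem_filter.1 hα).2]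
    rw [e]
    refine mul_le_mul_of_nonneg_right ?_ (h0 i b)
    rcases (S.filter (fun α => Function.update α i 0 = b)).eq_empty_or_nonempty with h | ⟨β, hβ⟩
    · rw [h]; simp; positivity
    · have : (S.filter (fun α => Function.update α i 0 = b)).card ≤
          (Finset.Icc (β i - m) (β i + m)).card := by
        refine Finset.card_le_card_of_injOn (fun α => α i) ?_ ?_
        · intro α hα
          rw [Finset.mem_coe, Finset.mem_filter] at hα
          rw [Finset.mem_filter] at hβ
          have a1 := hfib α hα.1 β hβ.1 (hα.2.trans hβ.2.symm)
          have a2 := hfib β hβ.1 α hα.1 (hβ.2.trans hα.2.symm)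
          rw [Finset.mem_coe, Finset.mem_Icc]
          constructor <;> linarith
        · intro α hα β hβ hαβ
          rw [Finset.mem_coe, Finset.mem_filter] at hα hβ
          have : Function.update α i 0 = Function.update β i 0 := hα.2.trans hβ.2.symm
          funext j
          by_cases hj : j = i
          · subst hj; exact hαβ
          · have := congrFun this j
            rwa [Function.update_of_ne hj, Function.update_of_ne hj] at this
      have hc : (Finset.Icc (β i - m) (β i + m)).card = 2 * m + 1 := by
        rw [Int.card_Icc]; omega
      rw [hc] at this
      exact_mod_cast this
  refine (Finset.sum_le_sum h2).trans ?_
  rw [← Finset.mul_sum]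
  exact mul_le_mul_of_nonneg_left (hsum i) (by positivity)

theorem ColumnBound.sum_box_le {n N : ℕ} (hn : 1 ≤ n) (hN : 1 ≤ N) {A : ℝ} (hA : 0 ≤ A)
    {ω : Idx n → ℝ} (hω : ColumnBound N A ω) {S : Finset (Idx n)} (hS : S ⊆ idxBox n N) :
    ∑ α ∈ S, ω α ≤ 3 * A * (N : ℝ) ^ 2 := by
  have := hω.sum_le hS ⟨0, hn⟩ N fun α hα β hβ _ => by
    have := mem_idxBox.1 (hS hα) ⟨0, hn⟩
    have := mem_idxBox.1 (hS hβ) ⟨0, hn⟩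
    omega
  refine this.trans ?_
  have hN' : (1 : ℝ) ≤ N := by exact_mod_cast hN
  have : 0 ≤ A * N := by positivity
  nlinarith

namespace LevelSetDomain

variable {n : ℕ} (P : LevelSetDomain n) {η g Λ M : ℝ}

theorem node_eq_add_of_update {N : ℕ} {α β : Idx n} {i : Fin n}
    (h : Function.update α i 0 = Function.update β i 0) (b : Bool) :
    (P.grid N).node α = (P.grid N).node β +
      ((if b then (1 : ℝ) else -1) * ((α i : ℝ) - β i) * (P.grid N).h) • axis (i, b) := by
  ext j
  by_cases hj : j = i
  · subst hj
    cases b <;> simp [Grid.node, axis] <;> ring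
  · have := congrFun h j
    rw [Function.update_of_ne hj, Function.update_of_ne hj] at this
    cases b <;> simp [Grid.node, axis, this, hj]

/-- Finitely many balls cover Γ, and in each of them the layer is a thickened graph over a
coordinate hyperplane, with a number of nodes per column that does not depend on h. The constant is
the number of balls times that column count. -/
theorem exists_sum_layer_le (hη : 0 < η) (hg : 0 < g) (hΛ : 0 < Λ)
    (hflat : ∀ y ∈ frontier P.Ω, ∃ s, IsFlatAt P.φ y η g Λ M s) :
    ∃ C : ℝ, 0 < C ∧ ∀ (N : ℕ) (hN : 1 ≤ N), 5 * (P.grid N).h < η → ∀ (A : ℝ) (ω : Idx n → ℝ),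
      0 ≤ A → (∀ α, 0 ≤ ω α) → ColumnBound N A ω →
      ∑ α ∈ (P.lattice hN).layer, ω α ≤ C * A * N := by
  classical
  obtain ⟨T, hTΓ, hTfin, hcov⟩ := P.isCompact_frontier.finite_cover_balls (half_pos hη)
  lift T to Finset (Pt n) using hTfin
  choose s hs using hflat
  -- In the layer |φ| ≤ Λh, while φ drops by at least gh per step along the axis; two layer nodes of
  -- a column are thus at most 2Λ/g steps apart.
  set m : ℕ := ⌈2 * Λ / g⌉₊ with hm
  refine ⟨(T.card + 1) * (2 * m + 1), by positivity, fun N hN hh A ω hA hω0 hω => ?_⟩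
  have hpos := P.h_pos hN
  set h := (P.grid N).h with hdef
  have near : ∀ α ∈ (P.lattice hN).layer, ∃ c ∈ T, (P.grid N).node α ∈ Metric.ball c η := by
    intro α hα
    obtain ⟨y, hy, hαy⟩ := P.exists_frontier_near_layer hN hα
    obtain ⟨c, hc, hyc⟩ := Set.mem_iUnion₂.1 (hcov hy)
    refine ⟨c, hc, ?_⟩
    rw [Metric.mem_ball] at hyc ⊢
    rw [← dist_eq_norm] at hαy
    linarith [dist_triangle ((P.grid N).node α) y c]
  have hval : ∀ α ∈ (P.lattice hN).layer, |P.φ ((P.grid N).node α)| ≤ Λ * h := by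
    intro α hα
    obtain ⟨y, hy, hαy⟩ := P.exists_frontier_near_layer hN hα
    have := (hs y hy).lipschitz (Metric.mem_ball_self hη)
      (mem_ball_of_norm_le hαy (by linarith))
    rw [P.mem_frontier_iff.1 hy, sub_zero] at this
    exact this.trans (mul_le_mul_of_nonneg_left hαy hΛ.le)
  have piece : ∀ c ∈ T, ∑ α ∈ (P.lattice hN).layer.filter
      (fun α => (P.grid N).node α ∈ Metric.ball c η), ω α ≤ (2 * m + 1) * (A * N) := by
    intro c hc
    have hfl := hs c (hTΓ hc)
    generalize s c (hTΓ hc) = sc at hfl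
    refine hω.sum_le ?_ sc.1 m ?_
    · exact (Finset.filter_subset _ _).trans
        ((P.layer_subset_active hN).trans (P.active_subset_box N))
    · intro α hα β hβ hαβ
      rw [Finset.mem_filter] at hα hβ
      have main : ∀ {α β : Idx n}, α ∈ (P.lattice hN).layer → β ∈ (P.lattice hN).layer →
          (P.grid N).node α ∈ Metric.ball c η → (P.grid N).node β ∈ Metric.ball c η →
          ∀ t : ℝ, 0 ≤ t → (P.grid N).node α = (P.grid N).node β + (t * h) • axis sc →
          t ≤ m := by
        intro α β hα hβ hαc hβc t ht hEq
        have d := hfl.decrease (t := t * h) (by positivity) hβc (by rw [← hEq]; exact hαc)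
        rw [← hEq] at d
        have v1 := (abs_le.1 (hval α hα)).1
        have v2 := (abs_le.1 (hval β hβ)).2
        have : g * t * h ≤ 2 * Λ * h := by linarith
        have := le_of_mul_le_mul_right this hpos
        have h3 : t ≤ 2 * Λ / g := by rw [le_div_iff₀ hg]; linarith
        exact h3.trans (Nat.le_ceil _)
      by_contra! hcon
      have hcon' : (m : ℝ) < α sc.1 - β sc.1 := by exact_mod_cast hcon
      have hm0 : (0 : ℝ) ≤ m := Nat.cast_nonneg m
      have e1 := P.node_eq_add_of_update (N := N) hαβ sc.2
      have e2 := P.node_eq_add_of_update (N := N) hαβ.symm sc.2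
      rw [Prod.mk.eta] at e1 e2
      by_cases hb : sc.2 = true
      · rw [if_pos hb, one_mul] at e1
        have := main hα.1 hβ.1 hα.2 hβ.2 _ (by linarith) e1
        linarith
      · rw [if_neg hb] at e2
        have := main hβ.1 hα.1 hβ.2 hα.2 _ (by linarith) e2
        linarith
  have hcover : ∑ α ∈ (P.lattice hN).layer, ω α ≤ ∑ c ∈ T, ∑ α ∈ (P.lattice hN).layer.filter
      (fun α => (P.grid N).node α ∈ Metric.ball c η), ω α := by
    simp only [Finset.sum_filter]
    rw [Finset.sum_comm]
    refine Finset.sum_le_sum fun α hα => ?_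
    obtain ⟨c, hc, hαc⟩ := near α hα
    have := Finset.single_le_sum
      (f := fun c => if (P.grid N).node α ∈ Metric.ball c η then ω α else 0)
      (fun c _ => by split_ifs; exacts [hω0 α, le_rfl]) hc
    simpa only [hαc, if_true] using this
  refine hcover.trans ((Finset.sum_le_sum piece).trans ?_)
  rw [Finset.sum_const, nsmul_eq_mul]
  have : 0 ≤ (2 * (m : ℝ) + 1) * (A * N) := by positivity
  nlinarith

end LevelSetDomain

/-! ### Functions with bounded derivatives of order at most four -/

/-- `u ∈ C⁴(Ω)` with derivatives of order at most four bounded by `K`. -/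
structure IsC4Bounded {n : ℕ} (Ω : Set (Pt n)) (u : Pt n → ℝ) (K : ℝ) : Prop where
  contDiffAt : ∀ x ∈ Ω, ContDiffAt ℝ 4 u x
  bound : ∀ k : ℕ, k ≤ 4 → ∀ x ∈ Ω, ‖iteratedFDeriv ℝ k u x‖ ≤ K
  nonneg : 0 ≤ K

theorem MemC4.isC4Bounded {n : ℕ} {Ω : Set (Pt n)} {u : Pt n → ℝ} (hΩ : IsOpen Ω)
    (hu : MemC4 Ω u) : IsC4Bounded Ω u (c4Norm Ω u).toReal where
  contDiffAt x hx := hu.1.contDiffAt (hΩ.mem_nhds hx)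
  bound k hk x hx := by
    have h : ‖iteratedFDeriv ℝ k u x‖ₑ ≤ c4Norm Ω u :=
      le_iSup_of_le k (le_iSup_of_le hk (le_iSup_of_le x (le_iSup_of_le hx le_rfl)))
    have := ENNReal.toReal_mono hu.2.ne h
    simpa using this
  nonneg := ENNReal.toReal_nonneg

/-- Integrates a bound once by the mean value inequality. The factor 1/(k + 1) is given up, which
only affects constants. -/
theorem abs_le_mul_pow_of_deriv {F F' : ℝ → ℝ} {h C : ℝ} {k : ℕ} (hC : 0 ≤ C) (h0 : F 0 = 0)
    (hd : ∀ t ∈ Set.Icc 0 h, HasDerivAt F (F' t) t) (hb : ∀ t ∈ Set.Icc 0 h, |F' t| ≤ C * t ^ k) :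
    ∀ t ∈ Set.Icc 0 h, |F t| ≤ C * t ^ (k + 1) := by
  intro t ht
  have := (convex_Icc 0 t).norm_image_sub_le_of_norm_hasDerivWithin_le (f := F) (f' := F')
    (C := C * t ^ k) (fun τ hτ => (hd τ ⟨hτ.1, hτ.2.trans ht.2⟩).hasDerivWithinAt)
    (fun τ hτ => (hb τ ⟨hτ.1, hτ.2.trans ht.2⟩).trans
      (mul_le_mul_of_nonneg_left (pow_le_pow_left₀ hτ.1 hτ.2 k) hC))
    (Set.left_mem_Icc.2 ht.1) (Set.right_mem_Icc.2 ht.1)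
  rw [h0, sub_zero, sub_zero, Real.norm_eq_abs, Real.norm_of_nonneg ht.1] at this
  rw [pow_succ, ← mul_assoc]
  exact this

namespace IsC4Bounded

variable {n : ℕ} {Ω : Set (Pt n)} {u : Pt n → ℝ} {K : ℝ}

theorem abs_le (hu : IsC4Bounded Ω u K) {x : Pt n} (hx : x ∈ Ω) : |u x| ≤ K := by
  have := hu.bound 0 (by norm_num) x hx
  rwa [norm_iteratedFDeriv_zero] at this

theorem norm_fderiv_le (hu : IsC4Bounded Ω u K) {x : Pt n} (hx : x ∈ Ω) : ‖fderiv ℝ u x‖ ≤ K := by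
  have := hu.bound 1 (by norm_num) x hx
  rwa [norm_iteratedFDeriv_one] at this

theorem norm_fderiv_sub_le (hu : IsC4Bounded Ω u K) {x y : Pt n} (h : segment ℝ x y ⊆ Ω) :
    ‖fderiv ℝ u y - fderiv ℝ u x‖ ≤ K * ‖y - x‖ := by
  refine (convex_segment x y).norm_image_sub_le_of_norm_fderiv_le (𝕜 := ℝ) (fun z hz => ?_)
    (fun z hz => ?_) (left_mem_segment ℝ x y) (right_mem_segment ℝ x y)
  · exact ((hu.contDiffAt z (h hz)).fderiv_right (m := 3) (by norm_num)).differentiableAt (by norm_num)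
  · rw [← norm_iteratedFDeriv_one, norm_iteratedFDeriv_fderiv]
    exact hu.bound 2 (by norm_num) z (h hz)

theorem taylor_one (hu : IsC4Bounded Ω u K) {x y : Pt n} (h : segment ℝ x y ⊆ Ω) :
    |u y - u x - fderiv ℝ u x (y - x)| ≤ K * ‖y - x‖ ^ 2 := by
  refine norm_taylor_one_le hu.nonneg
    (fun z hz => (hu.contDiffAt z (h hz)).differentiableAt (by norm_num)) fun z hz => ?_
  refine hu.norm_fderiv_sub_le fun w hw => h ?_
  exact (convex_segment x y).segment_subset (left_mem_segment ℝ x y) hz hw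

theorem hasDerivAt_line (hu : IsC4Bounded Ω u K) {x e : Pt n} {t : ℝ} (hx : x + t • e ∈ Ω) {k : ℕ}
    (hk : k < 4) : HasDerivAt (fun t : ℝ => iteratedFDeriv ℝ k u (x + t • e) fun _ => e)
      (iteratedFDeriv ℝ (k + 1) u (x + t • e) fun _ => e) t := by
  have h1 : HasDerivAt (fun τ : ℝ => x + τ • e) e t := by
    simpa using ((hasDerivAt_id t).smul_const e).const_add x
  have h2 : DifferentiableAt ℝ (iteratedFDeriv ℝ k u) (x + t • e) :=
    (hu.contDiffAt _ hx).differentiableAt_iteratedFDeriv (by exact_mod_cast hk)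
  have h3 := (h2.hasFDerivAt.continuousMultilinear_apply_const fun _ => e).comp_hasDerivAt t h1
  have e1 : (iteratedFDeriv ℝ (k + 1) u (x + t • e) fun _ => e) =
      (fderiv ℝ (iteratedFDeriv ℝ k u) (x + t • e) e) fun _ => e := by
    rw [iteratedFDeriv_succ_apply_left]; rfl
  rw [e1]
  exact h3

theorem abs_line_le (hu : IsC4Bounded Ω u K) {x e : Pt n} (hx : x ∈ Ω) (he : ‖e‖ = 1) {k : ℕ}
    (hk : k ≤ 4) : |iteratedFDeriv ℝ k u x fun _ => e| ≤ K := by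
  have := (iteratedFDeriv ℝ k u x).le_opNorm fun _ => e
  simp only [he, Finset.prod_const_one, mul_one] at this
  exact this.trans (hu.bound k hk x hx)

theorem line_neg (u : Pt n → ℝ) (x e : Pt n) (k : ℕ) :
    (iteratedFDeriv ℝ k u x fun _ => -e) = (-1) ^ k * iteratedFDeriv ℝ k u x fun _ => e := by
  have := (iteratedFDeriv ℝ k u x).map_smul_univ (fun _ => (-1 : ℝ)) fun _ => e
  simp only [neg_smul, one_smul, Finset.prod_const, Finset.card_univ, Fintype.card_fin,
    smul_eq_mul] at this
  exact this

/-- The even function u(x + te) + u(x - te) has vanishing odd derivatives at 0. Its fourth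
derivative is at most 2K, and four integrations from 0 give the bound, using u only on the two
segments. -/
theorem second_difference (hu : IsC4Bounded Ω u K) {x e : Pt n} {h : ℝ} (hh : 0 ≤ h)
    (he : ‖e‖ = 1) (h1 : segment ℝ x (x + h • e) ⊆ Ω) (h2 : segment ℝ x (x + h • -e) ⊆ Ω) :
    |u (x + h • e) + u (x + h • -e) - 2 * u x - h ^ 2 * iteratedFDeriv ℝ 2 u x ![e, e]| ≤
      2 * K * h ^ 4 := by
  have hx : x ∈ Ω := h1 (left_mem_segment ℝ _ _)
  have seg : ∀ e : Pt n, segment ℝ x (x + h • e) ⊆ Ω → ∀ t ∈ Set.Icc 0 h, x + t • e ∈ Ω := by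
    intro e hseg t ht
    apply hseg
    rcases eq_or_lt_of_le hh with h0 | h0
    · have : t = 0 := le_antisymm (by rw [h0]; exact ht.2) ht.1
      simp [this, left_mem_segment]
    · rw [segment_eq_image']
      refine ⟨t / h, ⟨div_nonneg ht.1 hh, (div_le_one h0).2 ht.2⟩, ?_⟩
      simp only [add_sub_cancel_left, smul_smul, div_mul_cancel₀ _ h0.ne']
  have s1 := seg e h1
  have s2 := seg (-e) h2
  set g : ℕ → ℝ → ℝ := fun k t => (iteratedFDeriv ℝ k u (x + t • e) fun _ => e) +
    iteratedFDeriv ℝ k u (x + t • -e) fun _ => -e with hg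
  have hder : ∀ k < 4, ∀ t ∈ Set.Icc 0 h, HasDerivAt (g k) (g (k + 1) t) t := fun k hk t ht =>
    (hu.hasDerivAt_line (s1 t ht) hk).add (hu.hasDerivAt_line (s2 t ht) hk)
  have g0 : ∀ k, g k 0 = (1 + (-1) ^ k) * iteratedFDeriv ℝ k u x fun _ => e := by
    intro k
    simp only [hg, zero_smul, add_zero, line_neg]
    ring
  have b4 : ∀ t ∈ Set.Icc 0 h, |g 4 t| ≤ 2 * K * t ^ 0 := by
    intro t ht
    have a1 := hu.abs_line_le (s1 t ht) he le_rfl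
    have a2 := hu.abs_line_le (s2 t ht) (by rw [norm_neg, he]) le_rfl
    simp only [hg]
    refine (abs_add_le _ _).trans ?_
    linarith
  have hK : 0 ≤ 2 * K := by linarith [hu.nonneg]
  have b3 := abs_le_mul_pow_of_deriv hK (F := g 3) (by rw [g0]; norm_num) (hder 3 (by norm_num)) b4
  have b2 := abs_le_mul_pow_of_deriv hK (F := fun t => g 2 t - g 2 0) (by simp)
    (fun t ht => (hder 2 (by norm_num) t ht).sub_const _) b3
  have b1 := abs_le_mul_pow_of_deriv hK (F := fun t => g 1 t - t * g 2 0)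
    (by rw [g0 1]; norm_num)
    (fun t ht => (hder 1 (by norm_num) t ht).sub (by simpa using (hasDerivAt_id t).mul_const (g 2 0)))
    b2
  have b0 := abs_le_mul_pow_of_deriv hK (F := fun t => g 0 t - g 0 0 - t ^ 2 / 2 * g 2 0)
    (by simp)
    (fun t ht => ((hder 0 (by norm_num) t ht).sub_const _).sub
      (by
        have : HasDerivAt (fun t : ℝ => t ^ 2 / 2) t t := by
          simpa using (hasDerivAt_pow 2 t).div_const 2
        exact this.mul_const (g 2 0)))
    b1
  have := b0 h ⟨hh, le_rfl⟩
  have c0 : g 0 h = u (x + h • e) + u (x + h • -e) := by simp [hg]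
  have c1 : g 0 0 = 2 * u x := by rw [g0]; norm_num
  have c2 : g 2 0 = 2 * iteratedFDeriv ℝ 2 u x ![e, e] := by
    have : (fun _ : Fin 2 => e) = ![e, e] := by ext i; fin_cases i <;> rfl
    rw [g0, this]; norm_num
  rw [c0, c1, c2] at this
  convert this using 2
  ring

theorem laplacian_eq (u : Pt n → ℝ) (x : Pt n) : Laplacian.laplacian u x =
    ∑ i, iteratedFDeriv ℝ 2 u x ![axis (i, true), axis (i, true)] := by
  rw [InnerProductSpace.laplacian_eq_iteratedFDeriv_orthonormalBasis u
    (EuclideanSpace.basisFun (Fin n) ℝ)]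
  simp [axis]

theorem abs_laplacian_le (hu : IsC4Bounded Ω u K) {x : Pt n} (hx : x ∈ Ω) :
    |Laplacian.laplacian u x| ≤ n * K := by
  rw [laplacian_eq]
  refine (Finset.abs_sum_le_sum_abs _ _).trans ?_
  have : ∀ i ∈ (Finset.univ : Finset (Fin n)),
      |iteratedFDeriv ℝ 2 u x ![axis (i, true), axis (i, true)]| ≤ K := by
    intro i _
    have e : (fun _ : Fin 2 => axis (i, true)) = ![axis (i, true), axis (i, true)] := by
      ext j; fin_cases j <;> rfl
    rw [← e]
    exact hu.abs_line_le hx (norm_axis _) (by norm_num)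
  refine (Finset.sum_le_sum this).trans ?_
  simp

end IsC4Bounded

/-! ### Affine approximation near the boundary -/

namespace LevelSetDomain

variable {n : ℕ} (P : LevelSetDomain n) {η g Λ M : ℝ}

set_option maxHeartbeats 2000000 in
/-- Approximation of `u` near `y ∈ Γ`, at scale `h`, by an affine function that is a multiple of `φ`
up to second order. -/
theorem exists_affine (hη : 0 < η) (hg : 0 < g) (hΛ : 0 < Λ) (hM : 0 < M) :
    ∃ C h₁ : ℝ, 0 < C ∧ 0 < h₁ ∧ ∀ (y : Pt n) (s : SDir n), y ∈ frontier P.Ω →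
      IsFlatAt P.φ y η g Λ M s → ∀ h : ℝ, 0 < h → h < h₁ → ∀ (u : Pt n → ℝ) (K : ℝ),
      IsC4Bounded P.Ω u K → ContinuousOn u (closure P.Ω) → (∀ x ∈ frontier P.Ω, u x = 0) →
      ∃ (c lam : ℝ) (l : Pt n →L[ℝ] ℝ),
        (∀ z, ‖z - y‖ ≤ 2 * h → |c + l z - lam * P.φ z| ≤ C * K * h ^ 2) ∧
        (∀ x ∈ P.Ω, ‖x - y‖ ≤ 3 * h → |u x - (c + l x)| ≤ C * K * h ^ 2 ∧
          ‖fderiv ℝ u x - l‖ ≤ C * K * h) := by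
  -- Distances in units of h: from a point within 2h of y, moving K₁h along the axis s in one of the
  -- two senses reaches Γ; R is the radius of the region considered, K₁ + 2 plus one spare unit; and
  -- the R-ball around y, moved by K₂h along s, lies inside Ω.
  set K₁ := (2 * Λ + 1) / g with hK₁
  set R := K₁ + 3 with hR
  set K₂ := (R * Λ + 1) / g with hK₂
  have hK₁0 : 0 < K₁ := by positivity
  have hR0 : 0 < R := by positivity
  have hK₂0 : 0 < K₂ := by positivity
  have hgK₁ : g * K₁ = 2 * Λ + 1 := by rw [hK₁]; field_simp
  have hgK₂ : g * K₂ = R * Λ + 1 := by rw [hK₂]; field_simp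
  refine ⟨(K₂ + R) ^ 2 + (K₂ + R) + M / g * (R ^ 2 + 4), η / (R + K₂), by positivity,
    by positivity, fun y s hy hf h hh hh₁ u K hu huc hu0 => ?_⟩
  have hRη : (R + K₂) * h < η := by
    rw [lt_div_iff₀ (by positivity)] at hh₁; linarith
  have hK0 := hu.nonneg
  have hy0 := P.mem_frontier_iff.1 hy
  have byy : y ∈ Metric.ball y η := Metric.mem_ball_self hη
  have hRh : R * h < η := by nlinarith
  -- As u is only given in Ω, the affine function is its Taylor polynomial at a point pushed inside,
  -- around which a whole ball lies in Ω.
  set xs := y + (K₂ * h) • axis s with hxs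
  set l := fderiv ℝ u xs with hl
  have hball : Metric.closedBall xs (R * h) ⊆ P.Ω := by
    intro w hw
    rw [Metric.mem_closedBall, dist_eq_norm] at hw
    set z := w - (K₂ * h) • axis s with hz
    have ez : z + (K₂ * h) • axis s = w := by rw [hz]; abel
    have nz : ‖z - y‖ ≤ R * h := by
      have : z - y = w - xs := by rw [hz, hxs]; abel
      rw [this]; exact hw
    have bz := mem_ball_of_norm_le (η := η) nz hRh
    have nw := norm_add_smul_axis_sub_le s (t := K₂ * h) (by positivity) nz
    have d := hf.decrease (t := K₂ * h) (by positivity) bz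
      (mem_ball_of_norm_le (η := η) nw (by linarith))
    rw [ez] at d
    have lp := (abs_le.1 (hf.lipschitz byy bz)).2
    rw [hy0, sub_zero] at lp
    have : Λ * ‖z - y‖ ≤ Λ * (R * h) := mul_le_mul_of_nonneg_left nz hΛ.le
    rw [P.mem_iff]
    have : g * (K₂ * h) = (R * Λ + 1) * h := by rw [← mul_assoc, hgK₂]
    nlinarith
  have hxsΩ : xs ∈ P.Ω := hball (Metric.mem_closedBall_self (by positivity))
  set c := u xs - l xs with hc
  have hT : ∀ z, c + l z = u xs + l (z - xs) := fun z => by rw [hc, map_sub]; ring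
  have inner : ∀ x ∈ P.Ω, ‖x - y‖ ≤ R * h →
      |u x - (c + l x)| ≤ (K₂ + R) ^ 2 * K * h ^ 2 ∧
        ‖fderiv ℝ u x - l‖ ≤ (K₂ + R) * K * h := by
    intro x hx hxy
    -- The path from x to xs goes straight inside along s, where φ decreases, and then through the
    -- convex ball, so every segment used lies in Ω.
    set x' := x + (K₂ * h) • axis s with hx'
    have bx := mem_ball_of_norm_le (η := η) hxy hRh
    have nx'x : ‖x' - x‖ = K₂ * h := by
      rw [hx', add_sub_cancel_left, norm_smul, norm_axis, mul_one,
        Real.norm_of_nonneg (by positivity)]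
    have nx' : ‖x' - xs‖ ≤ R * h := by
      have : x' - xs = x - y := by rw [hx', hxs]; abel
      rw [this]; exact hxy
    have seg1 : segment ℝ x x' ⊆ P.Ω := by
      intro w hw
      rw [hx', segment_eq_image'] at hw
      obtain ⟨τ, ⟨hτ0, hτ1⟩, rfl⟩ := hw
      simp only [add_sub_cancel_left, smul_smul]
      have hτ : τ * (K₂ * h) ≤ K₂ * h := by nlinarith [mul_pos hK₂0 hh]
      have d := hf.decrease (t := τ * (K₂ * h)) (by positivity) bx
        (mem_ball_of_norm_le (η := η)
          (norm_add_smul_axis_sub_le s (by positivity) hxy) (by linarith))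
      rw [P.mem_iff] at hx ⊢
      have : 0 ≤ g * (τ * (K₂ * h)) := by positivity
      linarith
    have hx'ball : x' ∈ Metric.closedBall xs (R * h) := by
      rw [Metric.mem_closedBall, dist_eq_norm]; exact nx'
    have seg2 : segment ℝ xs x' ⊆ P.Ω := fun w hw =>
      hball ((convex_closedBall xs (R * h)).segment_subset
        (Metric.mem_closedBall_self (by positivity)) hx'ball hw)
    have seg1' : segment ℝ x' x ⊆ P.Ω := by rw [segment_symm]; exact seg1
    have nxx' : ‖x - x'‖ = K₂ * h := by rw [norm_sub_rev]; exact nx'x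
    have D1 := hu.norm_fderiv_sub_le seg1'
    have D2 := hu.norm_fderiv_sub_le seg2
    have T1 := hu.taylor_one seg1'
    have T2 := hu.taylor_one seg2
    rw [nxx'] at D1 T1
    have D2' : ‖fderiv ℝ u x' - l‖ ≤ K * (R * h) :=
      D2.trans (mul_le_mul_of_nonneg_left nx' hK0)
    have T2' : |u x' - u xs - l (x' - xs)| ≤ K * (R * h) ^ 2 :=
      T2.trans (mul_le_mul_of_nonneg_left (pow_le_pow_left₀ (norm_nonneg _) nx' 2) hK0)
    have T3 : |(fderiv ℝ u x' - l) (x - x')| ≤ K * (R * h) * (K₂ * h) := by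
      have := (fderiv ℝ u x' - l).le_opNorm (x - x')
      rw [nxx', Real.norm_eq_abs] at this
      exact this.trans (mul_le_mul_of_nonneg_right D2' (by positivity))
    constructor
    · have e : u x - (c + l x) = (u x - u x' - fderiv ℝ u x' (x - x')) +
          (u x' - u xs - l (x' - xs)) + (fderiv ℝ u x' - l) (x - x') := by
        rw [hT, sub_apply]
        have : l (x - xs) = l (x - x') + l (x' - xs) := by rw [← map_add]; congr 1; abel
        rw [this]; ring
      rw [e]
      refine (abs_add_three _ _ _).trans ?_
      have : 0 ≤ K * (R * h) * (K₂ * h) := by positivity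
      nlinarith
    · have e : fderiv ℝ u x - l = (fderiv ℝ u x - fderiv ℝ u x') + (fderiv ℝ u x' - l) := by abel
      rw [e]
      refine (norm_add_le _ _).trans ?_
      linarith
  -- On Γ the solution vanishes, but the Taylor estimate holds only in Ω; it is carried to z by
  -- continuity along the inward ray z + t e_s.
  have onΓ : ∀ z, P.φ z = 0 → ‖z - y‖ ≤ (R - 1) * h → |c + l z| ≤ (K₂ + R) ^ 2 * K * h ^ 2 := by
    intro z hz hzy
    have hev : ∀ t ∈ Set.Ioo 0 h, z + t • axis s ∈ P.Ω ∧ ‖z + t • axis s - y‖ ≤ R * h := by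
      intro t ht
      have n1 := norm_add_smul_axis_sub_le s ht.1.le hzy
      have n2 : ‖z + t • axis s - y‖ ≤ R * h := n1.trans (by linarith [ht.2])
      refine ⟨?_, n2⟩
      have d := hf.decrease ht.1.le (mem_ball_of_norm_le (η := η) hzy (by linarith))
        (mem_ball_of_norm_le (η := η) n2 hRh)
      rw [P.mem_iff]
      have := mul_pos hg ht.1
      linarith
    have htend : Filter.Tendsto (fun t : ℝ => z + t • axis s) (nhdsWithin 0 (Set.Ioo 0 h))
        (nhdsWithin z (closure P.Ω)) := by
      refine tendsto_nhdsWithin_iff.2 ⟨?_, ?_⟩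
      · have : Continuous fun t : ℝ => z + t • axis s := by fun_prop
        have h0 := this.tendsto 0
        simp only [zero_smul, add_zero] at h0
        exact h0.mono_left nhdsWithin_le_nhds
      · filter_upwards [self_mem_nhdsWithin] with t ht
        exact subset_closure (hev t ht).1
    have hzcl : z ∈ closure P.Ω := P.mem_closure_iff.2 hz.le
    have l1 := (huc z hzcl).tendsto.comp htend
    rw [hu0 z (P.mem_frontier_iff.2 hz)] at l1
    have l2 : Filter.Tendsto (fun t : ℝ => c + l (z + t • axis s)) (nhdsWithin 0 (Set.Ioo 0 h))
        (nhds (c + l z)) :=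
      ((continuous_const.add l.continuous).tendsto z).comp (htend.mono_right nhdsWithin_le_nhds)
    have l3 := (l1.sub l2).abs
    rw [zero_sub, abs_neg] at l3
    have : (nhdsWithin (0 : ℝ) (Set.Ioo 0 h)).NeBot := by
      rw [nhdsWithin_Ioo_eq_nhdsGT hh]; infer_instance
    refine le_of_tendsto l3 ?_
    filter_upwards [self_mem_nhdsWithin] with t ht
    exact (inner _ (hev t ht).1 (hev t ht).2).1
  have hDe := hf.decr y byy
  set D := fderiv ℝ P.φ y with hD
  have hDne : D (axis s) ≠ 0 := by linarith
  have hle : |l (axis s)| ≤ K := by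
    have := l.le_opNorm (axis s)
    rw [norm_axis, mul_one] at this
    exact this.trans (hu.norm_fderiv_le hxsΩ)
  -- This multiplier makes l and the linearization of φ at y agree along s. The function c + l - lam
  -- φ then changes only by O(K h²) when z is moved along s to a point z' of Γ, where it is itself
  -- of that size.
  refine ⟨c, l (axis s) / D (axis s), l, fun z hz => ?_, fun x hx hxy => ?_⟩
  · set lam := l (axis s) / D (axis s) with hlam
    have hlamle : |lam| ≤ K / g := by
      rw [hlam, abs_div, abs_of_neg (show D (axis s) < 0 by linarith)]
      rw [div_le_div_iff₀ (by linarith) hg]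
      nlinarith [abs_nonneg (l (axis s))]
    have b0 := mem_ball_of_norm_le (η := η) hz (by nlinarith)
    have nall : ∀ t : ℝ, |t| ≤ K₁ * h → ‖z + t • axis s - y‖ ≤ (R - 1) * h := by
      intro t ht
      have e : z + t • axis s - y = (z - y) + t • axis s := by abel
      rw [e]
      refine (norm_add_le _ _).trans ?_
      rw [norm_smul, norm_axis, mul_one, Real.norm_eq_abs, hR]
      linarith
    have hR1 : (R - 1) * h < η := by linarith
    have ball : ∀ t : ℝ, |t| ≤ K₁ * h → z + t • axis s ∈ Metric.ball y η := fun t ht =>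
      mem_ball_of_norm_le (nall t ht) hR1
    have lpz := abs_le.1 (hf.lipschitz byy b0)
    rw [hy0, sub_zero] at lpz
    have hzΛ : Λ * ‖z - y‖ ≤ Λ * (2 * h) := mul_le_mul_of_nonneg_left hz hΛ.le
    have hK₁h : 0 < K₁ * h := by positivity
    have hgK₁h : g * (K₁ * h) = (2 * Λ + 1) * h := by rw [← mul_assoc, hgK₁]
    have dp := hf.decrease hK₁h.le b0 (ball _ (by rw [abs_of_pos hK₁h]))
    have em : z + (-(K₁ * h)) • axis s + (K₁ * h) • axis s = z := by rw [neg_smul]; abel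
    have dm := hf.decrease hK₁h.le (ball (-(K₁ * h)) (by rw [abs_neg, abs_of_pos hK₁h]))
      (by rw [em]; exact b0)
    rw [em] at dm
    have hcont : ContinuousOn (fun t : ℝ => P.φ (z + t • axis s))
        (Set.Icc (-(K₁ * h)) (K₁ * h)) := by
      intro t ht
      have h1 : ContinuousAt P.φ (z + t • axis s) :=
        (hf.diff _ (ball t (abs_le.2 ht))).continuousAt
      have h2 : ContinuousAt (fun t : ℝ => z + t • axis s) t := by fun_prop
      exact (ContinuousAt.comp (f := fun t : ℝ => z + t • axis s) h1 h2).continuousWithinAt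
    -- By the choice of K₁, φ has opposite signs at the two ends of this segment.
    obtain ⟨t, ht, ht0⟩ := intermediate_value_Icc' (by linarith) hcont
      (show (0 : ℝ) ∈ Set.Icc _ _ from ⟨by nlinarith, by nlinarith⟩)
    simp only at ht0
    set z' := z + t • axis s with hz'
    have nz' := nall t (abs_le.2 ht)
    have bz' := ball t (abs_le.2 ht)
    have q1 := onΓ z' ht0 nz'
    have q2 := hf.taylor hM.le byy b0
    have q3 := hf.taylor hM.le byy bz'
    rw [hy0, sub_zero] at q2 q3
    rw [ht0, zero_sub, abs_neg] at q3
    have e : c + l z - lam * P.φ z = (c + l z') - lam * D (z' - y) -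
        lam * (P.φ z - D (z - y)) := by
      have e1 : z' - y = (z - y) + t • axis s := by rw [hz']; abel
      rw [e1, hz', map_add, map_add, map_smul, map_smul, smul_eq_mul, smul_eq_mul, mul_add]
      have : lam * (t * D (axis s)) = t * l (axis s) := by rw [hlam]; field_simp
      rw [this]; ring
    have q2' : |P.φ z - D (z - y)| ≤ M * (2 * h) ^ 2 :=
      q2.trans (mul_le_mul_of_nonneg_left (pow_le_pow_left₀ (norm_nonneg _) hz 2) hM.le)
    have q3' : |D (z' - y)| ≤ M * (R * h) ^ 2 :=
      q3.trans (mul_le_mul_of_nonneg_left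
        (pow_le_pow_left₀ (norm_nonneg _) (nz'.trans (by linarith)) 2) hM.le)
    have q4 : |lam * D (z' - y)| ≤ K / g * (M * (R * h) ^ 2) := by
      rw [abs_mul]; exact mul_le_mul hlamle q3' (abs_nonneg _) (by positivity)
    have q5 : |lam * (P.φ z - D (z - y))| ≤ K / g * (M * (2 * h) ^ 2) := by
      rw [abs_mul]; exact mul_le_mul hlamle q2' (abs_nonneg _) (by positivity)
    rw [e]
    refine (abs_sub _ _).trans ((add_le_add_left (abs_sub _ _) _).trans ?_)
    have : 0 ≤ (K₂ + R) * K * h ^ 2 := by positivity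
    have e2 : ((K₂ + R) ^ 2 + (K₂ + R) + M / g * (R ^ 2 + 4)) * K * h ^ 2 =
        (K₂ + R) ^ 2 * K * h ^ 2 + (K₂ + R) * K * h ^ 2 + (K / g * (M * (R * h) ^ 2) +
          K / g * (M * (2 * h) ^ 2)) := by ring
    rw [e2]
    linarith
  · obtain ⟨i1, i2⟩ := inner x hx (hxy.trans (by rw [hR]; nlinarith))
    have p1 : 0 ≤ M / g * (R ^ 2 + 4) := by positivity
    have p2 : 0 ≤ (K₂ + R) ^ 2 := by positivity
    have p3 : 0 ≤ K₂ + R := by positivity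
    constructor
    · refine i1.trans ?_
      gcongr
      linarith
    · refine i2.trans ?_
      rw [mul_assoc, mul_assoc]
      exact mul_le_mul_of_nonneg_right (by linarith) (by positivity)

end LevelSetDomain

/-! ### Linearity and locality of the form -/

theorem secondDiff_sub {n : ℕ} (v w : Idx n → ℝ) (α : Idx n) (i : Fin n) :
    Grid.secondDiff (fun α => v α - w α) α i = Grid.secondDiff v α i - Grid.secondDiff w α i := by
  simp only [Grid.secondDiff]; ring

theorem abs_secondDiff_le {n : ℕ} {w : Idx n → ℝ} {α : Idx n} {i : Fin n} {m : ℝ}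
    (h0 : |w α| ≤ m) (h1 : |w (α - dir i)| ≤ m) (h2 : |w (α + dir i)| ≤ m) :
    |Grid.secondDiff w α i| ≤ 4 * m := by
  rw [abs_le] at *
  simp only [Grid.secondDiff]
  constructor <;> linarith

theorem step_true {n : ℕ} (i : Fin n) : step (i, true) = dir i := by simp [step]

theorem step_false {n : ℕ} (i : Fin n) : step (i, false) = -dir i := by simp [step]

namespace LatticeDomain

variable {n : ℕ} (Q : LatticeDomain n)

theorem jump_sub (v w : Idx n → ℝ) (p : Idx n × Fin n) :
    Q.jump (fun α => v α - w α) p = Q.jump v p - Q.jump w p := by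
  simp only [jump]; ring

theorem abs_jump_le {w : Idx n → ℝ} {p : Idx n × Fin n} {m : ℝ}
    (h1 : |w p.1| ≤ m) (h2 : |w (p.1 + dir p.2)| ≤ m) : |Q.jump w p| ≤ 2 * m := by
  have hm : 0 ≤ m := (abs_nonneg _).trans h1
  set A := Q.ψ p.1 with hA
  set A' := Q.ψ (p.1 + dir p.2) with hA'
  have s1 : |A| ≤ Real.sqrt (A ^ 2 + A' ^ 2) := Real.abs_le_sqrt (by nlinarith [sq_nonneg A'])
  have s2 : |A'| ≤ Real.sqrt (A ^ 2 + A' ^ 2) := Real.abs_le_sqrt (by nlinarith [sq_nonneg A])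
  rw [jump, abs_div, abs_of_nonneg (Real.sqrt_nonneg _)]
  refine div_le_of_le_mul₀ (Real.sqrt_nonneg _) (by linarith) ?_
  refine (abs_sub _ _).trans ?_
  rw [abs_mul, abs_mul]
  have t1 := mul_le_mul s2 h1 (abs_nonneg _) (Real.sqrt_nonneg _)
  have t2 := mul_le_mul s1 h2 (abs_nonneg _) (Real.sqrt_nonneg _)
  linarith

theorem jump_const_mul_self (c : ℝ) (p : Idx n × Fin n) : Q.jump (fun α => c * Q.ψ α) p = 0 := by
  rw [jump, div_eq_zero_iff]; left; ring

theorem form_sub_left (σ γ : ℝ) (v w z : Idx n → ℝ) :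
    Q.form σ γ (fun α => v α - w α) z = Q.form σ γ v z - Q.form σ γ w z := by
  have e : Q.lap (fun α => v α - w α) z = Q.lap v z - Q.lap w z := by
    simp only [lap, ← Finset.sum_sub_distrib, sdiff]
    refine Finset.sum_congr rfl fun α _ => Finset.sum_congr rfl fun s _ => ?_
    ring
  simp only [form, e, jump_sub, secondDiff_sub, sub_mul, Finset.sum_sub_distrib]
  ring

theorem lap_eq (v z : Idx n → ℝ) : Q.lap v z = ∑ α ∈ Q.I, (∑ s, sdiff v α s) * z α := by
  simp only [lap, Finset.sum_mul]

/-- As w solves the scheme, its penalization and stabilization are already accounted for, and those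
of U appear as data. They are kept paired with the jumps and second differences of the test
function, against which the energy can absorb them. -/
theorem hasResidual_sub {σ γ m m' : ℝ} {U w ρ : Idx n → ℝ}
    (hw : ∀ z, Q.form σ γ w z = ∑ α ∈ Q.I, ρ α * z α)
    (h1 : ∀ α ∈ Q.I, α ∈ Q.layer → |∑ s, sdiff U α s - ρ α| ≤ m)
    (h2 : ∀ α ∈ Q.I, α ∉ Q.layer → |∑ s, sdiff U α s - ρ α| ≤ m')
    (h3 : ∀ p ∈ Q.B, |Q.jump U p| ≤ m)
    (h4 : ∀ p ∈ Q.ghost, |Grid.secondDiff U p.1 p.2| ≤ m) :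
    Q.HasResidual σ γ (fun α => U α - w α) m m' := by
  refine ⟨fun α => ∑ s, sdiff U α s - ρ α, Q.jump U, fun p => Grid.secondDiff U p.1 p.2,
    h1, h2, h3, h4, fun z => ?_⟩
  rw [form_sub_left, hw, form, lap_eq]
  simp only [sub_mul, Finset.sum_sub_distrib]
  ring

end LatticeDomain

/-! ### The scheme on the grid -/

/-- The discrete function with the values `z`. -/
def restrict {n : ℕ} (G : Grid n) (Ω : Set (Pt n)) (z : Idx n → ℝ) : G.DiscreteFn Ω := fun α => z α

theorem val_restrict {n : ℕ} {G : Grid n} {Ω : Set (Pt n)} (z : Idx n → ℝ) {α : Idx n}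
    (hα : α ∈ G.activeNodes Ω) : Grid.val (restrict G Ω z) α = z α := by
  simp [Grid.val, hα, restrict]

namespace LevelSetDomain

variable {n : ℕ} (P : LevelSetDomain n) {N : ℕ} (hN : 1 ≤ N)

theorem active_of_mem_I {α : Idx n} (h : α ∈ (P.lattice hN).I) : α ∈ (P.grid N).activeNodes P.Ω :=
  (P.mem_active_iff hN).2 (Or.inl ((P.mem_I_iff hN).1 h))

theorem active_add_step {α : Idx n} (h : α ∈ (P.lattice hN).I) (s : SDir n) :
    α + step s ∈ (P.grid N).activeNodes P.Ω :=
  (P.mem_active_iff hN).2 (Or.inr ⟨s.flip, by simpa using (P.mem_I_iff hN).1 h⟩)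

theorem active_add_dir {α : Idx n} (h : α ∈ (P.lattice hN).I) (i : Fin n) :
    α + dir i ∈ (P.grid N).activeNodes P.Ω := by
  rw [← step_true]; exact P.active_add_step hN h _

theorem active_sub_dir {α : Idx n} (h : α ∈ (P.lattice hN).I) (i : Fin n) :
    α - dir i ∈ (P.grid N).activeNodes P.Ω := by
  rw [sub_eq_add_neg, ← step_false]; exact P.active_add_step hN h _

theorem mem_B_iff {p : Idx n × Fin n} : p ∈ (P.lattice hN).B ↔
    p.1 ∈ (P.grid N).activeNodes P.Ω ∧ p.1 + dir p.2 ∈ (P.grid N).activeNodes P.Ω ∧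
      ((P.grid N).edge p.1 p.2 ∩ frontier P.Ω).Nonempty ∧
      ¬ (P.grid N).edge p.1 p.2 ⊆ frontier P.Ω := by
  classical
  change p ∈ (P.grid N).cutEdges P.Ω ↔ _
  simp only [Grid.cutEdges, Finset.mem_filter, Finset.mem_product, Finset.mem_univ, and_true]

theorem active_of_mem_B {p : Idx n × Fin n} (h : p ∈ (P.lattice hN).B) :
    p.1 ∈ (P.grid N).activeNodes P.Ω ∧ p.1 + dir p.2 ∈ (P.grid N).activeNodes P.Ω ∧
      ∃ y ∈ frontier P.Ω, ‖(P.grid N).node p.1 - y‖ ≤ (P.grid N).h ∧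
        ‖(P.grid N).node (p.1 + dir p.2) - y‖ ≤ (P.grid N).h := by
  rw [mem_B_iff] at h
  obtain ⟨ha, hb, ⟨y, hy, hyΓ⟩, -⟩ := h
  rw [Grid.edge, node_add_dir] at hy
  refine ⟨ha, hb, y, hyΓ, ?_⟩
  rw [node_add_dir]
  exact norm_sub_le_of_mem_edge (P.h_pos hN).le hy

theorem ghost_eq : (P.lattice hN).ghost = (P.grid N).ghostPairs P.Ω := by
  classical
  ext p
  rw [LatticeDomain.mem_ghost]
  simp only [Grid.ghostPairs, Finset.mem_filter, Finset.mem_product, Finset.mem_univ, and_true,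
    mem_I_iff, P.mem_interior_iff hN]

/-- The form reads only active nodes. Arbitrary lattice functions, such as ωv, can therefore be used
as test functions. -/
theorem form_congr (σ γ : ℝ) {v v' z z' : Idx n → ℝ}
    (hv : ∀ α ∈ (P.grid N).activeNodes P.Ω, v α = v' α)
    (hz : ∀ α ∈ (P.grid N).activeNodes P.Ω, z α = z' α) :
    (P.lattice hN).form σ γ v z = (P.lattice hN).form σ γ v' z' := by
  have e1 : (P.lattice hN).lap v z = (P.lattice hN).lap v' z' := by
    refine Finset.sum_congr rfl fun α hα => Finset.sum_congr rfl fun s _ => ?_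
    rw [sdiff, sdiff, hv _ (P.active_of_mem_I hN hα), hv _ (P.active_add_step hN hα s),
      hz _ (P.active_of_mem_I hN hα)]
  have e2 : ∀ p ∈ (P.lattice hN).B, (P.lattice hN).jump v p * (P.lattice hN).jump z p =
      (P.lattice hN).jump v' p * (P.lattice hN).jump z' p := by
    intro p hp
    obtain ⟨h1, h2, -⟩ := P.active_of_mem_B hN hp
    simp only [LatticeDomain.jump, hv _ h1, hv _ h2, hz _ h1, hz _ h2]
  have e3 : ∀ p ∈ (P.lattice hN).ghost, Grid.secondDiff v p.1 p.2 * Grid.secondDiff z p.1 p.2 =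
      Grid.secondDiff v' p.1 p.2 * Grid.secondDiff z' p.1 p.2 := by
    intro p hp
    have h0 := ((P.lattice hN).mem_ghost.1 hp).1
    have h1 := P.active_of_mem_I hN h0
    have h2 := P.active_add_dir hN h0 p.2
    have h3 := P.active_sub_dir hN h0 p.2
    simp only [Grid.secondDiff, hv _ h1, hv _ h2, hv _ h3, hz _ h1, hz _ h2, hz _ h3]
  rw [LatticeDomain.form, LatticeDomain.form, e1, Finset.sum_congr rfl e2, Finset.sum_congr rfl e3]

theorem sq_mul_aForm (σ γ : ℝ) (u v : (P.grid N).DiscreteFn P.Ω) :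
    (P.grid N).h ^ 2 * (P.grid N).aForm P.Ω P.φ σ γ u v =
      (P.lattice hN).form σ γ (Grid.val u) (Grid.val v) := by
  have hh := (P.h_pos hN).ne'
  have e1 : (P.grid N).h ^ 2 * (P.grid N).lapForm P.Ω u v =
      (P.lattice hN).lap (Grid.val u) (Grid.val v) := by
    rw [LatticeDomain.lap_eq, Grid.lapForm, Finset.mul_sum]
    refine Finset.sum_congr rfl fun α _ => ?_
    rw [sum_sdiff, Finset.sum_mul, Finset.mul_sum]
    refine Finset.sum_congr rfl fun i _ => ?_
    field_simp
  have e2 : (P.grid N).h ^ 2 * (P.grid N).bForm P.Ω P.φ γ u v = γ / 2 *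
      ∑ p ∈ (P.lattice hN).B, (P.lattice hN).jump (Grid.val u) p *
        (P.lattice hN).jump (Grid.val v) p := by
    rw [Grid.bForm, ← mul_assoc]
    congr 1
    · field_simp
    · refine Finset.sum_congr rfl fun p _ => ?_
      change _ = ((P.grid N).phiJump P.φ (Grid.val u) p.1 p.2 /
        Real.sqrt (P.φ ((P.grid N).node p.1) ^ 2 + P.φ ((P.grid N).node (p.1 + dir p.2)) ^ 2)) *
        ((P.grid N).phiJump P.φ (Grid.val v) p.1 p.2 / Real.sqrt
        (P.φ ((P.grid N).node p.1) ^ 2 + P.φ ((P.grid N).node (p.1 + dir p.2)) ^ 2))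
      rw [div_mul_div_comm, Real.mul_self_sqrt (by positivity)]
      ring
  have e3 : (P.grid N).h ^ 2 * (P.grid N).jForm P.Ω σ u v = σ *
      ∑ p ∈ (P.lattice hN).ghost, Grid.secondDiff (Grid.val u) p.1 p.2 *
        Grid.secondDiff (Grid.val v) p.1 p.2 := by
    rw [Grid.jForm, ghost_eq, mul_left_comm, Finset.mul_sum]
    congr 1
    refine Finset.sum_congr rfl fun p _ => ?_
    field_simp
  rw [Grid.aForm, mul_add, mul_add, e1, e2, e3, LatticeDomain.form]

theorem isDiscreteSolution_iff (σ γ : ℝ) (f : Pt n → ℝ) (u : (P.grid N).DiscreteFn P.Ω) :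
    (P.grid N).IsDiscreteSolution P.Ω P.φ σ γ f u ↔
      ∀ z, (P.lattice hN).form σ γ (Grid.val u) z =
        ∑ α ∈ (P.lattice hN).I, ((P.grid N).h ^ 2 * f ((P.grid N).node α)) * z α := by
  have hh : (P.grid N).h ^ 2 ≠ 0 := pow_ne_zero 2 (P.h_pos hN).ne'
  have e : ∀ v : (P.grid N).DiscreteFn P.Ω, (P.grid N).h ^ 2 * (P.grid N).lForm P.Ω f v =
      ∑ α ∈ (P.lattice hN).I, ((P.grid N).h ^ 2 * f ((P.grid N).node α)) * Grid.val v α := by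
    intro v
    rw [Grid.lForm, Finset.mul_sum]
    exact Finset.sum_congr rfl fun α _ => by ring
  constructor
  · intro h z
    have h1 := congrArg ((P.grid N).h ^ 2 * ·) (h (restrict _ _ z))
    simp only [e, P.sq_mul_aForm hN] at h1
    rw [← P.form_congr hN σ γ (fun α _ => rfl) (fun α hα => val_restrict z hα), h1]
    exact Finset.sum_congr rfl fun α hα => by rw [val_restrict z (P.active_of_mem_I hN hα)]
  · intro h v
    refine mul_left_cancel₀ hh ?_
    rw [P.sq_mul_aForm hN, h, e]

/-! ### Consistency -/

variable {η g Λ M : ℝ}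

open Classical in
/-- The values of `u` at the nodes in `Ω`, extended to their neighbors by Taylor expansion. -/
def extension (N : ℕ) (u : Pt n → ℝ) (α : Idx n) : ℝ :=
  if (P.grid N).node α ∈ P.Ω then u ((P.grid N).node α)
  else if h : ∃ s : SDir n, (P.grid N).node (α + step s) ∈ P.Ω then
    u ((P.grid N).node (α + step h.choose)) +
      fderiv ℝ u ((P.grid N).node (α + step h.choose))
        ((P.grid N).node α - (P.grid N).node (α + step h.choose))
  else 0

theorem extension_of_mem {u : Pt n → ℝ} {α : Idx n} (h : (P.grid N).node α ∈ P.Ω) :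
    P.extension N u α = u ((P.grid N).node α) := by
  rw [extension, if_pos h]

theorem abs_extension_sub_le (hN : 1 ≤ N) {u : Pt n → ℝ} {y : Pt n} {c m : ℝ} {l : Pt n →L[ℝ] ℝ}
    (hm : 0 ≤ m) (hx : ∀ x ∈ P.Ω, ‖x - y‖ ≤ 3 * (P.grid N).h → |u x - (c + l x)| ≤ m ∧
      ‖fderiv ℝ u x - l‖ * (P.grid N).h ≤ m) {α : Idx n}
    (hα : α ∈ (P.grid N).activeNodes P.Ω) (hy : ‖(P.grid N).node α - y‖ ≤ 2 * (P.grid N).h) :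
    |P.extension N u α - (c + l ((P.grid N).node α))| ≤ 2 * m := by
  have hh := P.h_pos hN
  by_cases h : (P.grid N).node α ∈ P.Ω
  · rw [P.extension_of_mem h]
    linarith [(hx _ h (by linarith)).1]
  · have hex := ((P.mem_active_iff hN).1 hα).resolve_left h
    rw [extension, if_neg h, dif_pos hex]
    have hs := hex.choose_spec
    set s := hex.choose
    set x' := (P.grid N).node (α + step s) with hx'
    set x := (P.grid N).node α
    have e : x' = x + (P.grid N).h • axis s := node_add_step _ _ _
    have n1 : ‖x' - y‖ ≤ 3 * (P.grid N).h := by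
      rw [e]; linarith [norm_add_smul_axis_sub_le s hh.le hy]
    have n2 : ‖x - x'‖ = (P.grid N).h := by
      rw [norm_sub_rev, e, add_sub_cancel_left, norm_smul, norm_axis, mul_one,
        Real.norm_of_nonneg hh.le]
    obtain ⟨h1, h2⟩ := hx x' hs n1
    have h3 := (fderiv ℝ u x' - l).le_opNorm (x - x')
    rw [n2, Real.norm_eq_abs, sub_apply] at h3
    have e2 : u x' + fderiv ℝ u x' (x - x') - (c + l x) =
        (u x' - (c + l x')) + (fderiv ℝ u x' (x - x') - l (x - x')) := by
      rw [map_sub l]; ring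
    rw [e2]
    refine (abs_add_le _ _).trans ?_
    linarith

theorem secondDiff_affine (G : Grid n) (c : ℝ) (l : Pt n →L[ℝ] ℝ) (α : Idx n) (i : Fin n) :
    Grid.secondDiff (fun α => c + l (G.node α)) α i = 0 := by
  have e : α - dir i = α + step (i, false) := by rw [step_false, sub_eq_add_neg]
  simp only [Grid.secondDiff]
  rw [e, node_add_step, node_add_dir, map_add, map_add]
  simp [axis]
  ring

/-- An edge that leaves Ω meets Γ, even if its two nodes are inside; it is then one of the edges of
B, whose ends are in the layer on a fine grid. -/
theorem segment_subset_of_not_mem_layer (hf : (P.lattice hN).IsFine) {α : Idx n}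
    (hα : α ∈ (P.lattice hN).I) (hl : α ∉ (P.lattice hN).layer) (s : SDir n) :
    segment ℝ ((P.grid N).node α) ((P.grid N).node α + (P.grid N).h • axis s) ⊆ P.Ω := by
  intro w hw
  by_contra hwΩ
  have hαΩ := (P.mem_I_iff hN).1 hα
  obtain ⟨y, hy, hyΓ⟩ := exists_mem_frontier_segment P.isOpen hαΩ hw hwΩ
  have hnot : ¬ (P.grid N).node α ∈ frontier P.Ω := fun h => (P.isOpen.frontier_eq ▸ h).2 hαΩ
  have ha := P.active_of_mem_I hN hα
  rw [← node_add_step] at hy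
  rcases s with ⟨i, b⟩
  cases b
  · have e : α - dir i + dir i = α := sub_add_cancel _ _
    have hB : (α - dir i, i) ∈ (P.lattice hN).B := by
      rw [mem_B_iff]
      simp only [Grid.edge, e]
      refine ⟨P.active_sub_dir hN hα i, ha, ⟨y, ?_, hyΓ⟩, fun hsub =>
        hnot (hsub (right_mem_segment ℝ _ _))⟩
      rw [segment_symm]
      simpa [step_false, sub_eq_add_neg] using hy
    have := (hf.near _ hB).2
    simp only [e] at this
    exact hl this
  · have hB : (α, i) ∈ (P.lattice hN).B := by
      rw [mem_B_iff]
      refine ⟨ha, P.active_add_dir hN hα i, ⟨y, ?_, hyΓ⟩, fun hsub =>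
        hnot (hsub (left_mem_segment ℝ _ _))⟩
      simpa [step_true, Grid.edge] using hy
    exact hl (hf.near _ hB).1

/-- Outside the layer the edges to all neighbors stay in Ω, so the extension is u itself there and
the usual fourth-order consistency applies. -/
theorem abs_residual_le_of_not_mem_layer (hf : (P.lattice hN).IsFine) {u : Pt n → ℝ} {K : ℝ}
    (hu : IsC4Bounded P.Ω u K) {α : Idx n}
    (hα : α ∈ (P.lattice hN).I) (hl : α ∉ (P.lattice hN).layer) :
    |∑ s, sdiff (P.extension N u) α s +
      (P.grid N).h ^ 2 * Laplacian.laplacian u ((P.grid N).node α)| ≤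
      2 * n * K * (P.grid N).h ^ 4 := by
  have hαΩ := (P.mem_I_iff hN).1 hα
  have hseg := P.segment_subset_of_not_mem_layer hN hf hα hl
  have hmem : ∀ s, (P.grid N).node (α + step s) ∈ P.Ω := fun s => by
    rw [node_add_step]; exact hseg s (right_mem_segment ℝ _ _)
  have key : ∀ i : Fin n, |Grid.secondDiff (P.extension N u) α i + (P.grid N).h ^ 2 *
      iteratedFDeriv ℝ 2 u ((P.grid N).node α) ![axis (i, true), axis (i, true)]| ≤
      2 * K * (P.grid N).h ^ 4 := by
    intro i
    have h2 : segment ℝ ((P.grid N).node α) ((P.grid N).node α + (P.grid N).h • -axis (i, true)) ⊆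
        P.Ω := by
      rw [← axis_flip]; exact hseg _
    have := hu.second_difference (P.h_pos hN).le (norm_axis _) (hseg (i, true)) h2
    rw [← abs_neg] at this
    convert this using 2
    have e : α - dir i = α + step (i, false) := by rw [step_false, sub_eq_add_neg]
    have m1 := hmem (i, true)
    have m2 := hmem (i, false)
    rw [step_true] at m1
    rw [← e] at m2
    rw [Grid.secondDiff, P.extension_of_mem m1, P.extension_of_mem m2, P.extension_of_mem hαΩ,
      e, node_add_step, node_add_dir]
    have : (-axis (i, true) : Pt n) = axis (i, false) := by simp [axis]
    rw [this]
    ring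
  rw [sum_sdiff, IsC4Bounded.laplacian_eq, Finset.mul_sum, ← Finset.sum_add_distrib]
  refine (Finset.abs_sum_le_sum_abs _ _).trans ((Finset.sum_le_sum fun i _ => key i).trans ?_)
  simp only [Finset.sum_const, Finset.card_univ, Fintype.card_fin, nsmul_eq_mul]
  exact le_of_eq (by ring)

/-- The extension of the solution satisfies the scheme up to second order in the boundary layer and
up to fourth order elsewhere. -/
theorem exists_residual_le (hη : 0 < η) (hg : 0 < g) (hΛ : 0 < Λ) (hM : 0 < M)
    (hflat : ∀ y ∈ frontier P.Ω, ∃ s, IsFlatAt P.φ y η g Λ M s) :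
    ∃ C h₁ : ℝ, 0 < C ∧ 0 < h₁ ∧ ∀ (N : ℕ) (hN : 1 ≤ N), (P.grid N).h < h₁ →
      (P.lattice hN).IsFine ∧ ∀ (f u : Pt n → ℝ) (K : ℝ), IsC4Bounded P.Ω u K →
      IsPoissonSolution P.Ω f u → ∀ (σ γ : ℝ) (uh : (P.grid N).DiscreteFn P.Ω),
      (P.grid N).IsDiscreteSolution P.Ω P.φ σ γ f uh →
      (P.lattice hN).HasResidual σ γ (fun α => P.extension N u α - Grid.val uh α)
        (C * K * (P.grid N).h ^ 2) (2 * n * K * (P.grid N).h ^ 4) := by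
  obtain ⟨C, h₁, hC, hh₁, H⟩ := P.exists_affine hη hg hΛ hM
  -- The term 8nC is for n second differences in the layer, 8C covers single second differences and
  -- jumps, and n is for h²Δu. The thresholds η/5 and g/(2M) are those of `isFine`.
  refine ⟨8 * (n + 1) * C + n, min h₁ (min (η / 5) (g / (2 * M))), by positivity, by positivity,
    fun N hN hlt => ?_⟩
  have hh := P.h_pos hN
  have hlt1 := hlt.trans_le (min_le_left _ _)
  have hlt2 := hlt.trans_le ((min_le_right _ _).trans (min_le_left _ _))
  have hlt3 := hlt.trans_le ((min_le_right _ _).trans (min_le_right _ _))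
  rw [lt_div_iff₀ (by norm_num)] at hlt2
  rw [lt_div_iff₀ (by positivity)] at hlt3
  have hfine : (P.lattice hN).IsFine :=
    P.isFine hN hM.le hg hflat (by linarith) (by linarith)
  refine ⟨hfine, fun f u K hu hsol σ γ uh huh => ?_⟩
  have hK := hu.nonneg
  set h := (P.grid N).h with hdef
  have hm : 0 ≤ C * K * h ^ 2 := by positivity
  have near : ∀ y ∈ frontier P.Ω, ∃ (c lam : ℝ) (l : Pt n →L[ℝ] ℝ),
      ∀ α ∈ (P.grid N).activeNodes P.Ω, ‖(P.grid N).node α - y‖ ≤ 2 * h →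
        |P.extension N u α - (c + l ((P.grid N).node α))| ≤ 2 * (C * K * h ^ 2) ∧
        |P.extension N u α - lam * (P.lattice hN).ψ α| ≤ 3 * (C * K * h ^ 2) := by
    intro y hy
    obtain ⟨s, hs⟩ := hflat y hy
    obtain ⟨c, lam, l, h1, h2⟩ := H y s hy hs h hh hlt1 u K hu hsol.continuousOn hsol.boundary
    refine ⟨c, lam, l, fun α hα hαy => ?_⟩
    have a1 := P.abs_extension_sub_le hN (u := u) (c := c) (l := l) hm (fun x hx hxy => by
      obtain ⟨b1, b2⟩ := h2 x hx hxy
      refine ⟨b1, ?_⟩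
      have := mul_le_mul_of_nonneg_right b2 hh.le
      rw [← hdef]
      linarith [show C * K * h * h = C * K * h ^ 2 by ring]) hα hαy
    refine ⟨a1, ?_⟩
    have a2 := h1 _ hαy
    have e : P.extension N u α - lam * (P.lattice hN).ψ α =
        (P.extension N u α - (c + l ((P.grid N).node α))) +
          (c + l ((P.grid N).node α) - lam * P.φ ((P.grid N).node α)) := by
      change _ - lam * P.φ ((P.grid N).node α) = _
      ring
    rw [e]
    refine (abs_add_le _ _).trans ?_
    linarith
  have hsec : ∀ α ∈ (P.lattice hN).I, α ∈ (P.lattice hN).layer → ∀ i,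
      |Grid.secondDiff (P.extension N u) α i| ≤ 8 * (C * K * h ^ 2) := by
    intro α hα hl i
    obtain ⟨y, hy, hαy⟩ := P.exists_frontier_near_layer hN hl
    obtain ⟨c, lam, l, hnear⟩ := near y hy
    have e := secondDiff_sub (P.extension N u) (fun α => c + l ((P.grid N).node α)) α i
    rw [secondDiff_affine, sub_zero] at e
    rw [← e]
    have hnb : ∀ s, ‖(P.grid N).node (α + step s) - y‖ ≤ 2 * h := by
      intro s
      rw [node_add_step]
      linarith [norm_add_smul_axis_sub_le s hh.le hαy]
    have n1 := hnb (i, true)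
    have n2 := hnb (i, false)
    rw [step_true] at n1
    rw [step_false, ← sub_eq_add_neg] at n2
    have := abs_secondDiff_le (i := i)
      (w := fun α => P.extension N u α - (c + l ((P.grid N).node α))) (hnear α (P.active_of_mem_I hN hα) (by linarith)).1
      (hnear _ (P.active_sub_dir hN hα i) n2).1 (hnear _ (P.active_add_dir hN hα i) n1).1
    refine this.trans (le_of_eq ?_)
    ring
  have hCm : ((8 * ((n : ℝ) + 1) * C + n) * K * h ^ 2) =
      n * (8 * (C * K * h ^ 2)) + 8 * (C * K * h ^ 2) + n * K * h ^ 2 := by ring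
  have p1 : 0 ≤ n * (8 * (C * K * h ^ 2)) := by positivity
  have p2 : 0 ≤ n * K * h ^ 2 := by positivity
  refine (P.lattice hN).hasResidual_sub ((P.isDiscreteSolution_iff hN σ γ f uh).1 huh) ?_ ?_ ?_ ?_
  -- No cancellation is sought in the layer: the second differences of U and h²Δu are each O(K h²).
  · intro α hα hl
    have hαΩ := (P.mem_I_iff hN).1 hα
    rw [sum_sdiff, ← hsol.equation _ hαΩ]
    have b1 : |∑ i, Grid.secondDiff (P.extension N u) α i| ≤ n * (8 * (C * K * h ^ 2)) := by
      refine (Finset.abs_sum_le_sum_abs _ _).trans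
        ((Finset.sum_le_sum fun i _ => hsec α hα hl i).trans ?_)
      simp
    have b2 := mul_le_mul_of_nonneg_left (hu.abs_laplacian_le hαΩ) (sq_nonneg h)
    refine (abs_sub _ _).trans ?_
    rw [abs_mul, abs_neg, abs_of_nonneg (sq_nonneg h), hCm]
    linarith
  · intro α hα hl
    rw [← hsol.equation _ ((P.mem_I_iff hN).1 hα), mul_neg, sub_neg_eq_add]
    exact P.abs_residual_le_of_not_mem_layer hN hfine hu hα hl
  · intro p hp
    obtain ⟨ha, hb, y, hy, n1, n2⟩ := P.active_of_mem_B hN hp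
    obtain ⟨c, lam, l, hnear⟩ := near y hy
    -- Subtracting lam φ does not change the jump and leaves values of size O(K h²).
    have e := (P.lattice hN).jump_sub (P.extension N u) (fun α => lam * (P.lattice hN).ψ α) p
    rw [LatticeDomain.jump_const_mul_self, sub_zero] at e
    rw [← e, hCm]
    have := (P.lattice hN).abs_jump_le (p := p)
      (w := fun α => P.extension N u α - lam * (P.lattice hN).ψ α) (hnear _ ha (by linarith)).2
      (hnear _ hb (by linarith)).2
    linarith
  · intro p hp
    have := hsec p.1 ((P.lattice hN).mem_ghost.1 hp).1 ((P.lattice hN).ghost_mem_layer hp) p.2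
    rw [hCm]
    linarith

end LevelSetDomain

/-! ### Absorption, the constant weight and the choice of ε. -/

theorem le_of_sq_le_add_mul {V T a b : ℝ} (hT : 0 ≤ T) (ha : 0 ≤ a) (hb : 0 ≤ b)
    (h : V ^ 2 ≤ a * T ^ 2 + b * (T * V)) : V ≤ (a + b + 1) * T := by
  by_contra! hlt
  have h1 : T ≤ V := by nlinarith [mul_nonneg ha hT, mul_nonneg hb hT]
  have h2 : 0 < V := lt_of_le_of_lt (by positivity) hlt
  have h3 : V ^ 2 ≤ (a + b) * T * V := by nlinarith [mul_nonneg ha hT, mul_nonneg ha (mul_nonneg hT (sub_nonneg.2 h1))]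
  have h4 : V ≤ (a + b) * T := by
    rw [sq] at h3; exact le_of_mul_le_mul_right h3 h2
  linarith

/-- A hyperplane has (N + 1)^(n-1) ≤ 4 N^(n-1) nodes. The scaling N^(2-n) gives the constant weight
the same O(N) hyperplane sum as the weights centered at a node. -/
theorem columnBound_const {n N : ℕ} (hn1 : 1 ≤ n) (hn3 : n ≤ 3) (hN : 1 ≤ N) :
    ColumnBound (n := n) N 4 fun _ => (N : ℝ) ^ 2 / (N : ℝ) ^ n := by
  have hN' : (1 : ℝ) ≤ N := by exact_mod_cast hN
  refine ⟨fun _ _ => (N : ℝ) ^ 2 / (N : ℝ) ^ n, fun _ _ => by positivity, fun _ _ _ => rfl,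
    fun i => ?_, fun _ _ _ => le_rfl⟩
  have hcard : (((idxBox n N).filter fun α => α i = 0).card : ℝ) = ((N : ℝ) + 1) ^ (n - 1) := by
    rw [idxBox_filter, Fintype.card_piFinset, ← prod_ite_const i, Nat.cast_prod]
    refine Finset.prod_congr rfl fun j _ => ?_
    split_ifs with h
    · simp
    · simp
  rw [Finset.sum_const, nsmul_eq_mul, hcard, mul_div_assoc', div_le_iff₀ (by positivity)]
  interval_cases n
  · norm_num; nlinarith
  · norm_num; nlinarith [mul_nonneg (sub_nonneg.2 hN') (sq_nonneg (N : ℝ))]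
  · norm_num
    have : ((N : ℝ) + 1) ^ 2 ≤ (2 * N) ^ 2 := pow_le_pow_left₀ (by positivity) (by linarith) 2
    nlinarith [sq_nonneg (N : ℝ)]

theorem slowlyVarying_const {n : ℕ} {c ε : ℝ} (hc : 0 < c) (hε : 0 ≤ ε) :
    SlowlyVarying (n := n) (fun _ => c) ε := by
  refine fun α => ⟨hc, fun s => ?_⟩
  simp only [sub_self, abs_zero]
  positivity

/-- An admissible relative variation of the weights. -/
def variation (n : ℕ) (σ γ : ℝ) : ℝ := coercConst n / (1 + (γ + σ) * LatticeDomain.commConst n)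

theorem variation_spec {n : ℕ} {σ γ : ℝ} (hσ : 1 ≤ σ) (hγ : 4 / coercConst n ≤ γ) :
    0 < variation n σ γ ∧ variation n σ γ ≤ coercConst n ∧
      (γ + σ) * variation n σ γ ^ 2 * LatticeDomain.commConst n ≤ coercConst n := by
  have h1 := coercConst_pos n
  have h2 := coercConst_le n
  have hγ0 : 0 < γ := lt_of_lt_of_le (by positivity) hγ
  have hc : 0 ≤ LatticeDomain.commConst n := by rw [LatticeDomain.commConst]; positivity
  have hX : 0 ≤ (γ + σ) * LatticeDomain.commConst n := by positivity
  set ε := variation n σ γ with hε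
  have e : ε * (1 + (γ + σ) * LatticeDomain.commConst n) = coercConst n := by
    rw [hε, variation]; field_simp
  have h0 : 0 < ε := by rw [hε, variation]; positivity
  have h3 : ε ≤ coercConst n := by nlinarith [mul_nonneg h0.le hX]
  refine ⟨h0, h3, ?_⟩
  have : (γ + σ) * ε ^ 2 * LatticeDomain.commConst n = ε * (ε * ((γ + σ) * LatticeDomain.commConst n)) := by ring
  rw [this]
  have h4 : 0 ≤ ε * ((γ + σ) * LatticeDomain.commConst n) := by positivity
  nlinarith

/-! ### Definiteness of the form. -/

namespace LatticeDomain

variable {n : ℕ} (Q : LatticeDomain n)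

/-- A function that is constant along the edges inside the domain and vanishes at the edges that
leave it is zero. -/
theorem eq_zero_of_cut (hn : 1 ≤ n) {v : Idx n → ℝ}
    (hint : ∀ p ∈ Q.intPairs, sdiff v p.1 p.2 = 0) (hcut : ∀ p ∈ Q.cutPairs, v p.1 = 0)
    {α : Idx n} (hα : α ∈ Q.I) : v α = 0 := by
  by_contra hv
  set s : SDir n := (⟨0, hn⟩, true) with hs
  -- A nonzero value would propagate along a ray that can never leave the domain, although the
  -- domain is finite.
  have key : ∀ k : ℕ, α + k • step s ∈ Q.I ∧ v (α + k • step s) = v α := by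
    intro k
    induction k with
    | zero => simpa using hα
    | succ k ih =>
      obtain ⟨h1, h2⟩ := ih
      rw [succ_nsmul, ← add_assoc]
      by_cases h : α + k • step s + step s ∈ Q.I
      · refine ⟨h, ?_⟩
        have := hint (α + k • step s, s) (Q.mem_intPairs.2 ⟨h1, h⟩)
        simp only [sdiff] at this
        linarith
      · have := hcut (α + k • step s, s) (Q.mem_cutPairs.2 ⟨h1, h⟩)
        simp only at this
        rw [h2] at this
        exact absurd this hv
  have hinj : Function.Injective fun k : ℕ => α + k • step s := by
    intro j k hjk
    have := congrFun (add_left_cancel hjk) ⟨0, hn⟩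
    simpa [hs, step, dir] using this
  exact (Set.infinite_of_injective_forall_mem (s := (Q.I : Set (Idx n))) hinj fun k => (key k).1)
    Q.I.finite_toSet

theorem sum_sq_eq_zero {ι : Type*} {S : Finset ι} {f : ι → ℝ} (h : ∑ p ∈ S, 1 * f p ^ 2 = 0) :
    ∀ p ∈ S, f p = 0 := by
  intro p hp
  have := (Finset.sum_eq_zero_iff_of_nonneg fun p _ => by positivity).1 h p hp
  simpa using this

theorem form_self (σ γ : ℝ) (v : Idx n → ℝ) : Q.form σ γ v v =
    Q.lap v v + γ / 2 * Q.eJump (fun _ => 1) v + σ * Q.eGhost (fun _ => 1) v := by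
  simp only [form, eJump, eGhost, one_mul, sq]

theorem lap_self (v : Idx n → ℝ) : Q.lap v v = 1 / 2 * Q.eInt (fun _ => 1) v +
    ∑ p ∈ Q.cutPairs, v p.1 * sdiff v p.1 p.2 := by
  have := Q.lap_weighted (fun _ => 1) v
  simpa [sdiff] using this

/-- The form is definite on the functions on which the penalization vanishes. -/
theorem lap_self_of_jump_eq_zero (hn : 1 ≤ n) {v : Idx n → ℝ}
    (hJ : Q.eJump (fun _ => 1) v = 0) (h : Q.lap v v ≤ 0) :
    (∀ α ∈ Q.I, v α = 0) ∧ ∀ p ∈ Q.cutPairs, v (p.1 + step p.2) = 0 := by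
  have hjump := sum_sq_eq_zero hJ
  have hb : ∀ p ∈ Q.cutPairs, 0 ≤ v p.1 * sdiff v p.1 p.2 ∧
      v p.1 ^ 2 ≤ 2 * sdiff v p.1 p.2 ^ 2 ∧
      v (p.1 + step p.2) ^ 2 ≤ 2 * sdiff v p.1 p.2 ^ 2 := by
    intro p hp
    have := Q.cut_bounds v hp
    rw [hjump _ (Q.edgeOf_mem hp)] at this
    simpa using this
  have hI : 0 ≤ Q.eInt (fun _ => 1) v :=
    Finset.sum_nonneg fun p _ => by positivity
  rw [lap_self] at h
  have hS : 0 ≤ ∑ p ∈ Q.cutPairs, v p.1 * sdiff v p.1 p.2 :=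
    Finset.sum_nonneg fun p hp => (hb p hp).1
  have hI0 := sum_sq_eq_zero (le_antisymm (by linarith : Q.eInt (fun _ => 1) v ≤ 0) hI)
  have hS0 := (Finset.sum_eq_zero_iff_of_nonneg fun p hp => (hb p hp).1).1
    (le_antisymm (by linarith) hS)
  have hz : ∀ p ∈ Q.cutPairs, v p.1 = 0 ∧ v (p.1 + step p.2) = 0 := by
    intro p hp
    obtain ⟨-, h2, h3⟩ := hb p hp
    -- If the inner value is 0, the vanishing jump forces the outer value to be 0, since φ ≠ 0 at
    -- the inner node; if the difference is 0, both values are bounded by it.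
    have hd : v p.1 = 0 ∨ sdiff v p.1 p.2 = 0 := by simpa using hS0 p hp
    rcases hd with hd | hd
    · refine ⟨hd, ?_⟩
      have hq := hjump _ (Q.edgeOf_mem hp)
      rw [mem_cutPairs, Q.mem_iff, Q.mem_iff] at hp
      obtain ⟨hp1, hp2⟩ := hp
      rcases p with ⟨α, i, b⟩
      have hne : ∀ x y : ℝ, x < 0 → Real.sqrt (x ^ 2 + y ^ 2) ≠ 0 ∧
          Real.sqrt (y ^ 2 + x ^ 2) ≠ 0 := fun x y hx => by
        have : 0 < x ^ 2 := sq_pos_of_ne_zero hx.ne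
        exact ⟨(Real.sqrt_pos.2 (by positivity)).ne', (Real.sqrt_pos.2 (by positivity)).ne'⟩
      cases b
      · simp only [step_false, ← sub_eq_add_neg] at *
        simp only [jump, edgeOf, Bool.false_eq_true, if_false, sub_add_cancel, div_eq_zero_iff,
          (hne _ (Q.ψ (α - dir i)) hp1).2, or_false, hd] at hq
        simpa [hp1.ne] using hq
      · simp only [step_true] at *
        simp only [jump, edgeOf, if_true, div_eq_zero_iff,
          (hne _ (Q.ψ (α + dir i)) hp1).1, or_false, hd] at hq
        simpa [hp1.ne] using hq
    · rw [hd] at h2 h3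
      constructor
      · exact pow_eq_zero_iff (two_ne_zero) |>.1 (le_antisymm (by linarith) (sq_nonneg _))
      · exact pow_eq_zero_iff (two_ne_zero) |>.1 (le_antisymm (by linarith) (sq_nonneg _))
  exact ⟨fun α hα => Q.eq_zero_of_cut hn hI0 (fun p hp => (hz p hp).1) hα, fun p hp => (hz p hp).2⟩

/-- On fine lattices the form is definite. -/
theorem eq_zero_of_form_self_le (hn : 1 ≤ n) (hQ : Q.IsFine) {σ γ : ℝ} (hσ : 1 ≤ σ)
    (hγ : 4 / coercConst n ≤ γ) {v : Idx n → ℝ} (h : Q.form σ γ v v ≤ 0) :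
    (∀ α ∈ Q.I, v α = 0) ∧ ∀ p ∈ Q.cutPairs, v (p.1 + step p.2) = 0 := by
  have hω : SlowlyVarying (n := n) (fun _ => 1) 0 := slowlyVarying_const one_pos le_rfl
  have hc := Q.coercive hQ hω le_rfl hσ hγ (coercConst_pos n).le
    (by simpa using (coercConst_pos n).le) v
  simp only [one_mul, sdiff, sub_self, Finset.sum_const_zero, mul_zero, add_zero] at hc
  have hE : Q.energy (fun _ => 1) v ≤ 0 := by
    by_contra! hlt
    have := mul_pos (coercConst_pos n) hlt
    linarith
  have a1 := Q.eInt_nonneg hω v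
  have a2 := Q.eCut_nonneg hω v
  have a3 := Q.eGhost_nonneg hω v
  have a4 := Q.eJump_nonneg hω v
  rw [energy] at hE
  refine Q.lap_self_of_jump_eq_zero hn (by linarith) ?_
  rw [form_self] at h
  have hγ0 : 0 < γ := lt_of_lt_of_le (div_pos (by norm_num) (coercConst_pos n)) hγ
  have : 0 ≤ γ / 2 * Q.eJump (fun _ => 1) v := by positivity
  have : 0 ≤ σ * Q.eGhost (fun _ => 1) v := mul_nonneg (by linarith) a3
  linarith

end LatticeDomain

/-! ### Error bounds on fine grids. -/

namespace LevelSetDomain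

variable {n : ℕ} (P : LevelSetDomain n) {η g Λ M : ℝ}

theorem sum_sdiff_nonneg_on_I {N : ℕ} (hN : 1 ≤ N) {ω : Idx n → ℝ}
    (hω : ∀ α ∈ idxBox n N, (∀ s, α + step s ∈ idxBox n N) → 0 ≤ ∑ s, sdiff ω α s) {α : Idx n}
    (hα : α ∈ (P.lattice hN).I) : 0 ≤ ∑ s, sdiff ω α s :=
  hω α (P.active_subset_box N (P.active_of_mem_I hN hα))
    fun s => P.active_subset_box N (P.active_add_step hN hα s)

/-- Maximum and energy bounds for the error on fine grids. -/
theorem exists_fine_estimate (hn1 : 1 ≤ n) (hn3 : n ≤ 3) (hη : 0 < η) (hg : 0 < g) (hΛ : 0 < Λ)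
    (hM : 0 < M) (hflat : ∀ y ∈ frontier P.Ω, ∃ s, IsFlatAt P.φ y η g Λ M s) :
    ∃ h₁ : ℝ, 0 < h₁ ∧ ∀ σ γ : ℝ, 1 ≤ σ → 4 / coercConst n ≤ γ → ∃ C : ℝ, 0 < C ∧
      ∀ (N : ℕ) (hN : 1 ≤ N), (P.grid N).h < h₁ → (P.lattice hN).IsFine ∧
      ∀ (f u : Pt n → ℝ) (K : ℝ), IsC4Bounded P.Ω u K →
      IsPoissonSolution P.Ω f u → ∀ (uh : (P.grid N).DiscreteFn P.Ω),
      (P.grid N).IsDiscreteSolution P.Ω P.φ σ γ f uh →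
      (∀ α ∈ (P.lattice hN).I, |(P.grid N).error P.Ω u uh α| ≤
        C * (K * ((P.grid N).h * Real.sqrt (P.grid N).h))) ∧
      (P.lattice hN).eInt (fun _ => (N : ℝ) ^ 2 / (N : ℝ) ^ n) ((P.grid N).error P.Ω u uh) ≤
        C * (K * ((P.grid N).h * Real.sqrt (P.grid N).h)) ^ 2 := by
  obtain ⟨C₁, h₁, hC₁, hh₁, H⟩ := P.exists_residual_le hη hg hΛ hM hflat
  obtain ⟨C₂, hC₂, HL⟩ := P.exists_sum_layer_le hη hg hΛ hflat
  refine ⟨min h₁ (η / 5), by positivity, fun σ γ hσ hγ => ?_⟩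
  obtain ⟨hε0, hε1, hε2⟩ := variation_spec hσ hγ
  set ε := variation n σ γ with hεdef
  obtain ⟨A, c, hA, hc, HW⟩ := exists_weight hn1 hn3 hε0
  have hκ0 := coercConst_pos n
  set κ := coercConst n with hκ
  have hγ0 : 0 < γ := lt_of_lt_of_le (by positivity) hγ
  have hS0 : 0 ≤ LatticeDomain.stabConst n σ γ := by
    rw [LatticeDomain.stabConst, LatticeDomain.youngConst]; positivity
  set S := LatticeDomain.stabConst n σ γ with hS
  have hL := P.L_pos
  set a := S * C₁ ^ 2 * C₂ * P.L with ha
  set b := 6 * n * P.L ^ 2 * Real.sqrt P.L with hb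
  have ha0 : 0 ≤ a := by positivity
  have hb0 : 0 ≤ b := by positivity
  set Cv := 2 / c * (a * A) + 2 / c * (b * A) + 1 with hCv
  have hCv0 : 0 < Cv := by positivity
  refine ⟨Cv + 2 / κ * (4 * a + 4 * b * Cv), by positivity, fun N hN hlt => ?_⟩
  have hh := P.h_pos hN
  have hlt1 := hlt.trans_le (min_le_left _ _)
  have hlt2 := hlt.trans_le (min_le_right _ _)
  rw [lt_div_iff₀ (by norm_num)] at hlt2
  obtain ⟨hfine, H⟩ := H N hN hlt1
  refine ⟨hfine, fun f u K hu hsol uh huh => ?_⟩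
  have hres := H f u K hu hsol σ γ uh huh
  have hK := hu.nonneg
  have hN' : (1 : ℝ) ≤ N := by exact_mod_cast hN
  have hLN : P.L = N * (P.grid N).h := by rw [grid_h]; field_simp
  have hhL : (P.grid N).h ≤ P.L := by rw [hLN]; nlinarith
  set h := (P.grid N).h with hdef
  set v : Idx n → ℝ := fun α => P.extension N u α - Grid.val uh α with hv
  have hverr : ∀ α ∈ (P.lattice hN).I, (P.grid N).error P.Ω u uh α = v α := by
    intro α hα
    simp only [Grid.error, hv, P.extension_of_mem ((P.mem_I_iff hN).1 hα)]
  set T := K * (h * Real.sqrt h) with hT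
  have hT0 : 0 ≤ T := by positivity
  have hT2 : T ^ 2 = K ^ 2 * h ^ 3 := by
    rw [hT, mul_pow, mul_pow, Real.sq_sqrt hh.le]; ring
  have hTh : K * h ^ 2 ≤ Real.sqrt P.L * T := by
    have e : K * h ^ 2 = K * (h * Real.sqrt h) * Real.sqrt h := by
      have := Real.mul_self_sqrt hh.le
      linear_combination -(K * h) * this
    rw [e, mul_comm]
    exact mul_le_mul_of_nonneg_right (Real.sqrt_le_sqrt hhL) hT0
  have hsub : (P.lattice hN).I ⊆ idxBox n N := fun α hα =>
    P.active_subset_box N (P.active_of_mem_I hN hα)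
  -- With T = K h^(3/2) and N = L/h, the layer contributes (K h²)² N ~ T², and the remaining nodes
  -- contribute K h⁴ N² V ~ K h² V, which is at most a multiple of TV since h ≤ L.
  have rhs : ∀ (A : ℝ) (ω : Idx n → ℝ) (V : ℝ), 0 ≤ A → (∀ α, 0 ≤ ω α) → ColumnBound N A ω →
      0 ≤ V → (∀ α ∈ (P.lattice hN).I, |v α| ≤ V) →
      S * (C₁ * K * h ^ 2) ^ 2 * ∑ α ∈ (P.lattice hN).layer, ω α +
        2 * n * K * h ^ 4 * ∑ α ∈ (P.lattice hN).I, ω α * |v α| ≤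
      a * A * T ^ 2 + b * A * (T * V) := by
    intro A ω V hA hω0 hω hV hvV
    have r1 := mul_le_mul_of_nonneg_left (HL N hN (by linarith) A ω hA hω0 hω)
      (show 0 ≤ S * (C₁ * K * h ^ 2) ^ 2 by positivity)
    have r2 : ∑ α ∈ (P.lattice hN).I, ω α * |v α| ≤ 3 * A * (N : ℝ) ^ 2 * V := by
      refine (Finset.sum_le_sum fun α hα =>
        mul_le_mul_of_nonneg_left (hvV α hα) (hω0 α)).trans ?_
      rw [← Finset.sum_mul]
      exact mul_le_mul_of_nonneg_right (hω.sum_box_le hn1 hN hA hsub) hV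
    have r3 := mul_le_mul_of_nonneg_left r2 (show 0 ≤ 2 * n * K * h ^ 4 by positivity)
    have e1 : S * (C₁ * K * h ^ 2) ^ 2 * (C₂ * A * N) = a * A * T ^ 2 := by
      rw [hT2, ha, hLN]; ring
    have e2 : 2 * n * K * h ^ 4 * (3 * A * (N : ℝ) ^ 2 * V) =
        6 * n * P.L ^ 2 * A * V * (K * h ^ 2) := by rw [hLN]; ring
    have r4 := mul_le_mul_of_nonneg_left hTh (show 0 ≤ 6 * n * P.L ^ 2 * A * V by positivity)
    have e3 : 6 * n * P.L ^ 2 * A * V * (Real.sqrt P.L * T) = b * A * (T * V) := by rw [hb]; ring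
    linarith
  have hmax : ∀ α ∈ (P.lattice hN).I, |v α| ≤ Cv * T := by
    intro α hα
    -- The weight is centered at a maximum of |v|, so that the same |v(α₀)| bounds v on the
    -- right-hand side and occurs squared on the left.
    obtain ⟨α₀, hα₀, hmax⟩ := Finset.exists_max_image _ (fun α => |v α|) ⟨α, hα⟩
    refine (hmax α hα).trans ?_
    obtain ⟨ω, hω, hω1, hω2, hω3⟩ := HW N hN α₀ (hsub hα₀)
    have st := (P.lattice hN).stability hfine hω hε0.le hσ hγ hε1 hε2 (by positivity) hres
    have r := rhs A ω |v α₀| hA.le (fun α => (hω.pos α).le) hω3 (abs_nonneg _) hmax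
    have hE : 0 ≤ (P.lattice hN).energy ω v := by
      rw [LatticeDomain.energy]
      have := (P.lattice hN).eInt_nonneg hω v
      have := (P.lattice hN).eCut_nonneg hω v
      have := (P.lattice hN).eGhost_nonneg hω v
      have := (P.lattice hN).eJump_nonneg hω v
      linarith
    have hsum : v α₀ ^ 2 * c ≤ ∑ α ∈ (P.lattice hN).I, v α ^ 2 * ∑ s, sdiff ω α s := by
      refine le_trans ?_ (Finset.single_le_sum (f := fun α => v α ^ 2 * ∑ s, sdiff ω α s)
        (fun α hα => mul_nonneg (sq_nonneg _) (P.sum_sdiff_nonneg_on_I hN hω1 hα)) hα₀)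
      exact mul_le_mul_of_nonneg_left
        (hω2 fun s => P.active_subset_box N (P.active_add_step hN hα₀ s)) (sq_nonneg _)
    have hκE : 0 ≤ 1 / 2 * κ * (P.lattice hN).energy ω v := by positivity
    have h5 : 1 / 2 * (v α₀ ^ 2 * c) ≤ a * A * T ^ 2 + b * A * (T * |v α₀|) := by linarith
    refine le_of_sq_le_add_mul hT0 (by positivity) (by positivity) ?_
    rw [sq_abs]
    have e : v α₀ ^ 2 = 2 / c * (1 / 2 * (v α₀ ^ 2 * c)) := by field_simp
    rw [e]
    refine (mul_le_mul_of_nonneg_left h5 (by positivity)).trans (le_of_eq ?_)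
    ring
  have hextra : 0 ≤ 2 / κ * (4 * a + 4 * b * Cv) := by positivity
  refine ⟨fun α hα => ?_, ?_⟩
  · rw [hverr α hα]
    refine (hmax α hα).trans (mul_le_mul_of_nonneg_right (by linarith) hT0)
  -- A constant weight has zero Laplacian and variation; only the energy remains on the left, and
  -- the maximum bound just obtained is inserted on the right.
  · set w : ℝ := (N : ℝ) ^ 2 / (N : ℝ) ^ n with hw
    have hw0 : 0 < w := by positivity
    have hω : SlowlyVarying (n := n) (fun _ => w) ε := slowlyVarying_const hw0 hε0.le
    have e : (P.lattice hN).eInt (fun _ => w) ((P.grid N).error P.Ω u uh) =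
        (P.lattice hN).eInt (fun _ => w) v := by
      refine Finset.sum_congr rfl fun p hp => ?_
      rw [LatticeDomain.mem_intPairs] at hp
      simp only [sdiff]
      rw [hverr _ hp.1, hverr _ hp.2]
    rw [e]
    have st := (P.lattice hN).stability hfine hω hε0.le hσ hγ hε1 hε2 (by positivity) hres
    have r := rhs 4 (fun _ => w) (Cv * T) (by norm_num) (fun _ => hw0.le)
      (columnBound_const hn1 hn3 hN) (by positivity) hmax
    simp only [sdiff, sub_self, Finset.sum_const_zero, mul_zero, add_zero] at st
    have a1 := (P.lattice hN).eInt_nonneg hω v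
    have a2 := (P.lattice hN).eCut_nonneg hω v
    have a3 := (P.lattice hN).eGhost_nonneg hω v
    have a4 := (P.lattice hN).eJump_nonneg hω v
    have hE : (P.lattice hN).eInt (fun _ => w) v ≤ (P.lattice hN).energy (fun _ => w) v := by
      rw [LatticeDomain.energy]; linarith
    have h5 : 1 / 2 * κ * (P.lattice hN).eInt (fun _ => w) v ≤ (4 * a + 4 * b * Cv) * T ^ 2 := by
      have := mul_le_mul_of_nonneg_left hE (show 0 ≤ 1 / 2 * κ by positivity)
      have : a * 4 * T ^ 2 + b * 4 * (T * (Cv * T)) = (4 * a + 4 * b * Cv) * T ^ 2 := by ring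
      linarith
    have e2 : (P.lattice hN).eInt (fun _ => w) v =
        2 / κ * (1 / 2 * κ * (P.lattice hN).eInt (fun _ => w) v) := by field_simp
    rw [e2]
    refine (mul_le_mul_of_nonneg_left h5 (by positivity)).trans ?_
    rw [← mul_assoc]
    exact mul_le_mul_of_nonneg_right (by linarith) (sq_nonneg _)

end LevelSetDomain

/-! ### Solvability of the discrete problem -/

namespace LatticeDomain

variable {n : ℕ} (Q : LatticeDomain n)

theorem jump_add (v w : Idx n → ℝ) (p : Idx n × Fin n) :
    Q.jump (v + w) p = Q.jump v p + Q.jump w p := by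
  simp only [jump, Pi.add_apply]; ring

theorem jump_smul (c : ℝ) (v : Idx n → ℝ) (p : Idx n × Fin n) :
    Q.jump (c • v) p = c * Q.jump v p := by
  simp only [jump, Pi.smul_apply, smul_eq_mul]; ring

theorem secondDiff_add (v w : Idx n → ℝ) (α : Idx n) (i : Fin n) :
    Grid.secondDiff (v + w) α i = Grid.secondDiff v α i + Grid.secondDiff w α i := by
  simp only [Grid.secondDiff, Pi.add_apply]; ring

theorem secondDiff_smul (c : ℝ) (v : Idx n → ℝ) (α : Idx n) (i : Fin n) :
    Grid.secondDiff (c • v) α i = c * Grid.secondDiff v α i := by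
  simp only [Grid.secondDiff, Pi.smul_apply, smul_eq_mul]; ring

/-- The form as a bilinear map. -/
def bilin (σ γ : ℝ) : (Idx n → ℝ) →ₗ[ℝ] (Idx n → ℝ) →ₗ[ℝ] ℝ :=
  LinearMap.mk₂ ℝ (Q.form σ γ)
    (fun v w z => by
      simp only [form, lap_eq, sum_sdiff, jump_add, secondDiff_add, Finset.sum_add_distrib, add_mul]
      ring)
    (fun c v z => by
      simp only [form, lap_eq, sum_sdiff, jump_smul, secondDiff_smul, ← Finset.mul_sum, mul_assoc,
        smul_eq_mul]
      ring)
    (fun v w z => by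
      simp only [form, lap_eq, sum_sdiff, jump_add, secondDiff_add, Pi.add_apply,
        Finset.sum_add_distrib, mul_add]
      ring)
    (fun c v z => by
      simp only [form, lap_eq, sum_sdiff, jump_smul, secondDiff_smul, Pi.smul_apply,
        mul_left_comm _ c, ← Finset.mul_sum, smul_eq_mul]
      ring)

end LatticeDomain

theorem val_add {n : ℕ} {G : Grid n} {Ω : Set (Pt n)} (u v : G.DiscreteFn Ω) :
    Grid.val (u + v) = Grid.val u + Grid.val v := by
  funext α
  simp only [Grid.val, Pi.add_apply]
  split_ifs <;> simp

theorem val_smul {n : ℕ} {G : Grid n} {Ω : Set (Pt n)} (c : ℝ) (u : G.DiscreteFn Ω) :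
    Grid.val (c • u) = c • Grid.val u := by
  funext α
  simp only [Grid.val, Pi.smul_apply]
  split_ifs <;> simp

@[fun_prop]
theorem continuous_val {n : ℕ} {G : Grid n} {Ω : Set (Pt n)} (α : Idx n) :
    Continuous fun u : G.DiscreteFn Ω => Grid.val u α := by
  simp only [Grid.val]
  split_ifs
  · fun_prop
  · fun_prop

theorem abs_val_le {n : ℕ} {G : Grid n} {Ω : Set (Pt n)} (u : G.DiscreteFn Ω) (α : Idx n) :
    |Grid.val u α| ≤ ‖u‖ := by
  simp only [Grid.val]
  split_ifs with h
  · exact norm_le_pi_norm u ⟨α, h⟩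
  · simp

/-- Evaluation as a linear map. -/
def valₗ {n : ℕ} (G : Grid n) (Ω : Set (Pt n)) : G.DiscreteFn Ω →ₗ[ℝ] Idx n → ℝ where
  toFun := Grid.val
  map_add' := val_add
  map_smul' := val_smul

namespace LevelSetDomain

variable {n : ℕ} (P : LevelSetDomain n) {N : ℕ} (hN : 1 ≤ N)

/-- The form on discrete functions. -/
def gridForm (σ γ : ℝ) :
    (P.grid N).DiscreteFn P.Ω →ₗ[ℝ] (P.grid N).DiscreteFn P.Ω →ₗ[ℝ] ℝ :=
  ((P.lattice hN).bilin σ γ).compl₁₂ (valₗ _ _) (valₗ _ _)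

theorem gridForm_apply (σ γ : ℝ) (u v : (P.grid N).DiscreteFn P.Ω) :
    P.gridForm hN σ γ u v = (P.lattice hN).form σ γ (Grid.val u) (Grid.val v) := rfl

/-- The load of the scheme, multiplied by `h²`. -/
def gridLoad (f : Pt n → ℝ) : (P.grid N).DiscreteFn P.Ω →ₗ[ℝ] ℝ :=
  ∑ α ∈ (P.lattice hN).I, ((P.grid N).h ^ 2 * f ((P.grid N).node α)) •
    (LinearMap.proj α).comp (valₗ (P.grid N) P.Ω)

theorem gridLoad_apply (f : Pt n → ℝ) (v : (P.grid N).DiscreteFn P.Ω) :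
    P.gridLoad hN f v =
      ∑ α ∈ (P.lattice hN).I, ((P.grid N).h ^ 2 * f ((P.grid N).node α)) * Grid.val v α := by
  simp [gridLoad, valₗ]

theorem isDiscreteSolution_iff_gridForm (σ γ : ℝ) (f : Pt n → ℝ) (u : (P.grid N).DiscreteFn P.Ω) :
    (P.grid N).IsDiscreteSolution P.Ω P.φ σ γ f u ↔
      P.gridForm hN σ γ u = P.gridLoad hN f := by
  rw [P.isDiscreteSolution_iff hN]
  constructor
  · intro h
    refine LinearMap.ext fun v => ?_
    rw [gridForm_apply, gridLoad_apply, h]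
  · intro h z
    have h1 := LinearMap.congr_fun h (restrict _ _ z)
    rw [gridForm_apply, gridLoad_apply,
      P.form_congr hN σ γ (fun α _ => rfl) (fun α hα => val_restrict z hα)] at h1
    rw [h1]
    exact Finset.sum_congr rfl fun α hα => by rw [val_restrict z (P.active_of_mem_I hN hα)]

/-- Definiteness makes the map from a discrete function to its functional injective, hence bijective
by equality of finite dimensions. -/
theorem exists_unique_discreteSolution {σ γ : ℝ}
    (hdef : ∀ v, P.gridForm hN σ γ v v ≤ 0 → v = 0) (f : Pt n → ℝ) :
    ∃ uh, (P.grid N).IsDiscreteSolution P.Ω P.φ σ γ f uh ∧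
      ∀ wh, (P.grid N).IsDiscreteSolution P.Ω P.φ σ γ f wh → wh = uh := by
  have hinj : Function.Injective (P.gridForm hN σ γ) := by
    rw [injective_iff_map_eq_zero]
    intro v hv
    exact hdef v (by rw [hv]; simp)
  have hsurj := (LinearMap.injective_iff_surjective_of_finrank_eq_finrank
    (Subspace.dual_finrank_eq (K := ℝ) (V := (P.grid N).DiscreteFn P.Ω)).symm).1 hinj
  obtain ⟨uh, huh⟩ := hsurj (P.gridLoad hN f)
  refine ⟨uh, (P.isDiscreteSolution_iff_gridForm hN σ γ f uh).2 huh, fun wh hwh => hinj ?_⟩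
  rw [huh, (P.isDiscreteSolution_iff_gridForm hN σ γ f wh).1 hwh]

theorem eq_zero_of_val {v : (P.grid N).DiscreteFn P.Ω}
    (h : (∀ α ∈ (P.lattice hN).I, Grid.val v α = 0) ∧
      ∀ p ∈ (P.lattice hN).cutPairs, Grid.val v (p.1 + step p.2) = 0) : v = 0 := by
  have key : ∀ α ∈ (P.grid N).activeNodes P.Ω, Grid.val v α = 0 := by
    intro α hα
    by_cases hI : α ∈ (P.lattice hN).I
    · exact h.1 α hI
    · rw [mem_I_iff] at hI
      obtain ⟨s, hs⟩ := ((P.mem_active_iff hN).1 hα).resolve_left hI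
      have := h.2 (α + step s, s.flip) (by
        rw [LatticeDomain.mem_cutPairs, mem_I_iff, mem_I_iff]
        simpa using ⟨hs, hI⟩)
      simpa using this
  funext ⟨α, hα⟩
  have := key α hα
  simpa [Grid.val, hα] using this

theorem gridForm_smul_self (σ γ c : ℝ) (v : (P.grid N).DiscreteFn P.Ω) :
    P.gridForm hN σ γ (c • v) (c • v) = c ^ 2 * P.gridForm hN σ γ v v := by
  simp only [map_smul, LinearMap.smul_apply, smul_eq_mul]
  ring

theorem continuous_gridForm_self (σ γ : ℝ) : Continuous fun v => P.gridForm hN σ γ v v := by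
  simp only [gridForm_apply, LatticeDomain.form, LatticeDomain.lap, LatticeDomain.jump, sdiff,
    Grid.secondDiff]
  fun_prop

theorem le_gridForm_of_sphere {σ γ c : ℝ}
    (h : ∀ v ∈ Metric.sphere (0 : (P.grid N).DiscreteFn P.Ω) 1, c ≤ P.gridForm hN σ γ v v)
    (v : (P.grid N).DiscreteFn P.Ω) : c * ‖v‖ ^ 2 ≤ P.gridForm hN σ γ v v := by
  rcases eq_or_ne v 0 with rfl | hv
  · simp
  · have hv' : 0 < ‖v‖ := norm_pos_iff.2 hv
    have h1 := h (‖v‖⁻¹ • v) (by simp [norm_smul, hv'.ne'])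
    rw [gridForm_smul_self, inv_pow, ← div_eq_inv_mul, le_div_iff₀ (by positivity)] at h1
    exact h1

/-- On each grid the form is definite for large parameters. -/
theorem exists_params_definite (hn : 1 ≤ n) : ∃ s : ℝ, ∀ σ γ : ℝ, s ≤ σ → s ≤ γ →
    ∀ v, P.gridForm hN σ γ v v ≤ 0 → v = 0 := by
  set Q := P.lattice hN with hQ
  set p : (P.grid N).DiscreteFn P.Ω → ℝ := fun v =>
    Q.eJump (fun _ => 1) (Grid.val v) + Q.eGhost (fun _ => 1) (Grid.val v) with hp
  have hJ : ∀ v : (P.grid N).DiscreteFn P.Ω, 0 ≤ Q.eJump (fun _ => 1) (Grid.val v) := fun v =>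
    Finset.sum_nonneg fun _ _ => by positivity
  have hG : ∀ v : (P.grid N).DiscreteFn P.Ω, 0 ≤ Q.eGhost (fun _ => 1) (Grid.val v) := fun v =>
    Finset.sum_nonneg fun _ _ => by positivity
  have hp0 : ∀ v, 0 ≤ p v := fun v => add_nonneg (hJ v) (hG v)
  -- On the unit sphere, where the penalties p vanish the Laplacian part is positive, and elsewhere
  -- a large multiple of p dominates. These open sets increase with k, so by compactness a single k
  -- works.
  obtain ⟨k, hk⟩ := (isCompact_sphere (0 : (P.grid N).DiscreteFn P.Ω) 1).elim_directed_cover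
    (fun k : ℕ => {v | 0 < Q.lap (Grid.val v) (Grid.val v) + k * p v})
    (fun k => isOpen_lt continuous_const (by
      simp only [hp, LatticeDomain.lap, LatticeDomain.eJump, LatticeDomain.eGhost,
        LatticeDomain.jump, sdiff, Grid.secondDiff]
      fun_prop))
    (fun v hv => by
      rw [Set.mem_iUnion]
      rcases eq_or_lt_of_le (hp0 v) with h0 | h0
      · refine ⟨0, ?_⟩
        simp only [Set.mem_ofPred_eq, Nat.cast_zero, zero_mul, add_zero]
        by_contra! hcon
        have hJ0 : Q.eJump (fun _ => 1) (Grid.val v) = 0 := by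
          have := hJ v; have := hG v; simp only [hp] at h0; linarith
        have := P.eq_zero_of_val hN (Q.lap_self_of_jump_eq_zero hn hJ0 hcon)
        rw [this] at hv
        simp at hv
      · obtain ⟨k, hk⟩ := exists_nat_gt (-Q.lap (Grid.val v) (Grid.val v) / p v)
        refine ⟨k, ?_⟩
        rw [div_lt_iff₀ h0] at hk
        simp only [Set.mem_ofPred_eq]
        linarith)
    (directed_of_isDirected_le fun i j hij v hv => by
      simp only [Set.mem_ofPred_eq] at hv ⊢
      have : (i : ℝ) * p v ≤ j * p v :=
        mul_le_mul_of_nonneg_right (by exact_mod_cast hij) (hp0 v)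
      linarith)
  -- The factor 2 compensates for γ/2 in front of the penalization.
  refine ⟨2 * k, fun σ γ hσ hγ v hv => ?_⟩
  by_contra hne
  have hv' : 0 < ‖v‖ := norm_pos_iff.2 hne
  have hw := hk (show ‖v‖⁻¹ • v ∈ Metric.sphere (0 : (P.grid N).DiscreteFn P.Ω) 1 by
    simp [norm_smul, hv'.ne'])
  set w := ‖v‖⁻¹ • v with hwdef
  simp only [Set.mem_ofPred_eq] at hw
  have e1 : P.gridForm hN σ γ w w ≤ 0 := by
    rw [hwdef, gridForm_smul_self]
    exact mul_nonpos_of_nonneg_of_nonpos (sq_nonneg _) hv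
  rw [gridForm_apply, LatticeDomain.form_self] at e1
  have k0 : (0 : ℝ) ≤ k := Nat.cast_nonneg k
  have b1 := mul_le_mul_of_nonneg_right (show (k : ℝ) ≤ γ / 2 by linarith) (hJ w)
  have b2 := mul_le_mul_of_nonneg_right (show (k : ℝ) ≤ σ by linarith) (hG w)
  simp only [hp, mul_add] at hw
  linarith

/-- A crude bound for the error on a given grid. -/
theorem exists_error_le {σ γ : ℝ} (hdef : ∀ v, P.gridForm hN σ γ v v ≤ 0 → v = 0) :
    ∃ C : ℝ, 0 < C ∧ ∀ (f u : Pt n → ℝ) (K : ℝ), IsC4Bounded P.Ω u K →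
      IsPoissonSolution P.Ω f u → ∀ uh, (P.grid N).IsDiscreteSolution P.Ω P.φ σ γ f uh →
      ∀ α ∈ (P.lattice hN).I, |(P.grid N).error P.Ω u uh α| ≤ C * K := by
  -- The definite form has a positive lower bound c on the unit sphere of the maximum norm, which
  -- bounds u_h by the load, and the load by K through f = -Δu.
  obtain ⟨c, hc, hmin⟩ := (isCompact_sphere (0 : (P.grid N).DiscreteFn P.Ω) 1).exists_forall_le'
    (P.continuous_gridForm_self hN σ γ).continuousOn (a := 0) (fun v hv => by
      by_contra! hcon
      rw [hdef v hcon] at hv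
      simp at hv)
  refine ⟨1 + (P.grid N).h ^ 2 * (P.lattice hN).I.card * n / c, by positivity,
    fun f u K hu hsol uh huh α hα => ?_⟩
  have hK := hu.nonneg
  have h1 := P.le_gridForm_of_sphere hN hmin uh
  rw [(P.isDiscreteSolution_iff_gridForm hN σ γ f uh).1 huh, gridLoad_apply] at h1
  have h2 : ∑ α ∈ (P.lattice hN).I, ((P.grid N).h ^ 2 * f ((P.grid N).node α)) * Grid.val uh α ≤
      (P.lattice hN).I.card * ((P.grid N).h ^ 2 * (n * K) * ‖uh‖) := by
    rw [← nsmul_eq_mul]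
    refine Finset.sum_le_card_nsmul _ _ _ fun α hα => ?_
    have hΩ := (P.mem_I_iff hN).1 hα
    refine (le_abs_self _).trans ?_
    rw [abs_mul, abs_mul, abs_of_nonneg (sq_nonneg _), ← hsol.equation _ hΩ, abs_neg]
    exact mul_le_mul (mul_le_mul_of_nonneg_left (hu.abs_laplacian_le hΩ) (sq_nonneg _))
      (abs_val_le uh α) (abs_nonneg _) (by positivity)
  have h3 : ‖uh‖ ≤ (P.grid N).h ^ 2 * (P.lattice hN).I.card * n / c * K := by
    rcases eq_or_lt_of_le (norm_nonneg uh) with h0 | h0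
    · rw [← h0]; positivity
    · have h4 : c * ‖uh‖ * ‖uh‖ ≤ (P.lattice hN).I.card * ((P.grid N).h ^ 2 * (n * K)) * ‖uh‖ := by
        linarith
      have h5 := le_of_mul_le_mul_right h4 h0
      rw [div_mul_eq_mul_div, le_div_iff₀ hc]
      linarith
  have h4 := abs_val_le uh α
  have h5 := hu.abs_le ((P.mem_I_iff hN).1 hα)
  rw [Grid.error]
  refine (abs_sub _ _).trans ?_
  linarith

/-! ### Discrete norms -/

/-- The L² norm follows from the maximum because the grid has (N + 1)^n nodes and h(N + 1) ≤ 2L. For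
the seminorm, h^n / h² is L^n / L² times the constant weight N² / N^n, and each edge in a positive
direction is one of the directed interior edges. -/
theorem norms_le {w : Idx n → ℝ} {E E' : ℝ} (hE : 0 ≤ E) (hE' : 0 ≤ E')
    (h1 : ∀ α ∈ (P.lattice hN).I, |w α| ≤ E)
    (h2 : (P.lattice hN).eInt (fun _ => (N : ℝ) ^ 2 / (N : ℝ) ^ n) w ≤ E' ^ 2) :
    (P.grid N).normL2 P.Ω w + (P.grid N).normLinf P.Ω w + (P.grid N).seminormH1 P.Ω w ≤
      (Real.sqrt ((2 * P.L) ^ n) + 1) * E + Real.sqrt (P.L ^ n / P.L ^ 2) * E' := by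
  classical
  have hL := P.L_pos
  have hh := P.h_pos hN
  have hN' : (1 : ℝ) ≤ N := by exact_mod_cast hN
  have hN0 : (0 : ℝ) < N := by linarith
  have hLN : P.L = N * (P.grid N).h := by rw [grid_h]; field_simp
  have a1 : (P.grid N).normL2 P.Ω w ≤ Real.sqrt ((2 * P.L) ^ n) * E := by
    rw [Grid.normL2]
    refine Real.sqrt_le_iff.2 ⟨by positivity, ?_⟩
    rw [mul_pow, Real.sq_sqrt (by positivity)]
    have hs : ∑ α ∈ (P.grid N).interiorNodes P.Ω, w α ^ 2 ≤ ((N : ℝ) + 1) ^ n * E ^ 2 := by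
      have c1 : ∑ α ∈ (P.grid N).interiorNodes P.Ω, w α ^ 2 ≤
          ∑ α ∈ idxBox n N, E ^ 2 := by
        refine (Finset.sum_le_sum fun α hα => ?_).trans
          (Finset.sum_le_sum_of_subset_of_nonneg (Finset.filter_subset _ _)
            fun _ _ _ => sq_nonneg E)
        rw [← sq_abs]
        exact pow_le_pow_left₀ (abs_nonneg _) (h1 α hα) 2
      refine c1.trans (le_of_eq ?_)
      rw [Finset.sum_const, nsmul_eq_mul, idxBox, Pi.card_Icc]
      simp
    calc (P.grid N).h ^ n * ∑ α ∈ (P.grid N).interiorNodes P.Ω, w α ^ 2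
        ≤ (P.grid N).h ^ n * (((N : ℝ) + 1) ^ n * E ^ 2) :=
          mul_le_mul_of_nonneg_left hs (by positivity)
      _ = ((P.grid N).h * ((N : ℝ) + 1)) ^ n * E ^ 2 := by rw [mul_pow]; ring
      _ ≤ (2 * P.L) ^ n * E ^ 2 := by
          refine mul_le_mul_of_nonneg_right (pow_le_pow_left₀ (by positivity) ?_ n) (sq_nonneg _)
          rw [hLN]; nlinarith
  have a2 : (P.grid N).normLinf P.Ω w ≤ E := Real.iSup_le (fun α => h1 α α.2) hE
  have a3 : (P.grid N).seminormH1 P.Ω w ≤ Real.sqrt (P.L ^ n / P.L ^ 2) * E' := by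
    rw [Grid.seminormH1]
    refine Real.sqrt_le_iff.2 ⟨by positivity, ?_⟩
    rw [mul_pow, Real.sq_sqrt (by positivity)]
    refine le_trans ?_ (mul_le_mul_of_nonneg_left h2 (by positivity))
    rw [LatticeDomain.eInt, Finset.mul_sum]
    have := sum_le_sum_of_injOn_maps (S := ((P.grid N).interiorNodes P.Ω ×ˢ
      (Finset.univ : Finset (Fin n))).filter (fun p => p.1 + dir p.2 ∈ (P.grid N).interiorNodes P.Ω))
      (T := (P.lattice hN).intPairs) (fun p => (p.1, ((p.2, true) : SDir n)))
      (fun p _ q _ h => by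
        simp only [Prod.mk.injEq] at h
        exact Prod.ext h.1 h.2.1)
      (fun p hp => by
        rw [Finset.mem_filter, Finset.mem_product] at hp
        rw [LatticeDomain.mem_intPairs, step_true]
        exact ⟨hp.1.1, hp.2⟩)
      (g := fun p => P.L ^ n / P.L ^ 2 * ((N : ℝ) ^ 2 / (N : ℝ) ^ n * sdiff w p.1 p.2 ^ 2))
      (fun q _ => by positivity)
    refine le_trans (le_of_eq (Finset.sum_congr rfl fun p _ => ?_)) this
    simp only [sdiff, step_true]
    rw [sq_abs, grid_h, div_pow]
    field_simp
    ring
  linarith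

end LevelSetDomain

/-! ### The cells that meet Ω cover its closure. -/

theorem isClosed_cell {n : ℕ} (G : Grid n) (β : Idx n) : IsClosed (G.cell β) := by
  have e : G.cell β = ⋂ i, {x | G.node β i ≤ x i} ∩ {x | x i ≤ G.node β i + G.h} := by
    ext x; simp [Grid.cell]
  rw [e]
  refine isClosed_iInter fun i => IsClosed.inter ?_ ?_
  · exact isClosed_le continuous_const (by fun_prop)
  · exact isClosed_le (by fun_prop) continuous_const

theorem isClosed_cover {n : ℕ} (G : Grid n) (Ω : Set (Pt n)) : IsClosed (G.cover Ω) := by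
  have e : G.cover Ω = ⋃ β ∈ {β : Idx n | (∀ i, 0 ≤ β i ∧ β i < (G.N : ℤ)) ∧
      (G.cell β ∩ Ω).Nonempty}, G.cell β := by
    ext x; simp [Grid.cover, and_assoc]
  rw [e]
  refine Set.Finite.isClosed_biUnion ?_ fun β _ => isClosed_cell G β
  refine (idxBox n G.N).finite_toSet.subset fun β hβ => ?_
  rw [Finset.mem_coe, mem_idxBox]
  exact fun i => ⟨(hβ.1 i).1, (hβ.1 i).2.le⟩

theorem closure_subset_cover {n N : ℕ} (hN : 1 ≤ N) {a : Pt n} {L : ℝ} (hL : 0 < L)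
    {Ω : Set (Pt n)} (hΩ : Ω ⊆ box a L) : closure Ω ⊆ (cubeGrid a L N).cover Ω := by
  refine closure_minimal (fun x hx => ?_) (isClosed_cover _ _)
  have hN' : (0 : ℝ) < N := by exact_mod_cast hN
  have hh : 0 < L / N := div_pos hL hN'
  -- The minimum with N - 1 assigns the points on the upper faces of the cube to the last cell.
  have hcell : x ∈ (cubeGrid a L N).cell fun i => min ⌊(x i - a i) / (L / N)⌋ ((N : ℤ) - 1) := by
    intro i
    obtain ⟨h1, h2⟩ := hΩ hx i
    simp only [Grid.node, cubeGrid]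
    have f1 := Int.floor_le ((x i - a i) / (L / N))
    have f2 := Int.lt_floor_add_one ((x i - a i) / (L / N))
    rw [le_div_iff₀ hh] at f1
    rw [div_lt_iff₀ hh] at f2
    constructor
    · have : ((min ⌊(x i - a i) / (L / N)⌋ ((N : ℤ) - 1) : ℤ) : ℝ) ≤ ⌊(x i - a i) / (L / N)⌋ := by
        exact_mod_cast min_le_left _ _
      nlinarith
    · rcases min_choice ⌊(x i - a i) / (L / N)⌋ ((N : ℤ) - 1) with h | h <;> rw [h]
      · linarith
      · push_cast
        have : (N : ℝ) * (L / N) = L := by field_simp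
        linarith
  refine ⟨_, fun i => ⟨le_min ?_ (by omega), (min_le_right _ _).trans_lt (by
    change (N : ℤ) - 1 < N
    omega)⟩, ⟨x, hcell, hx⟩, hcell⟩
  exact Int.floor_nonneg.2 (div_nonneg (by linarith [(hΩ hx i).1]) hh.le)

theorem exists_pos_div_lt {L c : ℝ} (hc : 0 < c) : ∃ N₁ : ℕ, 1 ≤ N₁ ∧ ∀ N : ℕ, N₁ ≤ N →
    L / N < c := by
  obtain ⟨N₁, h⟩ := exists_nat_gt (|L| / c)
  refine ⟨N₁ + 1, by omega, fun N hN => ?_⟩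
  have hN' : (N₁ : ℝ) + 1 ≤ N := by exact_mod_cast hN
  have h0 : (0 : ℝ) ≤ N₁ := Nat.cast_nonneg _
  rw [div_lt_iff₀ hc] at h
  rw [div_lt_iff₀ (by linarith)]
  have := le_abs_self L
  nlinarith

theorem exists_uniform_bound {p : ℕ → ℝ → Prop} (hmono : ∀ N x y, x ≤ y → p N x → p N y)
    (h : ∀ N, ∃ x, p N x) (N₁ : ℕ) : ∃ x, ∀ N < N₁, p N x := by
  choose x hx using h
  obtain ⟨M, hM⟩ := ((Finset.range N₁).image x).exists_le
  exact ⟨M, fun N hN => hmono N _ _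
    (hM _ (Finset.mem_image_of_mem _ (Finset.mem_range.2 hN))) (hx N)⟩

/-! ### Assembly over coarse and fine grids. -/

namespace LevelSetDomain

variable {n : ℕ} (P : LevelSetDomain n)

/-- Unique solvability and the error bound with constant `C` on the grid with `N` cells per
direction. -/
def Converges (σ γ : ℝ) (N : ℕ) (C : ℝ) : Prop :=
  ∀ f u : Pt n → ℝ, ∀ K : ℝ, IsC4Bounded P.Ω u K → IsPoissonSolution P.Ω f u →
    ∃ uh : (P.grid N).DiscreteFn P.Ω, (P.grid N).IsDiscreteSolution P.Ω P.φ σ γ f uh ∧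
      (∀ wh, (P.grid N).IsDiscreteSolution P.Ω P.φ σ γ f wh → wh = uh) ∧
      (P.grid N).normL2 P.Ω ((P.grid N).error P.Ω u uh) +
        (P.grid N).normLinf P.Ω ((P.grid N).error P.Ω u uh) +
        (P.grid N).seminormH1 P.Ω ((P.grid N).error P.Ω u uh) ≤
      C * (K * ((P.grid N).h * Real.sqrt (P.grid N).h))

theorem Converges.mono {σ γ : ℝ} {N : ℕ} {C C' : ℝ} (hN : 1 ≤ N) (h : P.Converges σ γ N C)
    (hC : C ≤ C') : P.Converges σ γ N C' := by
  intro f u K hu hsol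
  obtain ⟨uh, h1, h2, h3⟩ := h f u K hu hsol
  have := hu.nonneg
  have := P.h_pos hN
  exact ⟨uh, h1, h2, h3.trans (mul_le_mul_of_nonneg_right hC (by positivity))⟩

/-- On a fixed grid h^(3/2) is just a positive number, and dividing the crude bound by it yields an
admissible constant. -/
theorem exists_converges_of_definite {N : ℕ} (hN : 1 ≤ N) {σ γ : ℝ}
    (hdef : ∀ v, P.gridForm hN σ γ v v ≤ 0 → v = 0) : ∃ C, P.Converges σ γ N C := by
  have hh := P.h_pos hN
  have hL := P.L_pos
  have hN0 : (0 : ℝ) < N := by exact_mod_cast hN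
  obtain ⟨C, hC, hest⟩ := P.exists_error_le hN hdef
  set w : ℝ := (N : ℝ) ^ 2 / (N : ℝ) ^ n with hw
  have hw0 : 0 < w := by positivity
  set D := Real.sqrt ((P.lattice hN).intPairs.card * (w * (2 * C) ^ 2)) with hD
  set H := (P.grid N).h * Real.sqrt (P.grid N).h with hH
  have hH0 : 0 < H := mul_pos hh (Real.sqrt_pos.2 hh)
  refine ⟨((Real.sqrt ((2 * P.L) ^ n) + 1) * C + Real.sqrt (P.L ^ n / P.L ^ 2) * D) / H,
    fun f u K hu hsol => ?_⟩
  obtain ⟨uh, h1, h2⟩ := P.exists_unique_discreteSolution hN hdef f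
  refine ⟨uh, h1, h2, ?_⟩
  have hK := hu.nonneg
  have hE := hest f u K hu hsol uh h1
  have hI : (P.lattice hN).eInt (fun _ => w) ((P.grid N).error P.Ω u uh) ≤ (D * K) ^ 2 := by
    rw [mul_pow, hD, Real.sq_sqrt (by positivity), LatticeDomain.eInt, mul_assoc, ← nsmul_eq_mul]
    refine Finset.sum_le_card_nsmul _ _ _ fun p hp => ?_
    rw [LatticeDomain.mem_intPairs] at hp
    have : |sdiff ((P.grid N).error P.Ω u uh) p.1 p.2| ≤ 2 * C * K := by
      rw [sdiff]
      refine (abs_sub _ _).trans ?_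
      linarith [hE _ hp.1, hE _ hp.2]
    have := pow_le_pow_left₀ (abs_nonneg _) this 2
    rw [sq_abs] at this
    have := mul_le_mul_of_nonneg_left this hw0.le
    linarith
  refine (P.norms_le hN (by positivity) (by positivity) hE hI).trans (le_of_eq ?_)
  rw [← hH]
  field_simp

/-- Fine grids have uniform constants by weighted stability. Only the finitely many N < N₁ remain;
their thresholds for the parameters and their constants are combined by taking a maximum. The
parameter threshold is fixed before σ and γ are chosen, while C may depend on them. -/
theorem exists_converges (hn1 : 1 ≤ n) (hn3 : n ≤ 3) : ∃ s : ℝ, 0 < s ∧ ∀ σ γ : ℝ, s ≤ σ →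
    s ≤ γ → ∃ C, 0 < C ∧ ∀ N : ℕ, 1 ≤ N → P.Converges σ γ N C := by
  have hL := P.L_pos
  obtain ⟨η, g, Λ, M, hη, hg, hΛ, hM, hflat⟩ := exists_uniform_flat P.isCompact_frontier
    (fun y hy => P.contDiffAt y (frontier_subset_closure hy)) P.levelSet.fderiv_ne_zero
  obtain ⟨h₁, hh₁, hfine⟩ := P.exists_fine_estimate hn1 hn3 hη hg hΛ hM hflat
  obtain ⟨N₁, -, hN₁⟩ := exists_pos_div_lt (L := P.L) hh₁
  obtain ⟨s, hs⟩ := exists_uniform_bound (p := fun N s => ∀ hN : 1 ≤ N, ∀ σ γ : ℝ, s ≤ σ → s ≤ γ →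
    ∀ v, P.gridForm hN σ γ v v ≤ 0 → v = 0)
    (fun N x y hxy h hN σ γ hσ hγ => h hN σ γ (hxy.trans hσ) (hxy.trans hγ))
    (fun N => by
      by_cases hN : 1 ≤ N
      · obtain ⟨s, hs⟩ := P.exists_params_definite hN hn1
        exact ⟨s, fun _ => hs⟩
      · exact ⟨0, fun h => absurd h hN⟩) N₁
  refine ⟨max s (max 1 (4 / coercConst n)),
    lt_max_of_lt_right (lt_max_of_lt_left one_pos), fun σ γ hσ hγ => ?_⟩
  have hσ1 : 1 ≤ σ := ((le_max_left _ _).trans (le_max_right _ _)).trans hσ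
  have hγ1 : 4 / coercConst n ≤ γ := ((le_max_right _ _).trans (le_max_right _ _)).trans hγ
  obtain ⟨C₁, hC₁, hfine⟩ := hfine σ γ hσ1 hγ1
  obtain ⟨C₂, hC₂⟩ := exists_uniform_bound (p := fun N C => 1 ≤ N → N < N₁ → P.Converges σ γ N C)
    (fun N x y hxy h hN hlt => (h hN hlt).mono P hN hxy)
    (fun N => by
      by_cases hN : 1 ≤ N ∧ N < N₁
      · obtain ⟨C, hC⟩ := P.exists_converges_of_definite hN.1 (hs N hN.2 hN.1 σ γ
          ((le_max_left _ _).trans hσ) ((le_max_left _ _).trans hγ))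
        exact ⟨C, fun _ _ => hC⟩
      · exact ⟨0, fun h h' => absurd ⟨h, h'⟩ hN⟩) N₁
  set C₃ := (Real.sqrt ((2 * P.L) ^ n) + 1) * C₁ +
    Real.sqrt (P.L ^ n / P.L ^ 2) * Real.sqrt C₁ with hC₃
  have hC₃0 : 0 < C₃ := by positivity
  refine ⟨max C₂ C₃, lt_max_of_lt_right hC₃0, fun N hN => ?_⟩
  rcases lt_or_ge N N₁ with hlt | hge
  · exact (hC₂ N hlt hN hlt).mono P hN (le_max_left _ _)
  · refine Converges.mono P hN (C := C₃) (fun f u K hu hsol => ?_) (le_max_right _ _)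
    obtain ⟨hQ, hest⟩ := hfine N hN (hN₁ N hge)
    obtain ⟨uh, h1, h2⟩ := P.exists_unique_discreteSolution hN (σ := σ) (γ := γ)
      (fun v hv => P.eq_zero_of_val hN
        ((P.lattice hN).eq_zero_of_form_self_le hn1 hQ hσ1 hγ1 hv)) f
    obtain ⟨hE, hI⟩ := hest f u K hu hsol uh h1
    have hK := hu.nonneg
    have hh := P.h_pos hN
    refine ⟨uh, h1, h2, ?_⟩
    set T := K * ((P.grid N).h * Real.sqrt (P.grid N).h) with hT
    have hT0 : 0 ≤ T := by positivity
    refine (P.norms_le hN (E' := Real.sqrt C₁ * T) (by positivity) (by positivity) hE ?_).trans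
      (le_of_eq ?_)
    · rwa [mul_pow, Real.sq_sqrt hC₁.le]
    · rw [hC₃]; ring

end LevelSetDomain

end PhiFD

end

theorem theorem1 (n : ℕ) (hn1 : 1 ≤ n) (hn3 : n ≤ 3)
    (a : PhiFD.Pt n) (L : ℝ) (hL : 0 < L)
    (Ω : Set (PhiFD.Pt n)) (hΩo : IsOpen Ω) (hΩc : IsConnected Ω) (hΩbox : Ω ⊆ PhiFD.box a L)
    (φ : PhiFD.Pt n → ℝ) (hφ : PhiFD.IsLevelSet Ω φ)
    (r : ℝ) (hr : 0 < r) (hΩr : PhiFD.IsRSmooth Ω r)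
    (hφC2 : ∀ N : ℕ, 1 ≤ N → L / N < 2 * r / Real.sqrt 10 →
      PhiFD.IsC2OnClosed φ ((PhiFD.cubeGrid a L N).cover Ω)) :
    ∃ σ₀ γ₀ : ℝ, 0 < σ₀ ∧ 0 < γ₀ ∧ ∀ σ γ : ℝ, σ₀ ≤ σ → γ₀ ≤ γ →
      ∃ C : ℝ, 0 < C ∧
        ∀ N : ℕ, 1 ≤ N → L / N < 2 * r / Real.sqrt 10 →
          ∀ f u : PhiFD.Pt n → ℝ, PhiFD.IsPoissonSolution Ω f u → PhiFD.MemC4 Ω u →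
            ∃ uh : (PhiFD.cubeGrid a L N).DiscreteFn Ω,
              (PhiFD.cubeGrid a L N).IsDiscreteSolution Ω φ σ γ f uh ∧
              (∀ wh : (PhiFD.cubeGrid a L N).DiscreteFn Ω,
                (PhiFD.cubeGrid a L N).IsDiscreteSolution Ω φ σ γ f wh → wh = uh) ∧
              (PhiFD.cubeGrid a L N).normL2 Ω ((PhiFD.cubeGrid a L N).error Ω u uh) +
                (PhiFD.cubeGrid a L N).normLinf Ω ((PhiFD.cubeGrid a L N).error Ω u uh) +
                (PhiFD.cubeGrid a L N).seminormH1 Ω ((PhiFD.cubeGrid a L N).error Ω u uh) ≤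
              C * (L / N) ^ (3 / 2 : ℝ) * (PhiFD.c4Norm Ω u).toReal := by
  -- A single fine enough grid gives the regularity of φ on the whole closure of Ω, because its
  -- cover contains that closure.
  obtain ⟨N₀, hN₀, hlt⟩ := PhiFD.exists_pos_div_lt (L := L) (c := 2 * r / Real.sqrt 10)
    (by positivity)
  let P : PhiFD.LevelSetDomain n := ⟨a, L, Ω, φ, hL, hΩo, hΩbox, hφ, fun x hx =>
    hφC2 N₀ hN₀ (hlt N₀ le_rfl) x (PhiFD.closure_subset_cover hN₀ hL hΩbox hx)⟩
  obtain ⟨s, hs, hconv⟩ := P.exists_converges hn1 hn3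
  refine ⟨s, s, hs, hs, fun σ γ hσ hγ => ?_⟩
  obtain ⟨C, hC, hconv⟩ := hconv σ γ hσ hγ
  refine ⟨C, hC, fun N hN _ f u hsol hu => ?_⟩
  obtain ⟨uh, h1, h2, h3⟩ := hconv N hN f u _ (hu.isC4Bounded hΩo) hsol
  refine ⟨uh, h1, h2, h3.trans (le_of_eq ?_)⟩
  have hh : 0 < L / N := P.h_pos hN
  have e : (L / N) ^ (3 / 2 : ℝ) = L / N * Real.sqrt (L / N) := by
    rw [show (3 / 2 : ℝ) = 1 + 1 / 2 by norm_num, Real.rpow_add hh, Real.rpow_one,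
      Real.sqrt_eq_rpow]
  rw [e]
  change C * ((PhiFD.c4Norm Ω u).toReal * (L / N * Real.sqrt (L / N))) = _
  ring
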